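/- Let $C$ be a compact connected complex curve whose only singularities are nodes $z_1,\dots,z_k$, let $\mathbf x=(x_1,\dots,x_n)$ be distinct smooth points of $C$, and let $\pi:C'\to C$ be the normalisation, $\pi^{-1}(z_l)=\{y_l,y_l'\}$. Let $P$ be a smooth principal $S^1$-bundle over $C\setminus\{x_1,\dots,x_n,z_1,\dots,z_k\}$, also viewed as a bundle on $C'$ minus the points $x_j,y_l,y_l'$. For $y\in\{x_j,y_l,y_l'\}$ let $T(P,y)$ be the set of homotopy classes of trivialisations of $P$ over a small loop around $y$; such a class is represented by a trivialisation of $P$ over a punctured coordinate disk around $y$. Let $\tau=(\tau_j)_j$ with $\tau_j\in T(P,x_j)$, and for every node let $(\xi_l,\xi_l')\in T(P,y_l)\times T(P,y_l')$. Let $A$ be a smooth connection on $P$ whose curvature $F_A$ extends to a continuous $2$-form on $C'$. For a trivialisation of class $\xi$ over a punctured disk around $y$ with polar coordinates $(r,\theta)$, in which $d_A=d+\alpha$ with $\alpha$ an $\mathbf i\mathbb R$-valued $1$-form, the residue is $$\operatorname{Res}(A,y,\xi)=\lim_{\epsilon\to0}\frac1{2\pi}\int_{r=\epsilon}\alpha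 ,$$ the circle being oriented counterclockwise. Suppose that $A$ is meromorphic on $P$ marked by the classes $\sigma_l=[(\xi_l,\xi_l')]$, i.e. that $\operatorname{Res}(A,y_l,\xi_l)+\operatorname{Res}(A,y_l',\xi_l')=0$ for every $l$. Let $C^s$ be a smoothing of $C$: it is obtained from $C'$ by choosing disjoint holomorphic unit coordinate disks with coordinates $u_l,u_l'$ centred at $y_l,y_l'$ (and avoiding the $x_j$) and numbers $0<|\epsilon_l|<1$, removing the disks $|u_l|\le|\epsilon_l|$, $|u_l'|\le|\epsilon_l|$, and identifying the points with $u_lu_l'=\epsilon_l$. Let $Q=P^{A}(\tau)$ be the principal $S^1$-bundle over the compact Riemann surface $C^s$ obtained from $P$ by identifying, over points with $u_lu_l'=\epsilon_l$, the trivialisations $\xi_l$ and $\xi_l'$, and by extending $P$ over each $x_j$ so that $\tau_j$ extends to a trivialisation near $x_j$. Its degree $\deg P^A(\tau)\in\mathbb Z$ is the sum of the indices (winding numbers in local trivialisations along small counterclockwise circles) of any section of $Q$ with finitely many singularities. Then $$\deg P^A(\tau)=\frac{\mathbf i}{2\pi}\int_{C}F_A+\mathbf i\sum_{j=1}^n\operatorname{Res}(A,x_j,\tau_j),$$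 where $\int_CF_A$ is the integral over the normalisation $C'$. (If $C$ is smooth, then $C^s=C$ and $Q$ is the extension of $P$ to $C$ determined by $\tau$.) -/

import Mathlib

open Set Filter MeasureTheory
open scoped Manifold ContDiff Topology

namespace ChernWeil

noncomputable section

/-- A Riemann surface is in particular a smooth real surface. -/
instance instIsManifoldReal {X : Type*} [TopologicalSpace X] [ChartedSpace ℂ X]
    [IsManifold 𝓘(ℂ) ω X] : IsManifold 𝓘(ℝ, ℂ) ∞ X := by
  refine isManifold_of_contDiffOn 𝓘(ℝ, ℂ) ∞ X fun e e' he he' => ?_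
  have h := (contDiffGroupoid ω 𝓘(ℂ)).compatible he he'
  rw [contDiffGroupoid, mem_groupoid_of_pregroupoid] at h
  have h1 : ContDiffOn ℂ ω _ _ := h.1
  exact (h1.restrict_scalars ℝ).of_le le_top

section Forms

variable {X : Type*} [TopologicalSpace X] [ChartedSpace ℂ X]

/-- Complex valued `1`-forms on a surface (no regularity imposed). -/
abbrev OneForm (X : Type*) [TopologicalSpace X] [ChartedSpace ℂ X] : Type _ :=
  ∀ x : X, TangentSpace 𝓘(ℝ, ℂ) x →L[ℝ] ℂ

/-- The expression of a `1`-form in a coordinate chart `e`, i.e. its pull-back by `e.symm`. -/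
def inChart (a : OneForm X) (e : OpenPartialHomeomorph X ℂ) (w : ℂ) : ℂ →L[ℝ] ℂ :=
  (a (e.symm w)).comp (mfderiv 𝓘(ℝ, ℂ) 𝓘(ℝ, ℂ) e.symm w)

/-- Smoothness of a `1`-form on an open set, read in the charts. -/
def SmoothFormOn (a : OneForm X) (V : Set X) : Prop :=
  ∀ e ∈ atlas ℂ X, ContDiffOn ℝ ∞ (inChart a e) (e.target ∩ e.symm ⁻¹' V)

/-- Smoothness of a circle valued function on an open set. -/
def SmoothCircleOn (g : X → Circle) (V : Set X) : Prop :=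
  ContMDiffOn 𝓘(ℝ, ℂ) 𝓘(ℝ, ℂ) ∞ (fun x => (g x : ℂ)) V

/-- The `1`-form `g⁻¹ dg` of a circle valued function. -/
def dlog (g : X → Circle) : OneForm X := fun x =>
  let dg : TangentSpace 𝓘(ℝ, ℂ) x →L[ℝ] ℂ := mfderiv 𝓘(ℝ, ℂ) 𝓘(ℝ, ℂ) (fun y => (g y : ℂ)) x
  ((g x : ℂ)⁻¹) • dg

/-- For a `1`-form `β = β₁ dx + β₂ dy` on (an open subset of) `ℂ`, the coefficient
`∂β₂/∂x - ∂β₁/∂y` of `dβ` with respect to `dx ∧ dy`. -/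
def dCoeff (β : ℂ → ℂ →L[ℝ] ℂ) (w : ℂ) : ℂ :=
  fderiv ℝ β w 1 Complex.I - fderiv ℝ β w Complex.I 1

/-- A smooth partition of unity subordinate to the charts. -/
def chartPartition (X : Type*) [TopologicalSpace X] [ChartedSpace ℂ X] [T2Space X]
    [CompactSpace X] [IsManifold 𝓘(ℂ) ω X] : SmoothPartitionOfUnity X 𝓘(ℝ, ℂ) X univ :=
  Classical.choose (SmoothPartitionOfUnity.exists_isSubordinate_chartAt_source 𝓘(ℝ, ℂ) X)

/-- The integral over a compact Riemann surface (with its complex orientation) of the `2`-form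
whose expression in a chart `e` is `f e dx ∧ dy`. -/
def surfaceIntegral {X : Type*} [TopologicalSpace X] [ChartedSpace ℂ X] [T2Space X]
    [CompactSpace X] [IsManifold 𝓘(ℂ) ω X] (f : OpenPartialHomeomorph X ℂ → ℂ → ℂ) : ℂ :=
  ∑ᶠ x : X, ∫ w in (chartAt ℂ x).target,
    (chartPartition X x ((chartAt ℂ x).symm w) : ℂ) * f (chartAt ℂ x) w

end Forms

section Bundles

/-- A smooth principal `S¹`-bundle over the open subset `U` of the surface `X`, given by
trivialisations over the members of an open covering of `U` and their transition functions: a point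
of the fibre over `x` with coordinate `c` in the `j`-th trivialisation has coordinate `g i j x * c`
in the `i`-th one. -/
structure CircleBundle (ι : Type*) (X : Type*) [TopologicalSpace X] [ChartedSpace ℂ X]
    (U : Set X) where
  base : ι → Set X
  isOpen_base : ∀ i, IsOpen (base i)
  iUnion_base : ⋃ i, base i = U
  g : ι → ι → X → Circle
  smooth_g : ∀ i j, SmoothCircleOn (g i j) (base i ∩ base j)
  cocycle : ∀ i j k, ∀ x ∈ base i ∩ base j ∩ base k, g i j x * g j k x = g i k x

variable {ι : Type*} {X : Type*} [TopologicalSpace X] [ChartedSpace ℂ X] {U : Set X}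

/-- `h` is a smooth trivialisation of `P` over the open set `W ⊆ U`: a point of the fibre over
`x ∈ W` with coordinate `c` in the `i`-th trivialisation has coordinate `h i x * c` in the
trivialisation `h`. -/
def CircleBundle.IsTrivialisation (P : CircleBundle ι X U) (W : Set X) (h : ι → X → Circle) :
    Prop :=
  (∀ i, SmoothCircleOn (h i) (P.base i ∩ W)) ∧
    ∀ i j, ∀ x ∈ P.base i ∩ P.base j ∩ W, h i x = h j x * P.g j i x

/-- `s` is a smooth section of `P` over the open set `W ⊆ U`: the point `s(x)` has coordinate
`s i x` in the `i`-th trivialisation. -/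
def CircleBundle.IsSection (P : CircleBundle ι X U) (W : Set X) (s : ι → X → Circle) : Prop :=
  (∀ i, SmoothCircleOn (s i) (P.base i ∩ W)) ∧
    ∀ i j, ∀ x ∈ P.base i ∩ P.base j ∩ W, s i x = P.g i j x * s j x

/-- The `2π`-periodic loop `γ` in the circle has winding number `n`. -/
def HasWinding (γ : ℝ → Circle) (n : ℤ) : Prop :=
  ∃ φ : ℝ → ℝ, Continuous φ ∧ (∀ θ, γ θ = Circle.exp (φ θ)) ∧
    ∀ θ, φ (θ + 2 * Real.pi) = φ θ + 2 * Real.pi * n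

/-- The section `s`, defined on a punctured neighbourhood of `x`, has index `n` at `x`: its
coordinate in a trivialisation near `x` winds `n` times along small counterclockwise circles. -/
def CircleBundle.HasIndex (P : CircleBundle ι X U) (s : ι → X → Circle) (x : X) (n : ℤ) : Prop :=
  ∃ i, x ∈ P.base i ∧ ∀ᶠ r in 𝓝[>] (0 : ℝ),
    HasWinding (fun θ => s i ((chartAt ℂ x).symm (circleMap (chartAt ℂ x x) r θ))) n

/-- `d` is the sum of the indices of a section of `P` with finitely many singularities. -/
def CircleBundle.HasDegree (P : CircleBundle ι X univ) (d : ℤ) : Prop :=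
  ∃ (F : Finset X) (s : ι → X → Circle) (n : X → ℤ),
    P.IsSection (F : Set X)ᶜ s ∧ (∀ x ∈ F, P.HasIndex s x (n x)) ∧ d = ∑ x ∈ F, n x

open Classical in
/-- The degree of a principal `S¹`-bundle over a compact Riemann surface: the sum of the indices of
any section with finitely many singularities. -/
def CircleBundle.degree (P : CircleBundle ι X univ) : ℤ :=
  if h : ∃ d, P.HasDegree d then Classical.choose h else 0

/-- A smooth connection on `P`, given by its imaginary valued connection forms: in the `i`-th
trivialisation the covariant derivative is `d + form i`. -/
structure Connection (P : CircleBundle ι X U) where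
  form : ι → OneForm X
  imaginary : ∀ i, ∀ x ∈ P.base i, ∀ v, (form i x v).re = 0
  smooth_form : ∀ i, SmoothFormOn (form i) (P.base i)
  gauge : ∀ i j, ∀ x ∈ P.base i ∩ P.base j, form j x = form i x + dlog (P.g i j) x

variable {P : CircleBundle ι X U}

open Classical in
/-- The connection form of `A` in the trivialisation `h`. It does not depend on the index `i` used
at each point. -/
def Connection.formIn (A : Connection P) (h : ι → X → Circle) : OneForm X := fun x =>
  if hx : ∃ i, x ∈ P.base i then
    A.form (Classical.choose hx) x - dlog (h (Classical.choose hx)) x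
  else 0

open Classical in
/-- The coefficient of the curvature `F_A` with respect to `dx ∧ dy` in the chart `e`; the curvature
is `d (form i)` over `base i`, for any `i`. -/
def Connection.curvature (A : Connection P) (e : OpenPartialHomeomorph X ℂ) (w : ℂ) : ℂ :=
  if hx : ∃ i, e.symm w ∈ P.base i then dCoeff (inChart (A.form (Classical.choose hx)) e) w else 0

/-- The curvature of `A` extends to a continuous `2`-form on the whole of `X`. -/
def Connection.CurvatureExtends (A : Connection P) : Prop :=
  ∀ e ∈ atlas ℂ X, ∃ f : ℂ → ℂ, ContinuousOn f e.target ∧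
    ∀ w ∈ e.target, e.symm w ∈ U → f w = A.curvature e w

/-- The residue of `A` at the centre of the coordinate `z` with respect to the trivialisation `h`
over a punctured disk around that centre: the number `λ` such that the connection form in `h`
is `λ dθ` up to a term whose integral along small circles tends to `0`. -/
def Connection.residue (A : Connection P) (z : OpenPartialHomeomorph X ℂ) (h : ι → X → Circle) :
    ℂ :=
  limUnder (𝓝[>] (0 : ℝ)) fun r : ℝ =>
    (1 / (2 * Real.pi) : ℂ) * ∫ θ in (0 : ℝ)..2 * Real.pi,
      inChart (A.formIn h) z (circleMap 0 r θ) (deriv (circleMap 0 r) θ)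

end Bundles

section Curves

/-- A compact connected curve `C` with `k` nodes as its only singularities and `n` marked smooth
points, given by its normalisation `X` (a compact Riemann surface, not necessarily connected), the
marked points, and the two preimages `branch (l, false)`, `branch (l, true)` of the `l`-th node;
`C` is the quotient of `X` that identifies these two points for each `l`. -/
structure MarkedNodalCurve (X : Type*) [TopologicalSpace X] (n k : ℕ) where
  mark : Fin n → X
  branch : Fin k × Bool → X
  injective : Function.Injective (Sum.elim mark branch)
  connected : ConnectedSpace
    (Quot fun p q : X => ∃ l, p = branch (l, false) ∧ q = branch (l, true))

variable {X : Type*} [TopologicalSpace X] {n k : ℕ}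

/-- The marked points and the preimages of the nodes. -/
def MarkedNodalCurve.point (C : MarkedNodalCurve X n k) : Fin n ⊕ Fin k × Bool → X :=
  Sum.elim C.mark C.branch

/-- The complement of the marked points and of the nodes. -/
def MarkedNodalCurve.regular (C : MarkedNodalCurve X n k) : Set X :=
  (range C.point)ᶜ

variable [ChartedSpace ℂ X]

/-- Pairwise disjoint holomorphic coordinate disks (scaled to radius `1`) around the marked points
and the preimages of the nodes. -/
structure CoordDisks (C : MarkedNodalCurve X n k) where
  z : Fin n ⊕ Fin k × Bool → OpenPartialHomeomorph X ℂ
  holomorphic : ∀ s, z s ∈ IsManifold.maximalAtlas 𝓘(ℂ) ω X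
  mem_source : ∀ s, C.point s ∈ (z s).source
  map_point : ∀ s, z s (C.point s) = 0
  target_eq : ∀ s, (z s).target = Metric.ball 0 1
  disjoint : ∀ s t, s ≠ t → Disjoint (z s).source (z t).source

variable {C : MarkedNodalCurve X n k} {ι : Type*}

/-- Trivialisations of `P` over the punctured coordinate disks. Those at the marked points represent
an element `τ ∈ T(P, x)`; the pairs of those at the two preimages of each node represent an element
`σ ∈ T(P, z)`. -/
structure Framing (D : CoordDisks C) (P : CircleBundle ι X C.regular) where
  triv : Fin n ⊕ Fin k × Bool → ι → X → Circle
  isTrivialisation : ∀ s, P.IsTrivialisation ((D.z s).source \ {C.point s}) (triv s)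

variable {D : CoordDisks C} {P : CircleBundle ι X C.regular}

/-- The residue of `A` at a marked point or a preimage of a node. -/
def Framing.residue (T : Framing D P) (A : Connection P) (s : Fin n ⊕ Fin k × Bool) : ℂ :=
  A.residue (D.z s) (T.triv s)

/-- `A` is a meromorphic connection on the marked bundle `(P, σ)`: its curvature extends
continuously to the normalisation and its residues at the two preimages of every node, with respect
to a representative of `σ`, are opposite. -/
def Framing.IsMeromorphic (T : Framing D P) (A : Connection P) : Prop :=
  A.CurvatureExtends ∧
    ∀ l : Fin k, T.residue A (Sum.inr (l, false)) + T.residue A (Sum.inr (l, true)) = 0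

/-- The normalisation minus the closed disks of radius `‖ε l‖` around the preimages of the nodes. -/
def CoordDisks.truncated (D : CoordDisks C) (ε : Fin k → ℂ) : Set X :=
  {p | ∀ l b, p ∈ (D.z (Sum.inr (l, b))).source → ‖ε l‖ < ‖D.z (Sum.inr (l, b)) p‖}

/-- `p` and `p'` lie in the coordinate disks around the preimages number `b` and `!b` of the `l`-th
node, and their coordinates satisfy `x y = ε l`. -/
def CoordDisks.Plumbed (D : CoordDisks C) (ε : Fin k → ℂ) (l : Fin k) (b : Bool) (p p' : X) :
    Prop :=
  p ∈ (D.z (Sum.inr (l, b))).source ∧ p' ∈ (D.z (Sum.inr (l, !b))).source ∧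
    D.z (Sum.inr (l, b)) p * D.z (Sum.inr (l, !b)) p' = ε l

/-- A presentation of the Riemann surface `Y` as the smoothing of `C` that replaces each node
`x y = 0` by `x y = ε l`: `Y` is the quotient, as a complex manifold, of the truncated
normalisation by the identification of plumbed points, and `q` is the quotient map. -/
structure Smoothing (D : CoordDisks C) (Y : Type*) [TopologicalSpace Y] [ChartedSpace ℂ Y] where
  ε : Fin k → ℂ
  ε_ne_zero : ∀ l, ε l ≠ 0
  norm_ε_lt_one : ∀ l, ‖ε l‖ < 1
  q : X → Y
  isLocalBiholomorphism : IsLocalDiffeomorphOn 𝓘(ℂ) 𝓘(ℂ) ω q (D.truncated ε)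
  surjOn : SurjOn q (D.truncated ε) univ
  map_eq_iff : ∀ p ∈ D.truncated ε, ∀ p' ∈ D.truncated ε,
    q p = q p' ↔ p = p' ∨ ∃ l b, D.Plumbed ε l b p p'

/-- A presentation of the bundle `Q` over the smoothing `Y` as the bundle obtained from `P` by
gluing along the necks with the trivialisations at the preimages of the nodes, and by extending
over the marked points with the trivialisations there. -/
structure Extension (T : Framing D P) {Y : Type*} [TopologicalSpace Y] [ChartedSpace ℂ Y]
    (S : Smoothing D Y) {κ : Type*} (Q : CircleBundle κ Y univ) where
  /-- The isomorphism of the fibre of `P` over `p` with that of `Q` over `q p` is multiplication by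
  `u i a p` in the trivialisations `i` of `P` and `a` of `Q`. -/
  u : ι → κ → X → Circle
  smooth_u : ∀ i a, SmoothCircleOn (u i a) (D.truncated S.ε ∩ P.base i ∩ S.q ⁻¹' Q.base a)
  change_left : ∀ i j a, ∀ p ∈ D.truncated S.ε, p ∈ P.base i → p ∈ P.base j → S.q p ∈ Q.base a →
    u j a p = u i a p * P.g i j p
  change_right : ∀ i a b, ∀ p ∈ D.truncated S.ε, p ∈ P.base i → S.q p ∈ Q.base a →
    S.q p ∈ Q.base b → u i b p = Q.g b a (S.q p) * u i a p
  /-- Over the necks, points of `P` over plumbed points are identified if they have the same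
  coordinate in the trivialisations at the two preimages of the node. -/
  neck : ∀ l b, ∀ p ∈ D.truncated S.ε, ∀ p' ∈ D.truncated S.ε, D.Plumbed S.ε l b p p' →
    ∀ i j a, p ∈ P.base i → p' ∈ P.base j → S.q p ∈ Q.base a →
      u i a p * (T.triv (Sum.inr (l, b)) i p)⁻¹ = u j a p' * (T.triv (Sum.inr (l, !b)) j p')⁻¹
  /-- The trivialisation at a marked point extends over the marked point as a trivialisation
  of `Q`. -/
  mark : ∀ m a, ∃ v : X → Circle,
    SmoothCircleOn v ((D.z (Sum.inl m)).source ∩ S.q ⁻¹' Q.base a) ∧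
      ∀ i, ∀ p ∈ (D.z (Sum.inl m)).source, p ∈ P.base i → S.q p ∈ Q.base a →
        u i a p * (T.triv (Sum.inl m) i p)⁻¹ = v p

end Curves

end

end ChernWeil

/-! The proof computes the degree with one section of `Q` and the residue theorem on the
normalisation. Take a section `s` of `Q` with a finite singular set `F`, enlarged to contain the
images of the marked points. Pulled back along the quotient map `q`, it becomes a section of `P`
over the truncated normalisation, hence a trivialisation of `P` there, off the preimage of `F`
(`Extension.pullTriv`). In this trivialisation the connection is `d + a` with `da = F_A`. Near a
singular point, `a` is a smooth form plus the logarithmic derivative of `s`, so its circulation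
along small circles tends to `2πi` times the index of `s` (`Extension.regular_limit`). At a marked
point `2π` times the residue with respect to `τ_j` is added (`Extension.mark_limit`). If there are
no nodes, `residue_theorem` (Stokes for a form with isolated singularities and integrable
derivative) gives `∫ F_A + 2πi deg Q + 2π ∑ Res = 0`, which is the claim multiplied by `2πi`.

At a node the form `a` stops at the removed disks. Over the coordinate disk at a preimage of a node,
`a = α + g⁻¹ dg`, where `α` is the connection form in the given trivialisation and `g`
(`Extension.coord`) is the coordinate of the pulled back section in it. The term `g⁻¹ dg` is cut off
inside a round annulus free of singular points, and the result (`Extension.globalForm`) is a form on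
the whole normalisation, smooth off a finite set. This has three effects, all of which are harmless:
- The cut-off adds `d(χ g⁻¹ dg)` to the curvature. By Green's formula its integral is `2πi` times
the winding number of `g` around the neck. Plumbing reverses the angle and the gluing identifies the
functions `g` of the two sides, so the two windings at a node are opposite
(`Extension.neckCirc_add`). - The preimages of the nodes become singular points, with limits `2π
Res`. These cancel in pairs because `A` is meromorphic. - The cut discards part of each neck. The
annuli of the two sides correspond under plumbing, so every point of `F` keeps exactly one preimage
(`NeckRadii.injOn_singularSet`, `NeckRadii.surjOn_singularSet`).

Two supporting facts are needed. The index is read in the preferred charts of the smoothing and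
residues in the given coordinates; these can be compared because the limit circulation of a closed
form is independent of the coordinate (`tendsto_circ_closed`). And a section with finitely many
singularities exists, by a transversality argument for the associated line bundle
(`exists_lineSection_isolated`). -/

namespace ChernWeil

/-! ### Green's formula in the plane and circulations along small circles -/

noncomputable section

/-- The integral of a `1`-form along the counterclockwise circle of centre `c` and radius `r`. -/
def circ (β : ℂ → ℂ →L[ℝ] ℂ) (c : ℂ) (r : ℝ) : ℂ :=
  ∫ θ in (0 : ℝ)..2 * Real.pi, β (circleMap c r θ) (deriv (circleMap c r) θ)

/-- The antisymmetric part of a real bilinear form on the plane is a multiple of the area form, and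
`z`, `iz` span a square of area `‖z‖ ^ 2`. This is the Jacobian of polar coordinates and of
holomorphic changes of chart. -/
theorem bilin_rotate (B : ℂ →L[ℝ] ℂ →L[ℝ] ℂ) (z : ℂ) :
    B z (z * Complex.I) - B (z * Complex.I) z =
      (‖z‖ ^ 2 : ℝ) * (B 1 Complex.I - B Complex.I 1) := by
  have h1 : z = z.re • (1 : ℂ) + z.im • Complex.I := by
    simp [Complex.real_smul, Complex.re_add_im]
  have h2 : z * Complex.I = (-z.im) • (1 : ℂ) + z.re • Complex.I := by
    apply Complex.ext <;> simp
  have h3 : ‖z‖ ^ 2 = z.re * z.re + z.im * z.im := by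
    rw [← Complex.normSq_eq_norm_sq, Complex.normSq_apply]
  rw [h2, h3]
  have e1 : ∀ w, B z w = z.re • B 1 w + z.im • B Complex.I w := by
    intro w
    have := congrArg (fun x => B x w) h1
    simpa only [map_add, map_smul, add_apply, smul_apply] using this
  have e2 : ∀ L : ℂ →L[ℝ] ℂ, L z = z.re • L 1 + z.im • L Complex.I := by
    intro L
    have := congrArg L h1
    simpa only [map_add, map_smul] using this
  rw [e1, e2]
  simp only [map_add, map_smul, add_apply, smul_apply]
  simp only [Complex.real_smul]
  push_cast
  ring

theorem hasFDerivAt_circleMap_polar (c : ℂ) (p : ℝ × ℝ) :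
    HasFDerivAt (fun p : ℝ × ℝ => circleMap c p.1 p.2)
      ((ContinuousLinearMap.fst ℝ ℝ ℝ).smulRight (Complex.exp (p.2 * Complex.I)) +
        (ContinuousLinearMap.snd ℝ ℝ ℝ).smulRight (p.1 * Complex.exp (p.2 * Complex.I) * Complex.I)) p := by
  unfold circleMap
  have h2 : HasFDerivAt (fun p : ℝ × ℝ => (p.2 : ℂ))
      (Complex.ofRealCLM.comp (ContinuousLinearMap.snd ℝ ℝ ℝ)) p :=
    Complex.ofRealCLM.hasFDerivAt.comp p hasFDerivAt_snd
  have h1 : HasFDerivAt (fun p : ℝ × ℝ => (p.1 : ℂ))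
      (Complex.ofRealCLM.comp (ContinuousLinearMap.fst ℝ ℝ ℝ)) p :=
    Complex.ofRealCLM.hasFDerivAt.comp p hasFDerivAt_fst
  have h3 := ((h1.mul ((h2.mul_const Complex.I).cexp)).const_add c)
  refine h3.congr_fderiv ?_
  ext
  · simp [mul_comm]
  · simp
    ring

theorem dCoeff_continuousAt {β : ℂ → ℂ →L[ℝ] ℂ} {w : ℂ} (h : ContDiffAt ℝ ∞ β w) :
    ContinuousAt (dCoeff β) w := by
  have h1 : ContinuousAt (fderiv ℝ β) w :=
    (h.fderiv_right (m := 0) (by simp)).continuousAt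
  unfold dCoeff
  exact ((h1.clm_apply continuousAt_const).clm_apply continuousAt_const).sub
    ((h1.clm_apply continuousAt_const).clm_apply continuousAt_const)

/-- Polar coordinates use the angles from `-π` to `π`; periodicity moves the interval there. -/
theorem circ_eq_pi (β : ℂ → ℂ →L[ℝ] ℂ) (c : ℂ) (r : ℝ) :
    circ β c r = ∫ θ in (-Real.pi)..Real.pi,
      β (circleMap c r θ) (r * Complex.exp (θ * Complex.I) * Complex.I) := by
  unfold circ
  simp only [deriv_circleMap]
  have hp : Function.Periodic (fun θ : ℝ => β (circleMap c r θ) (circleMap 0 r θ * Complex.I))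
      (2 * Real.pi) := by
    intro θ
    simp only [periodic_circleMap c r θ, periodic_circleMap 0 r θ]
  have := hp.intervalIntegral_add_eq 0 (-Real.pi)
  rw [zero_add, show -Real.pi + 2 * Real.pi = Real.pi by ring] at this
  rw [this]
  simp [circleMap]

/-- Green's formula on the polar rectangle. -/
theorem green_polar {β : ℂ → ℂ →L[ℝ] ℂ} {c : ℂ} {a b : ℝ} (hab : a ≤ b) (ha : 0 < a)
    (hβ : ∀ w, a ≤ ‖w - c‖ → ‖w - c‖ ≤ b → ContDiffAt ℝ ∞ β w) :
    ∫ p in Icc (a, -Real.pi) (b, Real.pi), (p.1 : ℂ) * dCoeff β (circleMap c p.1 p.2) =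
      circ β c b - circ β c a := by
  set e : ℝ × ℝ → ℂ := fun p => Complex.exp (p.2 * Complex.I) with he
  set Φ : ℝ × ℝ → ℂ := fun p => circleMap c p.1 p.2 with hΦ
  have hnorm : ∀ p ∈ Icc (a, -Real.pi) (b, Real.pi), ContDiffAt ℝ ∞ β (Φ p) := by
    rintro ⟨r, θ⟩ ⟨⟨h1, _⟩, ⟨h2, _⟩⟩
    simp only at h1 h2
    have : ‖Φ (r, θ) - c‖ = r := by
      simp [hΦ, circleMap, abs_of_pos (ha.trans_le h1)]
    exact hβ _ (by rw [this]; exact h1) (by rw [this]; exact h2)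
  have hΦd := hasFDerivAt_circleMap_polar c
  have hed : ∀ p : ℝ × ℝ, HasFDerivAt e
      ((ContinuousLinearMap.snd ℝ ℝ ℝ).smulRight (e p * Complex.I)) p := by
    intro p
    have h2 : HasFDerivAt (fun p : ℝ × ℝ => (p.2 : ℂ))
        (Complex.ofRealCLM.comp (ContinuousLinearMap.snd ℝ ℝ ℝ)) p :=
      Complex.ofRealCLM.hasFDerivAt.comp p hasFDerivAt_snd
    refine ((h2.mul_const Complex.I).cexp).congr_fderiv ?_
    ext <;> simp [he, mul_comm]
  have hfst : ∀ p : ℝ × ℝ, HasFDerivAt (fun p : ℝ × ℝ => (p.1 : ℂ))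
      (Complex.ofRealCLM.comp (ContinuousLinearMap.fst ℝ ℝ ℝ)) p := fun p =>
    Complex.ofRealCLM.hasFDerivAt.comp p hasFDerivAt_fst
  have hf : ∀ p ∈ Icc (a, -Real.pi) (b, Real.pi), HasFDerivAt
      (fun p => β (Φ p) (p.1 * e p * Complex.I)) _ p := fun p hp =>
    ((((hnorm p hp).differentiableAt (by simp)).hasFDerivAt.comp p (hΦd p)).clm_apply
      (((hfst p).mul (hed p)).mul_const Complex.I))
  have hg : ∀ p ∈ Icc (a, -Real.pi) (b, Real.pi), HasFDerivAt
      (fun p => -(β (Φ p) (e p))) _ p := fun p hp =>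
    ((((hnorm p hp).differentiableAt (by simp)).hasFDerivAt.comp p (hΦd p)).clm_apply
      (hed p)).neg
  have hsub : Ioo a b ×ˢ Ioo (-Real.pi) Real.pi ⊆ Icc (a, -Real.pi) (b, Real.pi) := by
    rintro ⟨x, y⟩ ⟨h1, h2⟩
    exact ⟨⟨h1.1.le, h2.1.le⟩, ⟨h1.2.le, h2.2.le⟩⟩
  have hle : ((a, -Real.pi) : ℝ × ℝ) ≤ (b, Real.pi) := ⟨hab, by linarith [Real.pi_pos]⟩
  -- The pull-back of `β` is `β(e) dr + β(r e i) dθ`. In its exterior derivative the two terms that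
  -- differentiate the vectors are both `β(e i)`, with opposite signs; what remains is the
  -- antisymmetric part of the derivative of `β` on `e`, `e i`, times `r`.
  have key : ∀ p ∈ Icc (a, -Real.pi) (b, Real.pi),
      fderiv ℝ (fun p => β (Φ p) (p.1 * e p * Complex.I)) p (1, 0) +
        fderiv ℝ (fun p => -(β (Φ p) (e p))) p (0, 1) = (p.1 : ℂ) * dCoeff β (Φ p) := by
    intro p hp
    rw [(hf p hp).fderiv, (hg p hp).fderiv]
    have hb := bilin_rotate (fderiv ℝ β (Φ p)) (e p)
    have hn : ‖e p‖ = 1 := by simp [he, Complex.norm_exp_ofReal_mul_I]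
    rw [hn] at hb
    have s1 : ∀ v : ℂ, (p.1 : ℂ) * v = p.1 • v := fun v => (Complex.real_smul).symm
    have hb' : dCoeff β (Φ p) = fderiv ℝ β (Φ p) (e p) (e p * Complex.I) -
        fderiv ℝ β (Φ p) (e p * Complex.I) (e p) := by
      rw [hb]; simp [dCoeff]
    rw [hb']
    have he' : Complex.exp (p.2 * Complex.I) = e p := rfl
    have s2 : (p.1 : ℂ) * e p * Complex.I = p.1 • (e p * Complex.I) := by
      rw [mul_assoc, s1]
    rw [s2, he', s1]
    simp only [add_apply, neg_apply, ContinuousLinearMap.comp_apply,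
      ContinuousLinearMap.flip_apply, ContinuousLinearMap.smulRight_apply, smul_apply,
      ContinuousLinearMap.coe_fst', ContinuousLinearMap.coe_snd', Function.comp_apply,
      map_smul, zero_smul, one_smul, add_zero, zero_add, Complex.ofRealCLM_apply,
      Complex.ofReal_one, smul_eq_mul, mul_one, mul_zero]
    rw [mul_comm Complex.I (e p), smul_sub]
    ring
  have hcont : ContinuousOn (fun p : ℝ × ℝ => (p.1 : ℂ) * dCoeff β (Φ p))
      (Icc (a, -Real.pi) (b, Real.pi)) := by
    intro p hp
    apply ContinuousAt.continuousWithinAt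
    exact (hfst p).continuousAt.mul
      (ContinuousAt.comp (f := Φ) (dCoeff_continuousAt (hnorm p hp)) (hΦd p).continuousAt)
  have hdiv := integral_divergence_prod_Icc_of_hasFDerivAt_of_le
    (fun p => β (Φ p) (p.1 * e p * Complex.I)) (fun p => -(β (Φ p) (e p)))
    (fderiv ℝ (fun p => β (Φ p) (p.1 * e p * Complex.I))) (fderiv ℝ (fun p => -(β (Φ p) (e p))))
    (a, -Real.pi) (b, Real.pi) hle
    (fun p hp => (hf p hp).continuousAt.continuousWithinAt)
    (fun p hp => (hg p hp).continuousAt.continuousWithinAt)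
    (fun p hp => (hf p (hsub hp)).differentiableAt.hasFDerivAt)
    (fun p hp => (hg p (hsub hp)).differentiableAt.hasFDerivAt)
    ((hcont.integrableOn_compact isCompact_Icc).congr_fun (fun p hp => (key p hp).symm)
      measurableSet_Icc)
  rw [setIntegral_congr_fun measurableSet_Icc key] at hdiv
  rw [hdiv, circ_eq_pi, circ_eq_pi]
  -- The sides `θ = π` and `θ = -π` of the rectangle are the same segment, so their boundary terms
  -- cancel.
  have hper : ∀ x : ℝ, -(β (Φ (x, Real.pi)) (e (x, Real.pi))) =
      -(β (Φ (x, -Real.pi)) (e (x, -Real.pi))) := by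
    intro x
    have h1 : e (x, -Real.pi) = e (x, Real.pi) := by
      simp only [he]
      rw [show ((Real.pi : ℝ) : ℂ) * Complex.I = ((-Real.pi : ℝ) : ℂ) * Complex.I + 2 * Real.pi * Complex.I by
        push_cast; ring, Complex.exp_periodic]
    have h2 : Φ (x, -Real.pi) = Φ (x, Real.pi) := by
      have : Real.pi = -Real.pi + 2 * Real.pi := by ring
      simp only [hΦ]
      conv_rhs => rw [this, periodic_circleMap]
    rw [h1, h2]
  simp only [hper, sub_self, zero_add]
  rfl

/-- **Green's formula** on a round annulus. -/
theorem green_annulus {β : ℂ → ℂ →L[ℝ] ℂ} {c : ℂ} {a b : ℝ} (hab : a ≤ b) (ha : 0 < a)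
    (hβ : ∀ w, a ≤ ‖w - c‖ → ‖w - c‖ ≤ b → ContDiffAt ℝ ∞ β w) :
    ∫ w in {w | a < ‖w - c‖ ∧ ‖w - c‖ ≤ b}, dCoeff β w = circ β c b - circ β c a := by
  rw [← green_polar hab ha hβ]
  have hS : MeasurableSet {w : ℂ | a < ‖w - c‖ ∧ ‖w - c‖ ≤ b} := by
    apply MeasurableSet.inter
    · exact measurableSet_lt (f := fun _ : ℂ => a) measurable_const (by fun_prop)
    · exact measurableSet_le (g := fun _ : ℂ => b) (by fun_prop) measurable_const
  rw [← integral_indicator hS]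
  rw [← integral_add_right_eq_self _ c, ← Complex.integral_comp_polarCoord_symm]
  rw [← integral_indicator (by exact (measurableSet_Ioi.prod measurableSet_Ioo)),
    ← integral_indicator measurableSet_Icc]
  apply integral_congr_ae
  -- The closed rectangle and its part in the open domain of polar coordinates differ only on lines,
  -- which are null.
  have hne : ∀ x : ℝ, ∀ᵐ p : ℝ × ℝ, p.1 ≠ x := by
    intro x
    have : (volume : Measure (ℝ × ℝ)) ({x} ×ˢ univ) = 0 := by
      rw [Measure.volume_eq_prod, Measure.prod_prod]; simp
    rw [ae_iff]
    convert this using 2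
    ext p; simp
  have hne2 : ∀ x : ℝ, ∀ᵐ p : ℝ × ℝ, p.2 ≠ x := by
    intro x
    have : (volume : Measure (ℝ × ℝ)) (univ ×ˢ {x}) = 0 := by
      rw [Measure.volume_eq_prod, Measure.prod_prod]; simp
    rw [ae_iff]
    convert this using 2
    ext p; simp
  filter_upwards [hne a, hne2 (-Real.pi), hne2 Real.pi] with p h1 h2 h3
  have hsymm : Complex.polarCoord.symm p + c = circleMap c p.1 p.2 := by
    simp [Complex.polarCoord_symm_apply, circleMap, Complex.exp_mul_I, add_comm]
  by_cases hp : p ∈ Icc (a, -Real.pi) (b, Real.pi)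
  · obtain ⟨⟨h4, h5⟩, ⟨h6, h7⟩⟩ := id hp
    simp only at h4 h5 h6 h7
    have h0 : 0 < p.1 := ha.trans_le h4
    rw [indicator_of_mem hp, indicator_of_mem]
    · rw [hsymm, indicator_of_mem]
      · exact Complex.real_smul
      · simp only [mem_ofPred_eq]
        have : ‖circleMap c p.1 p.2 - c‖ = p.1 := by simp [circleMap, abs_of_pos h0]
        rw [this]
        exact ⟨lt_of_le_of_ne h4 (Ne.symm h1), h6⟩
    · exact ⟨h0, lt_of_le_of_ne h5 (Ne.symm h2), lt_of_le_of_ne h7 h3⟩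
  · rw [indicator_of_notMem hp]
    by_cases hq : p ∈ Ioi (0 : ℝ) ×ˢ Ioo (-Real.pi) Real.pi
    · rw [indicator_of_mem (by exact hq), hsymm, indicator_of_notMem, smul_zero]
      have h0 : 0 < p.1 := hq.1
      have : ‖circleMap c p.1 p.2 - c‖ = p.1 := by simp [circleMap, abs_of_pos h0]
      simp only [mem_ofPred_eq, this]
      rintro ⟨h4, h5⟩
      exact hp ⟨⟨h4.le, hq.2.1.le⟩, ⟨h5, hq.2.2.le⟩⟩
    · rw [indicator_of_notMem (by exact hq)]

/-- The circulation of a form along small circles converges if its exterior derivative is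
integrable. -/
theorem tendsto_circ_of_integrableOn {β : ℂ → ℂ →L[ℝ] ℂ} {c : ℂ} {R R' : ℝ} (hR' : 0 < R')
    (hR : R' < R) (hβ : ∀ w, 0 < ‖w - c‖ → ‖w - c‖ < R → ContDiffAt ℝ ∞ β w)
    (hz : ∀ w, R' ≤ ‖w - c‖ → ‖w - c‖ < R → β w = 0)
    (hi : IntegrableOn (dCoeff β) (Metric.ball c R)) :
    Tendsto (circ β c) (𝓝[>] 0) (𝓝 (-∫ w in Metric.ball c R, dCoeff β w)) := by
  have hcirc : circ β c R' = 0 := by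
    unfold circ
    have : ∀ θ, β (circleMap c R' θ) = 0 := by
      intro θ
      have : ‖circleMap c R' θ - c‖ = R' := by simp [circleMap, abs_of_pos hR']
      exact hz _ this.ge (by rw [this]; exact hR)
    simp [this]
  have hdz : ∀ w, R' < ‖w - c‖ → ‖w - c‖ < R → dCoeff β w = 0 := by
    intro w h1 h2
    have : β =ᶠ[𝓝 w] fun _ => 0 := by
      have hn : Tendsto (fun w => ‖w - c‖) (𝓝 w) (𝓝 ‖w - c‖) :=
        (continuous_norm.comp (continuous_id.sub continuous_const)).continuousAt
      filter_upwards [hn.eventually (lt_mem_nhds h1), hn.eventually (gt_mem_nhds h2)] with x h3 h4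
      exact hz x h3.le h4
    simp [dCoeff, this.fderiv_eq]
  have hmeas : ∀ a : ℝ, MeasurableSet {w : ℂ | a < ‖w - c‖ ∧ ‖w - c‖ ≤ R'} := by
    intro a
    apply MeasurableSet.inter
    · exact measurableSet_lt (f := fun _ : ℂ => a) measurable_const (by fun_prop)
    · exact measurableSet_le (g := fun _ : ℂ => R') (by fun_prop) measurable_const
  have hsubset : ∀ a : ℝ, {w : ℂ | a < ‖w - c‖ ∧ ‖w - c‖ ≤ R'} ⊆ Metric.ball c R := by
    intro a w hw
    rw [mem_ball_iff_norm]
    exact hw.2.trans_lt hR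
  -- The outer circle of radius `R'` contributes nothing, so Green's formula writes the circulation
  -- at radius `r` as minus an integral over an annulus that exhausts the punctured disk;
  -- integrability then allows dominated convergence.
  have hev : ∀ᶠ r in 𝓝[>] (0 : ℝ), circ β c r =
      -∫ w in Metric.ball c R,
        {w : ℂ | r < ‖w - c‖ ∧ ‖w - c‖ ≤ R'}.indicator (dCoeff β) w := by
    filter_upwards [Ioo_mem_nhdsGT hR'] with r hr
    have h := green_annulus (β := β) (c := c) hr.2.le hr.1
      (fun w h1 h2 => hβ w (hr.1.trans_le h1) (h2.trans_lt hR))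
    rw [hcirc, zero_sub] at h
    rw [setIntegral_indicator (hmeas r), inter_eq_self_of_subset_right (hsubset r), h, neg_neg]
  refine Tendsto.congr' (EventuallyEq.symm hev) (Tendsto.neg ?_)
  refine tendsto_integral_filter_of_dominated_convergence (fun w => ‖dCoeff β w‖) ?_ ?_ hi.norm ?_
  · exact Eventually.of_forall fun r => hi.aestronglyMeasurable.indicator (hmeas r)
  · exact Eventually.of_forall fun r => Eventually.of_forall fun w =>
      norm_indicator_le_norm_self _ _
  · have hne : ∀ᵐ w ∂(volume.restrict (Metric.ball c R)), w ≠ c := by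
      apply ae_restrict_of_ae
      rw [ae_iff]; simp
    filter_upwards [hne, ae_restrict_mem measurableSet_ball] with w hw hwR
    have h0 : 0 < ‖w - c‖ := norm_pos_iff.2 (sub_ne_zero.2 hw)
    apply tendsto_const_nhds.congr'
    filter_upwards [Ioo_mem_nhdsGT h0] with r hr
    by_cases h : ‖w - c‖ ≤ R'
    · rw [indicator_of_mem]; exact ⟨hr.2, h⟩
    · rw [hdz w (not_le.1 h) (by rwa [mem_ball_iff_norm] at hwR)]
      symm
      rw [indicator_apply_eq_zero]
      intro h'; exact absurd h'.2 h

/-- A form bounded near the centre is integrated over a length `2πr`. This is how smooth terms drop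
out of every limit of circulations. -/
theorem tendsto_circ_zero {β : ℂ → ℂ →L[ℝ] ℂ} {c : ℂ} (hβ : ContinuousAt β c) :
    Tendsto (circ β c) (𝓝[>] 0) (𝓝 0) := by
  obtain ⟨δ, hδ, hb⟩ := Metric.continuousAt_iff.1 hβ 1 one_pos
  have hbound : ∀ᶠ r in 𝓝[>] (0 : ℝ), ‖circ β c r‖ ≤ ((‖β c‖ + 1) * r) * |2 * Real.pi - 0| := by
    filter_upwards [Ioo_mem_nhdsGT hδ] with r hr
    refine intervalIntegral.norm_integral_le_of_norm_le_const fun θ _ => ?_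
    have h1 : dist (circleMap c r θ) c < δ := by
      rw [dist_eq_norm]
      simpa [circleMap, abs_of_pos hr.1] using hr.2
    have h2 : ‖β (circleMap c r θ)‖ ≤ ‖β c‖ + 1 := by
      have := hb h1
      rw [dist_eq_norm] at this
      calc ‖β (circleMap c r θ)‖ = ‖β c + (β (circleMap c r θ) - β c)‖ := by congr 1; abel
        _ ≤ _ := (norm_add_le _ _).trans (by linarith)
    refine (ContinuousLinearMap.le_opNorm _ _).trans ?_
    have h3 : ‖deriv (circleMap c r) θ‖ = r := by simp [abs_of_pos hr.1]
    rw [h3]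
    exact mul_le_mul_of_nonneg_right h2 hr.1.le
  refine squeeze_zero_norm' hbound ?_
  have : Tendsto (fun r : ℝ => ((‖β c‖ + 1) * r) * |2 * Real.pi - 0|) (𝓝 0)
      (𝓝 (((‖β c‖ + 1) * 0) * |2 * Real.pi - 0|)) :=
    (Continuous.tendsto (by fun_prop) 0)
  simp only [mul_zero, zero_mul] at this
  exact this.mono_left nhdsWithin_le_nhds

/-! ### Winding numbers as integrals of logarithmic derivatives -/

section Winding

variable {γ : ℝ → Circle}

/-- A lift of a smooth path in the circle is given by the integral of its logarithmic
derivative. -/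
theorem circle_eq_exp_integral (hγ : ContDiff ℝ 1 fun θ => (γ θ : ℂ)) :
    ∃ J : ℝ → ℝ, Continuous J ∧ (∀ a b, (∫ t in a..b, (γ t : ℂ)⁻¹ * deriv (fun θ => (γ θ : ℂ)) t) =
      (J b - J a : ℝ) * Complex.I) ∧ ∀ θ, γ θ = Circle.exp (J θ) := by
  set l : ℝ → ℂ := fun t => (γ t : ℂ)⁻¹ * deriv (fun θ => (γ θ : ℂ)) t with hl
  have hlc : Continuous l := by
    apply Continuous.mul
    · exact hγ.continuous.inv₀ fun t => Circle.coe_ne_zero _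
    · exact hγ.continuous_deriv le_rfl
  have hJ : ∀ θ, HasDerivAt (fun θ => ∫ t in (0 : ℝ)..θ, l t) (l θ) θ := fun θ =>
    intervalIntegral.integral_hasDerivAt_right (hlc.intervalIntegrable _ _)
      hlc.stronglyMeasurable.stronglyMeasurableAtFilter hlc.continuousAt
  have hconst : ∀ θ, (γ θ : ℂ) * Complex.exp (-∫ t in (0 : ℝ)..θ, l t) = γ 0 := by
    intro θ
    have hd : ∀ x, HasDerivAt (fun θ => (γ θ : ℂ) * Complex.exp (-∫ t in (0 : ℝ)..θ, l t)) 0 x := by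
      intro x
      have h1 := (hγ.differentiable (by simp) x).hasDerivAt
      have h2 := (h1.mul (hJ x).neg.cexp)
      refine h2.congr_deriv ?_
      have : (γ x : ℂ) * l x = deriv (fun θ => (γ θ : ℂ)) x :=
        mul_inv_cancel_left₀ (Circle.coe_ne_zero _) _
      rw [← this]
      simp only [Pi.neg_apply]
      ring
    have := is_const_of_deriv_eq_zero (fun x => (hd x).differentiableAt) (fun x => (hd x).deriv) θ 0
    simpa using this
  have hexp : ∀ θ, (γ θ : ℂ) = γ 0 * Complex.exp (∫ t in (0 : ℝ)..θ, l t) := by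
    intro θ
    rw [← hconst θ, mul_assoc, ← Complex.exp_add]; simp
  -- Both `γ θ` and `γ 0` have modulus one, so the exponential relating them has modulus one and the
  -- integral is purely imaginary.
  have hre : ∀ θ, (∫ t in (0 : ℝ)..θ, l t).re = 0 := by
    intro θ
    have := congrArg norm (hexp θ)
    rw [norm_mul, Circle.norm_coe, Circle.norm_coe, one_mul, Complex.norm_exp] at this
    exact (Real.exp_eq_one_iff _).1 this.symm
  obtain ⟨a, ha⟩ := Circle.exp_surjective (γ 0)
  refine ⟨fun θ => a + (∫ t in (0 : ℝ)..θ, l t).im, ?_, ?_, ?_⟩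
  · have : Continuous fun θ => ∫ t in (0 : ℝ)..θ, l t :=
      continuous_iff_continuousAt.2 fun x => (hJ x).continuousAt
    exact continuous_const.add (Complex.continuous_im.comp this)
  · intro x y
    rw [← intervalIntegral.integral_interval_sub_left (hlc.intervalIntegrable 0 y)
      (hlc.intervalIntegrable 0 x)]
    apply Complex.ext
    · simp [hre]
    · simp
  · intro θ
    rw [Circle.exp_add, ha]
    apply Circle.coe_injective
    rw [hexp θ, Circle.coe_mul, Circle.coe_exp]
    congr 2
    apply Complex.ext
    · simp [hre]
    · simp

/-- Two continuous lifts differ by a continuous function with values in `2πℤ`, which is constant on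
the line. Hence the increment along an interval does not depend on the lift. -/
theorem lift_sub_const {J φ : ℝ → ℝ} (hJ : Continuous J) (hφ : Continuous φ)
    (h : ∀ θ, Circle.exp (J θ) = Circle.exp (φ θ)) (a b : ℝ) : J a - J b = φ a - φ b := by
  have h1 : ∀ θ, ∃ n : ℤ, J θ - φ θ = n * (2 * Real.pi) := by
    intro θ
    obtain ⟨n, hn⟩ := Circle.exp_eq_exp.1 (h θ)
    exact ⟨n, by rw [hn]; ring⟩
  choose n hn using h1
  have hc : Continuous n := by
    rw [Int.isClosedEmbedding_coe_real.continuous_iff]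
    have : (Int.cast ∘ n : ℝ → ℝ) = fun θ => (J θ - φ θ) / (2 * Real.pi) := by
      ext θ; rw [hn θ]; simp [Real.pi_ne_zero]
    rw [this]
    fun_prop
  have := PreconnectedSpace.constant (α := ℝ) inferInstance hc (x := a) (y := b)
  have h2 := hn a
  have h3 := hn b
  rw [this] at h2
  linarith

theorem HasWinding.integral_eq {n : ℤ} (h : HasWinding γ n)
    (hγ : ContDiff ℝ 1 fun θ => (γ θ : ℂ)) :
    ∫ t in (0 : ℝ)..2 * Real.pi, (γ t : ℂ)⁻¹ * deriv (fun θ => (γ θ : ℂ)) t =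
      2 * Real.pi * Complex.I * n := by
  obtain ⟨φ, hφ, h1, h2⟩ := h
  obtain ⟨J, hJ, h3, h4⟩ := circle_eq_exp_integral hγ
  rw [h3, lift_sub_const hJ hφ (fun θ => by rw [← h4, h1]) (2 * Real.pi) 0]
  have := h2 0
  rw [zero_add] at this
  rw [this]
  push_cast; ring

theorem exists_hasWinding (hγ : ContDiff ℝ 1 fun θ => (γ θ : ℂ))
    (hp : Function.Periodic γ (2 * Real.pi)) : ∃ n, HasWinding γ n := by
  obtain ⟨J, hJ, -, h4⟩ := circle_eq_exp_integral hγ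
  -- The translate of `J` by a period is another lift of `γ`, so it differs from `J` by a constant;
  -- this constant is read off at `0`.
  have hs : ∀ a b, J (a + 2 * Real.pi) - J (b + 2 * Real.pi) = J a - J b := fun a b =>
    lift_sub_const (J := fun θ => J (θ + 2 * Real.pi)) (by fun_prop) hJ
      (fun θ => by rw [← h4, ← h4, hp θ]) a b
  obtain ⟨n, hn⟩ := Circle.exp_eq_exp.1 (show Circle.exp (J (0 + 2 * Real.pi)) = Circle.exp (J 0) by
    rw [← h4, ← h4, hp 0])
  refine ⟨n, J, hJ, h4, fun θ => ?_⟩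
  have := hs θ 0
  rw [hn] at this
  linarith

end Winding

/-! ### The closed form of a circle valued function on the plane -/

section Dlog

/-- The form `h⁻¹ dh` of a circle valued function on the plane. -/
def dlogC (h : ℂ → Circle) (w : ℂ) : ℂ →L[ℝ] ℂ :=
  ((h w : ℂ)⁻¹) • fderiv ℝ (fun w => (h w : ℂ)) w

variable {g h : ℂ → Circle} {w : ℂ}

theorem contDiffAt_dlogC (hh : ContDiffAt ℝ ∞ (fun w => (h w : ℂ)) w) :
    ContDiffAt ℝ ∞ (dlogC h) w := by
  unfold dlogC
  exact (hh.inv (Circle.coe_ne_zero _)).smul (hh.fderiv_right (m := ∞) (by simp))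

/-- Differentiating `h⁻¹` yields a multiple of `dh ∧ dh`, which vanishes because complex
multiplication commutes; differentiating `dh` yields zero by symmetry of the second derivative. -/
theorem dCoeff_dlogC (hh : ContDiffAt ℝ ∞ (fun w => (h w : ℂ)) w) : dCoeff (dlogC h) w = 0 := by
  have h1' : HasFDerivAt (fun w => ((h w : ℂ)⁻¹)) _ w :=
    ((hasFDerivAt_inv (𝕜 := ℂ) (Circle.coe_ne_zero (h w))).restrictScalars ℝ).comp w
      (hh.differentiableAt (by simp)).hasFDerivAt
  have h2 : HasFDerivAt (fderiv ℝ (fun w => (h w : ℂ))) _ w :=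
    ((hh.fderiv_right (m := ∞) (by simp)).differentiableAt (by simp)).hasFDerivAt
  have h3 := h1'.smul h2
  have hs : IsSymmSndFDerivAt ℝ (fun w => (h w : ℂ)) w :=
    hh.isSymmSndFDerivAt (by simpa using (WithTop.coe_le_coe.2 (le_top : (2 : ℕ∞) ≤ ⊤)))
  have := hs.eq 1 Complex.I
  have h4 : fderiv ℝ (dlogC h) w = _ := h3.fderiv
  unfold dCoeff
  rw [h4]
  simp [this]
  ring

theorem dlogC_congr (hgh : g =ᶠ[𝓝 w] h) : dlogC g w = dlogC h w := by
  have h1 : (fun w => (g w : ℂ)) =ᶠ[𝓝 w] fun w => (h w : ℂ) := hgh.mono fun x hx => by simp only [hx]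
  unfold dlogC
  rw [h1.fderiv_eq, hgh.eq_of_nhds]

theorem contDiff_comp_circleMap {c : ℂ} {r : ℝ}
    (hh : ∀ θ, ContDiffAt ℝ ∞ (fun w => (h w : ℂ)) (circleMap c r θ)) :
    ContDiff ℝ 1 fun θ => (h (circleMap c r θ) : ℂ) := by
  rw [contDiff_iff_contDiffAt]
  intro θ
  exact ((hh θ).of_le (by exact_mod_cast le_top)).comp θ (contDiff_circleMap c r).contDiffAt

theorem circ_dlogC_eq_integral {c : ℂ} {r : ℝ}
    (hh : ∀ θ, ContDiffAt ℝ ∞ (fun w => (h w : ℂ)) (circleMap c r θ)) :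
    circ (dlogC h) c r = ∫ t in (0 : ℝ)..2 * Real.pi, (h (circleMap c r t) : ℂ)⁻¹ *
      deriv (fun θ => (h (circleMap c r θ) : ℂ)) t := by
  unfold circ
  congr 1
  ext t
  have h1 := ((hh t).differentiableAt (by simp)).hasFDerivAt.comp_hasDerivAt t
    (differentiable_circleMap c r t).hasDerivAt
  rw [show deriv (fun θ => (h (circleMap c r θ) : ℂ)) t = _ from h1.deriv]
  simp [dlogC]

theorem circ_dlogC_of_hasWinding {c : ℂ} {r : ℝ} {n : ℤ}
    (hh : ∀ θ, ContDiffAt ℝ ∞ (fun w => (h w : ℂ)) (circleMap c r θ))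
    (hw : HasWinding (fun θ => h (circleMap c r θ)) n) :
    circ (dlogC h) c r = 2 * Real.pi * Complex.I * n := by
  rw [circ_dlogC_eq_integral hh, hw.integral_eq (contDiff_comp_circleMap hh)]

theorem circ_eq_of_dCoeff_eq_zero {β : ℂ → ℂ →L[ℝ] ℂ} {c : ℂ} {a b : ℝ} (hab : a ≤ b) (ha : 0 < a)
    (hβ : ∀ w, a ≤ ‖w - c‖ → ‖w - c‖ ≤ b → ContDiffAt ℝ ∞ β w)
    (h0 : ∀ w, a ≤ ‖w - c‖ → ‖w - c‖ ≤ b → dCoeff β w = 0) : circ β c b = circ β c a := by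
  have := green_annulus hab ha hβ
  have hS : MeasurableSet {w : ℂ | a < ‖w - c‖ ∧ ‖w - c‖ ≤ b} := by
    apply MeasurableSet.inter
    · exact measurableSet_lt (f := fun _ : ℂ => a) measurable_const (by fun_prop)
    · exact measurableSet_le (g := fun _ : ℂ => b) (by fun_prop) measurable_const
  rw [setIntegral_congr_fun hS (g := fun _ => 0) (fun w hw => h0 w hw.1.le hw.2)] at this
  simp only [integral_zero] at this
  exact (sub_eq_zero.1 this.symm)

theorem norm_circleMap_sub {c : ℂ} {r : ℝ} (hr : 0 < r) (θ : ℝ) : ‖circleMap c r θ - c‖ = r := by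
  simp [circleMap, abs_of_pos hr]

/-- Each small circle has some winding number. Green's formula for the closed form `dlogC h` makes
all these integers equal. -/
theorem exists_winding_punctured {c : ℂ} {R : ℝ} (hR : 0 < R)
    (hh : ∀ w, 0 < ‖w - c‖ → ‖w - c‖ < R → ContDiffAt ℝ ∞ (fun w => (h w : ℂ)) w) :
    ∃ n : ℤ, ∀ᶠ r in 𝓝[>] (0 : ℝ), HasWinding (fun θ => h (circleMap c r θ)) n := by
  have hs : ∀ r ∈ Ioo 0 R, ∀ θ, ContDiffAt ℝ ∞ (fun w => (h w : ℂ)) (circleMap c r θ) := by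
    intro r hr θ
    have := norm_circleMap_sub (c := c) hr.1 θ
    exact hh _ (by rw [this]; exact hr.1) (by rw [this]; exact hr.2)
  have hw : ∀ r ∈ Ioo 0 R, ∃ n : ℤ, HasWinding (fun θ => h (circleMap c r θ)) n := fun r hr =>
    exists_hasWinding (contDiff_comp_circleMap (hs r hr)) fun θ => by
      simp only [periodic_circleMap c r θ]
  obtain ⟨n, hn⟩ := hw (R / 2) ⟨by positivity, by linarith⟩
  refine ⟨n, ?_⟩
  filter_upwards [Ioo_mem_nhdsGT (half_pos hR)] with r hr
  have hrR : r ∈ Ioo 0 R := ⟨hr.1, by linarith [hr.2]⟩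
  obtain ⟨m, hm⟩ := hw r hrR
  have h1 := circ_dlogC_of_hasWinding (hs r hrR) hm
  have h2 := circ_dlogC_of_hasWinding (hs (R / 2) ⟨by positivity, by linarith⟩) hn
  have h3 := circ_eq_of_dCoeff_eq_zero (β := dlogC h) (c := c) hr.2.le hr.1
    (fun w h1 h2 => contDiffAt_dlogC (hh w (hr.1.trans_le h1) (by linarith)))
    (fun w h1 h2 => dCoeff_dlogC (hh w (hr.1.trans_le h1) (by linarith)))
  rw [h1, h2] at h3
  have hpi : (2 * Real.pi * Complex.I : ℂ) ≠ 0 := Complex.two_pi_I_ne_zero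
  have : n = m := by exact_mod_cast mul_left_cancel₀ hpi h3
  rw [this]; exact hm

end Dlog

/-! ### One-forms and circle valued functions in holomorphic charts -/

section Charts

theorem eventually_mem_overlap {X : Type*} [TopologicalSpace X]
    {e e' : OpenPartialHomeomorph X ℂ} {w : ℂ} (hw : w ∈ e.target) (hw' : e.symm w ∈ e'.source) :
    ∀ᶠ x in 𝓝 w, x ∈ e.target ∧ e.symm x ∈ e'.source :=
  (e.open_target.eventually_mem hw).and
    ((e.symm.continuousAt hw).eventually (e'.open_source.mem_nhds hw'))

variable {X : Type*} [TopologicalSpace X] [ChartedSpace ℂ X]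

/-- The holomorphic coordinate charts of a Riemann surface. -/
abbrev holAtlas (X : Type*) [TopologicalSpace X] [ChartedSpace ℂ X] :
    Set (OpenPartialHomeomorph X ℂ) :=
  IsManifold.maximalAtlas 𝓘(ℂ) ω X

theorem holAtlas_subset_real : holAtlas X ⊆ IsManifold.maximalAtlas 𝓘(ℝ, ℂ) ∞ X := by
  have key : ∀ f : OpenPartialHomeomorph ℂ ℂ, f ∈ contDiffGroupoid ω 𝓘(ℂ) →
      f ∈ contDiffGroupoid ∞ 𝓘(ℝ, ℂ) := by
    intro f hf
    rw [contDiffGroupoid, mem_groupoid_of_pregroupoid] at hf ⊢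
    have h1 : ContDiffOn ℂ ω _ _ := hf.1
    have h2 : ContDiffOn ℂ ω _ _ := hf.2
    exact ⟨(h1.restrict_scalars ℝ).of_le le_top, (h2.restrict_scalars ℝ).of_le le_top⟩
  intro e he
  rw [IsManifold.mem_maximalAtlas_iff] at he ⊢
  intro e' he'
  exact ⟨key _ (he e' he').1, key _ (he e' he').2⟩

variable {e e' : OpenPartialHomeomorph X ℂ} {w : ℂ} {a b : OneForm X} {p : X}

theorem contDiffAt_transition (he : e ∈ holAtlas X) (he' : e' ∈ holAtlas X) (hw : w ∈ e.target)
    (hw' : e.symm w ∈ e'.source) : ContDiffAt ℂ ω (e' ∘ e.symm) w := by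
  have h := IsManifold.compatible_of_mem_maximalAtlas he he'
  rw [contDiffGroupoid, mem_groupoid_of_pregroupoid] at h
  have h1 : ContDiffOn ℂ ω (e' ∘ e.symm) ((e.symm ≫ₕ e').source) := by
    simpa [contDiffPregroupoid] using h.1
  exact h1.contDiffAt ((e.symm ≫ₕ e').open_source.mem_nhds (by simp [hw, hw']))

theorem fderiv_real_eq_deriv {ψ : ℂ → ℂ} (h : DifferentiableAt ℂ ψ w) :
    fderiv ℝ ψ w = (ContinuousLinearMap.mul ℝ ℂ) (deriv ψ w) := by
  rw [(h.hasFDerivAt.restrictScalars ℝ).fderiv]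
  ext v
  simp [mul_comm]

theorem mdifferentiableAt_chart_symm (he : e ∈ holAtlas X) (hw : w ∈ e.target) :
    MDifferentiableAt 𝓘(ℝ, ℂ) 𝓘(ℝ, ℂ) e.symm w :=
  ((contMDiffOn_symm_of_mem_maximalAtlas (holAtlas_subset_real he)).contMDiffAt
    (e.open_target.mem_nhds hw)).mdifferentiableAt (by simp)

theorem inChart_transition (he : e ∈ holAtlas X) (he' : e' ∈ holAtlas X) (hw : w ∈ e.target)
    (hw' : e.symm w ∈ e'.source) :
    inChart a e w = (inChart a e' (e' (e.symm w))).comp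
      ((ContinuousLinearMap.mul ℝ ℂ) (deriv (e' ∘ e.symm) w)) := by
  have hd := (contDiffAt_transition he he' hw hw').differentiableAt (by simp)
  have hev : e.symm =ᶠ[𝓝 w] e'.symm ∘ (e' ∘ e.symm) := by
    filter_upwards [eventually_mem_overlap hw hw'] with x hx
    simp [e'.left_inv hx.2]
  have h1 : mfderiv 𝓘(ℝ, ℂ) 𝓘(ℝ, ℂ) e.symm w =
      (mfderiv 𝓘(ℝ, ℂ) 𝓘(ℝ, ℂ) e'.symm (e' (e.symm w))).comp
        (mfderiv 𝓘(ℝ, ℂ) 𝓘(ℝ, ℂ) (e' ∘ e.symm) w) := by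
    rw [hev.mfderiv_eq]
    exact mfderiv_comp w (mdifferentiableAt_chart_symm he' (e'.map_source hw'))
      (hd.restrictScalars ℝ).mdifferentiableAt
  have h2 : e'.symm (e' (e.symm w)) = e.symm w := e'.left_inv hw'
  rw [mfderiv_eq_fderiv, fderiv_real_eq_deriv hd] at h1
  unfold inChart
  rw [h1]
  ext v
  simp only [ContinuousLinearMap.comp_apply]
  rw [h2]
  rfl

theorem inChart_transition_eventually (he : e ∈ holAtlas X) (he' : e' ∈ holAtlas X)
    (hw : w ∈ e.target) (hw' : e.symm w ∈ e'.source) :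
    inChart a e =ᶠ[𝓝 w] fun w => (inChart a e' ((e' ∘ e.symm) w)).comp
      ((ContinuousLinearMap.mul ℝ ℂ) (deriv (e' ∘ e.symm) w)) := by
  filter_upwards [eventually_mem_overlap hw hw'] with x hx
  exact inChart_transition he he' hx.1 hx.2

theorem contDiffAt_deriv_transition (he : e ∈ holAtlas X) (he' : e' ∈ holAtlas X)
    (hw : w ∈ e.target) (hw' : e.symm w ∈ e'.source) :
    ContDiffAt ℂ ω (deriv (e' ∘ e.symm)) w := by
  have h := contDiffAt_transition he he' hw hw'
  have h2 : ContDiffAt ℂ ω (fderiv ℂ (e' ∘ e.symm)) w := h.fderiv_right (by simp)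
  exact h2.clm_apply contDiffAt_const

theorem contDiffAt_inChart_transition (he : e ∈ holAtlas X) (he' : e' ∈ holAtlas X)
    (hw : w ∈ e.target) (hw' : e.symm w ∈ e'.source)
    (h : ContDiffAt ℝ ∞ (inChart a e') (e' (e.symm w))) : ContDiffAt ℝ ∞ (inChart a e) w := by
  refine ContDiffAt.congr_of_eventuallyEq ?_ (inChart_transition_eventually he he' hw hw')
  have h1 : ContDiffAt ℝ ∞ (e' ∘ e.symm) w :=
    ((contDiffAt_transition he he' hw hw').restrict_scalars ℝ).of_le le_top
  have h2 : ContDiffAt ℝ ∞ (deriv (e' ∘ e.symm)) w :=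
    ((contDiffAt_deriv_transition he he' hw hw').restrict_scalars ℝ).of_le le_top
  have h3 : ContDiffAt ℝ ∞ (fun w => inChart a e' ((e' ∘ e.symm) w)) w :=
    ContDiffAt.comp (g := inChart a e') (f := e' ∘ e.symm) w h h1
  exact h3.clm_comp ((ContinuousLinearMap.mul ℝ ℂ).contDiff.contDiffAt.comp w h2)

/-- Naturality of the exterior derivative: the term with the second derivative of the transition map
is symmetric and drops out. Since the map is holomorphic, the rest is evaluated on `ψ'` and `ψ' i`,
and `bilin_rotate` produces `‖ψ'‖ ^ 2`. -/
theorem dCoeff_transition (he : e ∈ holAtlas X) (he' : e' ∈ holAtlas X)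
    (hw : w ∈ e.target) (hw' : e.symm w ∈ e'.source)
    (h : ContDiffAt ℝ ∞ (inChart a e') (e' (e.symm w))) :
    dCoeff (inChart a e) w =
      (‖deriv (e' ∘ e.symm) w‖ ^ 2 : ℝ) * dCoeff (inChart a e') (e' (e.symm w)) := by
  set ψ := e' ∘ e.symm with hψ
  have hψd : HasFDerivAt ψ ((ContinuousLinearMap.mul ℝ ℂ) (deriv ψ w)) w := by
    have hd := (contDiffAt_transition he he' hw hw').differentiableAt (by simp)
    rw [← fderiv_real_eq_deriv hd]
    exact (hd.restrictScalars ℝ).hasFDerivAt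
  have hdd : HasFDerivAt (deriv ψ) ((ContinuousLinearMap.mul ℝ ℂ) (deriv (deriv ψ) w)) w := by
    have hd := (contDiffAt_deriv_transition he he' hw hw').differentiableAt (by simp)
    rw [← fderiv_real_eq_deriv hd]
    exact (hd.restrictScalars ℝ).hasFDerivAt
  have h0 : HasFDerivAt (inChart a e') _ (ψ w) := (h.differentiableAt (by simp)).hasFDerivAt
  have h1 := (h0.comp w hψd).clm_comp
    ((ContinuousLinearMap.mul ℝ ℂ).hasFDerivAt.comp w hdd)
  have h2 : fderiv ℝ (inChart a e) w = _ :=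
    (inChart_transition_eventually he he' hw hw').fderiv_eq.trans h1.fderiv
  have hb := bilin_rotate (fderiv ℝ (inChart a e') (ψ w)) (deriv ψ w)
  unfold dCoeff
  rw [h2]
  have hb' : ψ w = e' (e.symm w) := rfl
  rw [hb'] at hb
  rw [← hb]
  simp [hb']

/-- Smoothness of a `1`-form at a point. -/
def FormSmoothAt (a : OneForm X) (p : X) : Prop :=
  ∃ e ∈ holAtlas X, p ∈ e.source ∧ ContDiffAt ℝ ∞ (inChart a e) (e p)

theorem FormSmoothAt.contDiffAt (h : FormSmoothAt a p) (he : e ∈ holAtlas X) (hp : p ∈ e.source) :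
    ContDiffAt ℝ ∞ (inChart a e) (e p) := by
  obtain ⟨e', he', hp', h'⟩ := h
  refine contDiffAt_inChart_transition he he' (e.map_source hp) (by rwa [e.left_inv hp]) ?_
  rwa [e.left_inv hp]

theorem FormSmoothAt.contDiffAt_symm (he : e ∈ holAtlas X) (hw : w ∈ e.target)
    (h : FormSmoothAt a (e.symm w)) : ContDiffAt ℝ ∞ (inChart a e) w := by
  have := h.contDiffAt he (e.map_target hw)
  rwa [e.right_inv hw] at this

theorem FormSmoothAt.dCoeff_transition (he : e ∈ holAtlas X) (he' : e' ∈ holAtlas X)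
    (hw : w ∈ e.target) (hw' : e.symm w ∈ e'.source) (h : FormSmoothAt a (e.symm w)) :
    dCoeff (inChart a e) w =
      (‖deriv (e' ∘ e.symm) w‖ ^ 2 : ℝ) * dCoeff (inChart a e') (e' (e.symm w)) :=
  ChernWeil.dCoeff_transition he he' hw hw' (h.contDiffAt he' hw')

theorem SmoothFormOn.formSmoothAt [IsManifold 𝓘(ℂ) ω X] {V : Set X} (h : SmoothFormOn a V)
    (hV : IsOpen V) (hp : p ∈ V) : FormSmoothAt a p := by
  refine ⟨chartAt ℂ p, IsManifold.chart_mem_maximalAtlas p, mem_chart_source ℂ p, ?_⟩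
  refine (h _ (chart_mem_atlas ℂ p)).contDiffAt ?_
  refine ((chartAt ℂ p).isOpen_inter_preimage_symm hV).mem_nhds ⟨mem_chart_target ℂ p, ?_⟩
  simpa using hp

theorem inChart_add (e : OpenPartialHomeomorph X ℂ) (w : ℂ) :
    inChart (a + b) e w = inChart a e w + inChart b e w := by
  unfold inChart; exact ContinuousLinearMap.add_comp _ _ _

theorem inChart_sub (e : OpenPartialHomeomorph X ℂ) (w : ℂ) :
    inChart (a - b) e w = inChart a e w - inChart b e w := by
  unfold inChart; exact ContinuousLinearMap.sub_comp _ _ _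

theorem inChart_congr (h : a (e.symm w) = b (e.symm w)) : inChart a e w = inChart b e w := by
  unfold inChart; rw [h]

/-- The product of a function and a `1`-form. -/
def smulForm (f : X → ℝ) (a : OneForm X) : OneForm X := fun x => f x • a x

theorem inChart_smulForm (f : X → ℝ) (e : OpenPartialHomeomorph X ℂ) (w : ℂ) :
    inChart (smulForm f a) e w = f (e.symm w) • inChart a e w := by
  unfold inChart smulForm; exact ContinuousLinearMap.smul_comp _ _ _

theorem inChart_zero (e : OpenPartialHomeomorph X ℂ) (w : ℂ) : inChart (0 : OneForm X) e w = 0 := by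
  unfold inChart; exact ContinuousLinearMap.zero_comp _

theorem FormSmoothAt.add (ha : FormSmoothAt a p) (hb : FormSmoothAt b p) :
    FormSmoothAt (a + b) p := by
  obtain ⟨e, he, hp, h⟩ := ha
  refine ⟨e, he, hp, ?_⟩
  rw [show inChart (a + b) e = inChart a e + inChart b e from funext fun w => inChart_add e w]
  exact h.add (hb.contDiffAt he hp)

theorem FormSmoothAt.sub (ha : FormSmoothAt a p) (hb : FormSmoothAt b p) :
    FormSmoothAt (a - b) p := by
  obtain ⟨e, he, hp, h⟩ := ha
  refine ⟨e, he, hp, ?_⟩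
  rw [show inChart (a - b) e = inChart a e - inChart b e from funext fun w => inChart_sub e w]
  exact h.sub (hb.contDiffAt he hp)

theorem FormSmoothAt.congr (ha : FormSmoothAt a p) (h : ∀ᶠ x in 𝓝 p, b x = a x) :
    FormSmoothAt b p := by
  obtain ⟨e, he, hp, h'⟩ := ha
  refine ⟨e, he, hp, h'.congr_of_eventuallyEq ?_⟩
  have hc := (e.symm.continuousAt (e.map_source hp))
  rw [ContinuousAt, e.left_inv hp] at hc
  exact (hc.eventually h).mono fun w hw => inChart_congr hw

theorem contDiffAt_comp_symm {F : Type*} [NormedAddCommGroup F] [NormedSpace ℝ F] {f : X → F}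
    (he : e ∈ holAtlas X) (hw : w ∈ e.target)
    (hf : ContMDiffAt 𝓘(ℝ, ℂ) 𝓘(ℝ, F) ∞ f (e.symm w)) : ContDiffAt ℝ ∞ (fun w => f (e.symm w)) w := by
  rw [← contMDiffAt_iff_contDiffAt]
  exact hf.comp w ((contMDiffOn_symm_of_mem_maximalAtlas (holAtlas_subset_real he)).contMDiffAt
    (e.open_target.mem_nhds hw))

theorem FormSmoothAt.smulForm {f : X → ℝ} (ha : FormSmoothAt a p)
    (hf : ContMDiffAt 𝓘(ℝ, ℂ) 𝓘(ℝ, ℝ) ∞ f p) : FormSmoothAt (smulForm f a) p := by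
  obtain ⟨e, he, hp, h⟩ := ha
  refine ⟨e, he, hp, ?_⟩
  rw [show inChart (ChernWeil.smulForm f a) e = fun w => f (e.symm w) • inChart a e w from
    funext fun w => inChart_smulForm f e w]
  exact (contDiffAt_comp_symm (F := ℝ) he (e.map_source hp) (by rwa [e.left_inv hp])).smul h

theorem formSmoothAt_zero [IsManifold 𝓘(ℂ) ω X] : FormSmoothAt (0 : OneForm X) p := by
  refine ⟨chartAt ℂ p, IsManifold.chart_mem_maximalAtlas p, mem_chart_source ℂ p, ?_⟩
  rw [show inChart (0 : OneForm X) (chartAt ℂ p) = fun _ => 0 from funext fun w => inChart_zero _ w]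
  exact contDiffAt_const

/-- Smoothness of a circle valued function at a point. -/
def SmoothCircleAt (g : X → Circle) (p : X) : Prop :=
  ContMDiffAt 𝓘(ℝ, ℂ) 𝓘(ℝ, ℂ) ∞ (fun x => (g x : ℂ)) p

theorem SmoothCircleOn.smoothCircleAt {g : X → Circle} {V : Set X} (h : SmoothCircleOn g V)
    (hV : V ∈ 𝓝 p) : SmoothCircleAt g p :=
  ContMDiffOn.contMDiffAt h hV

variable {g h : X → Circle}

theorem SmoothCircleAt.comp_symm (hg : SmoothCircleAt g (e.symm w)) (he : e ∈ holAtlas X)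
    (hw : w ∈ e.target) : ContDiffAt ℝ ∞ (fun w => (g (e.symm w) : ℂ)) w :=
  contDiffAt_comp_symm (f := fun x => (g x : ℂ)) he hw hg

theorem inChart_dlog (he : e ∈ holAtlas X) (hw : w ∈ e.target)
    (hg : SmoothCircleAt g (e.symm w)) :
    inChart (dlog g) e w = dlogC (fun w => g (e.symm w)) w := by
  unfold inChart dlog dlogC
  have h1 : mfderiv 𝓘(ℝ, ℂ) 𝓘(ℝ, ℂ) (fun w => (g (e.symm w) : ℂ)) w =
      (mfderiv 𝓘(ℝ, ℂ) 𝓘(ℝ, ℂ) (fun y => (g y : ℂ)) (e.symm w)).comp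
        (mfderiv 𝓘(ℝ, ℂ) 𝓘(ℝ, ℂ) e.symm w) :=
    mfderiv_comp (g := fun y => (g y : ℂ)) w (ContMDiffAt.mdifferentiableAt hg (by simp))
      (mdifferentiableAt_chart_symm he hw)
  rw [mfderiv_eq_fderiv] at h1
  rw [h1]
  rfl

theorem formSmoothAt_dlog [IsManifold 𝓘(ℂ) ω X] (hg : ∀ᶠ x in 𝓝 p, SmoothCircleAt g x) :
    FormSmoothAt (dlog g) p := by
  refine ⟨chartAt ℂ p, IsManifold.chart_mem_maximalAtlas p, mem_chart_source ℂ p, ?_⟩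
  set e := chartAt ℂ p
  have he : e ∈ holAtlas X := IsManifold.chart_mem_maximalAtlas p
  have hp : p ∈ e.source := mem_chart_source ℂ p
  have hc := (e.symm.continuousAt (e.map_source hp))
  rw [ContinuousAt, e.left_inv hp] at hc
  have h1 : ContDiffAt ℝ ∞ (dlogC fun w => g (e.symm w)) (e p) := by
    refine contDiffAt_dlogC (SmoothCircleAt.comp_symm ?_ he (e.map_source hp))
    rw [e.left_inv hp]
    exact hg.self_of_nhds
  refine h1.congr_of_eventuallyEq ?_
  filter_upwards [hc.eventually hg, e.open_target.eventually_mem (e.map_source hp)] with w h2 h3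
  exact inChart_dlog he h3 h2

theorem dCoeff_inChart_dlog (he : e ∈ holAtlas X) (hw : w ∈ e.target)
    (hg : ∀ᶠ x in 𝓝 (e.symm w), SmoothCircleAt g x) : dCoeff (inChart (dlog g) e) w = 0 := by
  have hev : inChart (dlog g) e =ᶠ[𝓝 w] dlogC fun w => g (e.symm w) := by
    filter_upwards [(e.symm.continuousAt hw).eventually hg, e.open_target.eventually_mem hw] with x h2 h3
    exact inChart_dlog he h3 h2
  rw [dCoeff, hev.fderiv_eq]
  exact dCoeff_dlogC (hg.self_of_nhds.comp_symm he hw)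

theorem SmoothCircleAt.mul (hg : SmoothCircleAt g p) (hh : SmoothCircleAt h p) :
    SmoothCircleAt (fun x => g x * h x) p := by
  unfold SmoothCircleAt
  simp only [Circle.coe_mul]
  have : ContDiff ℝ ∞ fun q : ℂ × ℂ => q.1 * q.2 := contDiff_mul
  exact this.contMDiff.contMDiffAt.comp p (ContMDiffAt.prodMk_space hg hh)

theorem SmoothCircleAt.inv (hg : SmoothCircleAt g p) : SmoothCircleAt (fun x => (g x)⁻¹) p := by
  unfold SmoothCircleAt
  simp only [Circle.coe_inv]
  have : ContDiffAt ℝ ∞ (fun z : ℂ => z⁻¹) (g p : ℂ) := contDiffAt_inv ℝ (Circle.coe_ne_zero _)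
  exact ContMDiffAt.comp (g := fun z : ℂ => z⁻¹) p this.contMDiffAt hg

theorem SmoothCircleAt.congr (hg : SmoothCircleAt g p) (hgh : h =ᶠ[𝓝 p] g) : SmoothCircleAt h p :=
  ContMDiffAt.congr_of_eventuallyEq hg (hgh.mono fun x hx => by simp only [hx])

theorem dlog_congr (hgh : h =ᶠ[𝓝 p] g) : dlog h p = dlog g p := by
  have h1 : (fun w => (h w : ℂ)) =ᶠ[𝓝 p] fun w => (g w : ℂ) := hgh.mono fun x hx => by simp only [hx]
  unfold dlog
  simp only [h1.mfderiv_eq, hgh.eq_of_nhds]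

theorem dlog_mul (hg : SmoothCircleAt g p) (hh : SmoothCircleAt h p) :
    dlog (fun x => g x * h x) p = dlog g p + dlog h p := by
  have h1 := (ContMDiffAt.mdifferentiableAt hg (by simp)).hasMFDerivAt
  have h2 := (ContMDiffAt.mdifferentiableAt hh (by simp)).hasMFDerivAt
  have h3 := (h1.mul h2).mfderiv
  unfold dlog
  simp only [Circle.coe_mul]
  have h4 : mfderiv 𝓘(ℝ, ℂ) 𝓘(ℝ, ℂ) (fun x => (g x : ℂ) * (h x : ℂ)) p = _ := h3
  have h5 : (g p : ℂ) ≠ 0 := Circle.coe_ne_zero _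
  have h6 : (h p : ℂ) ≠ 0 := Circle.coe_ne_zero _
  rw [h4]
  refine ContinuousLinearMap.ext fun v => ?_
  change ((g p : ℂ) * (h p : ℂ))⁻¹ * ((g p : ℂ) * _ + (h p : ℂ) * _) = (g p : ℂ)⁻¹ * _ + (h p : ℂ)⁻¹ * _
  field_simp
  rw [add_comm]

theorem dlog_const (c : Circle) : dlog (fun _ : X => c) p = 0 := by
  unfold dlog
  simp only [mfderiv_const]
  exact smul_zero (M := ℂ) (A := ℂ →L[ℝ] ℂ) _

theorem dlog_inv (hg : SmoothCircleAt g p) : dlog (fun x => (g x)⁻¹) p = -dlog g p := by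
  have h := dlog_mul hg hg.inv
  simp only [mul_inv_cancel, dlog_const] at h
  exact eq_neg_of_add_eq_zero_right h.symm

end Charts

/-! ### Integration of two-forms on a compact Riemann surface -/

section TwoForms

set_option linter.unusedSectionVars false

variable {X : Type*} [TopologicalSpace X] [ChartedSpace ℂ X]

/-- The transformation law of the coefficient `f e` of a `2`-form `f e dx ∧ dy` under change of the
holomorphic chart `e`. -/
def IsTwoForm (X : Type*) [TopologicalSpace X] [ChartedSpace ℂ X]
    (f : OpenPartialHomeomorph X ℂ → ℂ → ℂ) : Prop :=
  ∀ e ∈ holAtlas X, ∀ e' ∈ holAtlas X, ∀ w ∈ e.target, e.symm w ∈ e'.source →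
    f e w = (‖deriv (e' ∘ e.symm) w‖ ^ 2 : ℝ) * f e' (e' (e.symm w))

variable {f f₁ f₂ : OpenPartialHomeomorph X ℂ → ℂ → ℂ} {e e' : OpenPartialHomeomorph X ℂ}

/-- The Jacobian of a holomorphic map is nonnegative, so the absolute value in the change of
variables formula agrees with the transformation law of two-forms. -/
theorem det_mul_complex (z : ℂ) : ((ContinuousLinearMap.mul ℝ ℂ) z).det = ‖z‖ ^ 2 := by
  have h := Algebra.norm_complex_apply z
  rw [Algebra.norm_apply] at h
  rw [← Complex.normSq_eq_norm_sq, ← h]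
  rfl

theorem transition_image (e e' : OpenPartialHomeomorph X ℂ) :
    (e' ∘ e.symm) '' (e.target ∩ e.symm ⁻¹' e'.source) = e'.target ∩ e'.symm ⁻¹' e.source := by
  ext w
  constructor
  · rintro ⟨x, ⟨hx, hx'⟩, rfl⟩
    refine ⟨e'.map_source hx', ?_⟩
    simp only [mem_preimage, Function.comp_apply]
    rw [e'.left_inv hx']
    exact e.map_target hx
  · rintro ⟨hw, hw'⟩
    refine ⟨e (e'.symm w), ⟨e.map_source hw', ?_⟩, ?_⟩
    · simp only [mem_preimage]
      rw [e.left_inv hw']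
      exact e'.map_target hw
    · simp only [Function.comp_apply]
      rw [e.left_inv hw', e'.right_inv hw]

theorem transition_injOn (e e' : OpenPartialHomeomorph X ℂ) :
    InjOn (e' ∘ e.symm) (e.target ∩ e.symm ⁻¹' e'.source) := by
  intro x hx y hy h
  exact e.symm.injOn hx.1 hy.1 (e'.injOn hx.2 hy.2 h)

theorem hasFDerivWithinAt_transition (he : e ∈ holAtlas X) (he' : e' ∈ holAtlas X) :
    ∀ x ∈ e.target ∩ e.symm ⁻¹' e'.source, HasFDerivWithinAt (e' ∘ e.symm)
      ((ContinuousLinearMap.mul ℝ ℂ) (deriv (e' ∘ e.symm) x)) (e.target ∩ e.symm ⁻¹' e'.source) x := by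
  intro x hx
  have hd := (contDiffAt_transition he he' hx.1 hx.2).differentiableAt (by simp)
  rw [← fderiv_real_eq_deriv hd]
  exact (hd.restrictScalars ℝ).hasFDerivAt.hasFDerivWithinAt

theorem measurableSet_overlap (e e' : OpenPartialHomeomorph X ℂ) :
    MeasurableSet (e.target ∩ e.symm ⁻¹' e'.source) :=
  (e.isOpen_inter_preimage_symm e'.open_source).measurableSet

theorem transition_integrand (hf : IsTwoForm X f) (he : e ∈ holAtlas X) (he' : e' ∈ holAtlas X)
    (φ : X → ℝ) : EqOn (fun w => |((ContinuousLinearMap.mul ℝ ℂ) (deriv (e' ∘ e.symm) w)).det| •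
      ((φ (e'.symm ((e' ∘ e.symm) w)) : ℂ) * f e' ((e' ∘ e.symm) w)))
      (fun w => (φ (e.symm w) : ℂ) * f e w) (e.target ∩ e.symm ⁻¹' e'.source) := by
  intro w hw
  simp only [Function.comp_apply]
  rw [det_mul_complex, abs_of_nonneg (by positivity), hf e he e' he' w hw.1 hw.2,
    e'.left_inv hw.2, Complex.real_smul]
  ring_nf

/-- Change of variables for `2`-forms. -/
theorem IsTwoForm.integral_overlap (hf : IsTwoForm X f) (he : e ∈ holAtlas X)
    (he' : e' ∈ holAtlas X) (φ : X → ℝ) :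
    ∫ w in e'.target ∩ e'.symm ⁻¹' e.source, (φ (e'.symm w) : ℂ) * f e' w =
      ∫ w in e.target ∩ e.symm ⁻¹' e'.source, (φ (e.symm w) : ℂ) * f e w := by
  rw [← transition_image, integral_image_eq_integral_abs_det_fderiv_smul volume
    (measurableSet_overlap e e') (hasFDerivWithinAt_transition he he') (transition_injOn e e')]
  exact setIntegral_congr_fun (measurableSet_overlap e e') (transition_integrand hf he he' φ)

theorem IsTwoForm.integrableOn_overlap (hf : IsTwoForm X f) (he : e ∈ holAtlas X)
    (he' : e' ∈ holAtlas X) (φ : X → ℝ) :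
    IntegrableOn (fun w => (φ (e'.symm w) : ℂ) * f e' w) (e'.target ∩ e'.symm ⁻¹' e.source) ↔
      IntegrableOn (fun w => (φ (e.symm w) : ℂ) * f e w) (e.target ∩ e.symm ⁻¹' e'.source) := by
  rw [← transition_image, integrableOn_image_iff_integrableOn_abs_det_fderiv_smul volume
    (measurableSet_overlap e e') (hasFDerivWithinAt_transition he he') (transition_injOn e e')]
  exact integrableOn_congr_fun (transition_integrand hf he he' φ) (measurableSet_overlap e e')

variable [T2Space X] [CompactSpace X] [IsManifold 𝓘(ℂ) ω X]

theorem chartPartition_subordinate (x : X) :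
    tsupport (chartPartition X x) ⊆ (chartAt ℂ x).source :=
  Classical.choose_spec (SmoothPartitionOfUnity.exists_isSubordinate_chartAt_source 𝓘(ℝ, ℂ) X) x

theorem chartPartition_eq_zero {x y : X} (h : y ∉ (chartAt ℂ x).source) :
    chartPartition X x y = 0 :=
  image_eq_zero_of_notMem_tsupport fun h' => h (chartPartition_subordinate x h')

/-- The finitely many indices with nonzero partition function. -/
theorem finite_chartPartition : {x : X | (chartPartition X x : X → ℝ) ≠ 0}.Finite := by
  have h := (chartPartition X).locallyFinite.finite_nonempty_of_compact
  refine h.subset fun x hx => ?_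
  by_contra h'
  apply hx
  ext y
  by_contra hy
  exact h' ⟨y, hy⟩

/-- The indices of the nonzero functions of the partition of unity. -/
def partitionIndex (X : Type*) [TopologicalSpace X] [ChartedSpace ℂ X] [T2Space X]
    [CompactSpace X] [IsManifold 𝓘(ℂ) ω X] : Finset X :=
  (finite_chartPartition (X := X)).toFinset

theorem sum_partition (y : X) : ∑ x ∈ partitionIndex X, chartPartition X x y = 1 := by
  rw [← (chartPartition X).sum_eq_one (mem_univ y)]
  symm
  apply finsum_eq_sum_of_support_subset
  intro x hx
  simp only [partitionIndex, Finite.coe_toFinset, mem_ofPred_eq]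
  intro h
  exact hx (by simp [h])

theorem surfaceIntegral_eq_sum (f : OpenPartialHomeomorph X ℂ → ℂ → ℂ) :
    surfaceIntegral (X := X) f = ∑ x ∈ partitionIndex X, ∫ w in (chartAt ℂ x).target,
      (chartPartition X x ((chartAt ℂ x).symm w) : ℂ) * f (chartAt ℂ x) w := by
  apply finsum_eq_sum_of_support_subset
  intro x hx
  simp only [partitionIndex, Finite.coe_toFinset, mem_ofPred_eq]
  intro h
  apply hx
  simp [h]

/-- Integrability of a `2`-form. -/
def IntegrableForm (X : Type*) [TopologicalSpace X] [ChartedSpace ℂ X] [T2Space X]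
    [CompactSpace X] [IsManifold 𝓘(ℂ) ω X] (f : OpenPartialHomeomorph X ℂ → ℂ → ℂ) : Prop :=
  ∀ x : X, IntegrableOn (fun w => (chartPartition X x ((chartAt ℂ x).symm w) : ℂ) *
    f (chartAt ℂ x) w) (chartAt ℂ x).target

theorem IntegrableForm.add (h₁ : IntegrableForm X f₁) (h₂ : IntegrableForm X f₂) :
    IntegrableForm X (f₁ + f₂) := by
  intro x
  refine ((h₁ x).add (h₂ x)).congr ?_
  exact Eventually.of_forall fun w => by simp [mul_add]

theorem surfaceIntegral_add (h₁ : IntegrableForm X f₁) (h₂ : IntegrableForm X f₂) :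
    surfaceIntegral (X := X) (f₁ + f₂) =
      surfaceIntegral (X := X) f₁ + surfaceIntegral (X := X) f₂ := by
  simp only [surfaceIntegral_eq_sum, ← Finset.sum_add_distrib]
  refine Finset.sum_congr rfl fun x _ => ?_
  rw [← integral_add (h₁ x) (h₂ x)]
  simp [mul_add]

theorem integrableForm_zero : IntegrableForm X (0 : OpenPartialHomeomorph X ℂ → ℂ → ℂ) := by
  intro x; simp

theorem surfaceIntegral_zero :
    surfaceIntegral (X := X) (0 : OpenPartialHomeomorph X ℂ → ℂ → ℂ) = 0 := by
  simp [surfaceIntegral_eq_sum]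

theorem integrableForm_sum {ι : Type*} (s : Finset ι) (F : ι → OpenPartialHomeomorph X ℂ → ℂ → ℂ)
    (h : ∀ i ∈ s, IntegrableForm X (F i)) : IntegrableForm X (∑ i ∈ s, F i) := by
  classical
  induction s using Finset.induction_on with
  | empty => simpa using integrableForm_zero
  | insert i s hi ih =>
    rw [Finset.sum_insert hi]
    exact (h i (Finset.mem_insert_self _ _)).add
      (ih fun j hj => h j (Finset.mem_insert_of_mem hj))

theorem surfaceIntegral_sum {ι : Type*} (s : Finset ι)
    (F : ι → OpenPartialHomeomorph X ℂ → ℂ → ℂ) (h : ∀ i ∈ s, IntegrableForm X (F i)) :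
    surfaceIntegral (X := X) (∑ i ∈ s, F i) = ∑ i ∈ s, surfaceIntegral (X := X) (F i) := by
  classical
  induction s using Finset.induction_on with
  | empty => simpa using surfaceIntegral_zero
  | insert i s hi ih =>
    have h' : ∀ j ∈ s, IntegrableForm X (F j) := fun j hj => h j (Finset.mem_insert_of_mem hj)
    rw [Finset.sum_insert hi, Finset.sum_insert hi,
      surfaceIntegral_add (h i (Finset.mem_insert_self _ _)) (integrableForm_sum s F h'), ih h']

/-- Two forms agree off a finite set. -/
theorem ae_of_off_finite (S : Finset X) (e : OpenPartialHomeomorph X ℂ) {f₁ f₂ : ℂ → ℂ}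
    (h : ∀ w ∈ e.target, e.symm w ∉ S → f₁ w = f₂ w) :
    f₁ =ᵐ[volume.restrict e.target] f₂ := by
  have hfin : (e.target ∩ e.symm ⁻¹' (S : Set X)).Finite := by
    refine Finite.of_finite_image (f := e.symm) (S.finite_toSet.subset ?_)
      (e.symm.injOn.mono inter_subset_left)
    rintro _ ⟨w, hw, rfl⟩
    exact hw.2
  have h0 : ∀ᵐ w : ℂ, w ∉ e.target ∩ e.symm ⁻¹' (S : Set X) :=
    measure_eq_zero_iff_ae_notMem.1 (hfin.measure_zero volume)
  filter_upwards [ae_restrict_of_ae h0, ae_restrict_mem e.open_target.measurableSet] with w h1 h2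
  exact h w h2 fun h3 => h1 ⟨h2, h3⟩

/-- Finite sets are null, so the default values taken by two-forms at singular points have no effect
on integrals. -/
theorem surfaceIntegral_congr_off_finite (S : Finset X)
    (h : ∀ e ∈ atlas ℂ X, ∀ w ∈ e.target, e.symm w ∉ S → f₁ e w = f₂ e w) :
    surfaceIntegral (X := X) f₁ = surfaceIntegral (X := X) f₂ := by
  simp only [surfaceIntegral_eq_sum]
  refine Finset.sum_congr rfl fun x _ => integral_congr_ae ?_
  exact (ae_of_off_finite S _ (h _ (chart_mem_atlas ℂ x))).mono fun w hw => by simp only [hw]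

theorem IntegrableForm.congr_off_finite (S : Finset X) (hi : IntegrableForm X f₁)
    (h : ∀ e ∈ atlas ℂ X, ∀ w ∈ e.target, e.symm w ∉ S → f₁ e w = f₂ e w) :
    IntegrableForm X f₂ := by
  intro x
  refine (hi x).congr ?_
  exact (ae_of_off_finite S _ (h _ (chart_mem_atlas ℂ x))).mono fun w hw => by simp only [hw]

/-- The product of a function and a `2`-form. -/
def smulTwo (φ : X → ℝ) (f : OpenPartialHomeomorph X ℂ → ℂ → ℂ) :
    OpenPartialHomeomorph X ℂ → ℂ → ℂ := fun e w => (φ (e.symm w) : ℂ) * f e w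

theorem IntegrableForm.smulTwo {φ : X → ℝ} (hφ : Continuous φ) (hi : IntegrableForm X f) :
    IntegrableForm X (smulTwo φ f) := by
  intro x
  obtain ⟨C, hC⟩ := (isCompact_range hφ).isBounded.exists_norm_le
  have h1 : AEStronglyMeasurable (fun w => (φ ((chartAt ℂ x).symm w) : ℂ))
      (volume.restrict (chartAt ℂ x).target) := by
    apply ContinuousOn.aestronglyMeasurable _ (chartAt ℂ x).open_target.measurableSet
    exact (Complex.continuous_ofReal.comp hφ).comp_continuousOn (chartAt ℂ x).continuousOn_symm
  have h2 := Integrable.bdd_mul (c := C) (hi x) h1 (Eventually.of_forall fun w => by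
    rw [Complex.norm_real]; exact hC _ (mem_range_self _))
  refine h2.congr (Eventually.of_forall fun w => ?_)
  simp only [ChernWeil.smulTwo]
  ring

/-- Each partition function has compact support inside its chart domain, so continuity on the open
chart range is enough and no bound near its boundary is needed. -/
theorem integrableForm_of_continuousOn
    (h : ∀ x : X, ContinuousOn (f (chartAt ℂ x)) (chartAt ℂ x).target) : IntegrableForm X f := by
  intro x
  set e := chartAt ℂ x
  set K := e '' tsupport (chartPartition X x) with hK
  have hsub := chartPartition_subordinate x
  have hKc : IsCompact K := (isClosed_tsupport _).isCompact.image_of_continuousOn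
    (e.continuousOn.mono hsub)
  have hKt : K ⊆ e.target := by
    rintro _ ⟨y, hy, rfl⟩
    exact e.map_source (hsub hy)
  have hcont : ContinuousOn (fun w => (chartPartition X x (e.symm w) : ℂ) * f e w) e.target := by
    refine ContinuousOn.mul ?_ (h x)
    exact (Complex.continuous_ofReal.comp (chartPartition X x).contMDiff.continuous).comp_continuousOn
      e.continuousOn_symm
  refine ((hcont.mono hKt).integrableOn_compact hKc).of_forall_sdiff_eq_zero
    e.open_target.measurableSet fun w hw => ?_
  have : e.symm w ∉ tsupport (chartPartition X x) := fun h' =>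
    hw.2 ⟨e.symm w, h', e.right_inv hw.1⟩
  rw [image_eq_zero_of_notMem_tsupport this]
  simp

/-- The integral of a `2`-form supported in a coordinate chart can be computed in this chart. -/
theorem IsTwoForm.surfaceIntegral_eq (hf : IsTwoForm X f) (hi : IntegrableForm X f)
    (he : e ∈ holAtlas X)
    (hz : ∀ e' ∈ holAtlas X, ∀ w ∈ e'.target, e'.symm w ∉ e.source → f e' w = 0) :
    IntegrableOn (f e) e.target ∧ surfaceIntegral (X := X) f = ∫ w in e.target, f e w := by
  have hc : ∀ x : X, chartAt ℂ x ∈ holAtlas X := fun x => IsManifold.chart_mem_maximalAtlas x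
  have hz1 : ∀ x : X, ∀ w ∈ e.target \ (e.target ∩ e.symm ⁻¹' (chartAt ℂ x).source),
      (chartPartition X x (e.symm w) : ℂ) * f e w = 0 := by
    intro x w hw
    rw [chartPartition_eq_zero (fun h => hw.2 ⟨hw.1, h⟩)]
    simp
  -- The form is the sum of its products with the partition functions. Each product vanishes off the
  -- overlap with the chart of that function, and over the overlap both integrability and integral
  -- may be computed in either chart.
  have hInt : ∀ x : X, IntegrableOn (fun w => (chartPartition X x (e.symm w) : ℂ) * f e w)
      e.target := by
    intro x
    have h1 := ((hf.integrableOn_overlap he (hc x) (chartPartition X x)).1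
      ((hi x).mono_set inter_subset_left))
    exact h1.of_forall_sdiff_eq_zero e.open_target.measurableSet (hz1 x)
  have hsum : ∀ w, ∑ x ∈ partitionIndex X, (chartPartition X x (e.symm w) : ℂ) * f e w = f e w := by
    intro w
    rw [← Finset.sum_mul]
    have := sum_partition (e.symm w)
    have h2 : ∑ x ∈ partitionIndex X, (chartPartition X x (e.symm w) : ℂ) = 1 := by
      exact_mod_cast this
    rw [h2, one_mul]
  constructor
  · have := integrable_finsetSum (partitionIndex X) fun x _ => hInt x
    simp only [hsum] at this
    exact this
  · have h2 : ∫ w in e.target, f e w = ∫ w in e.target,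
        ∑ x ∈ partitionIndex X, (chartPartition X x (e.symm w) : ℂ) * f e w := by
      simp only [hsum]
    rw [h2, integral_finsetSum _ fun x _ => hInt x, surfaceIntegral_eq_sum]
    refine Finset.sum_congr rfl fun x _ => ?_
    rw [setIntegral_eq_of_subset_of_forall_sdiff_eq_zero e.open_target.measurableSet
      inter_subset_left (hz1 x), ← hf.integral_overlap he (hc x) (chartPartition X x)]
    refine setIntegral_eq_of_subset_of_forall_sdiff_eq_zero
      (chartAt ℂ x).open_target.measurableSet inter_subset_left fun w hw => ?_
    rw [hz _ (hc x) w hw.1 fun h => hw.2 ⟨hw.1, h⟩, mul_zero]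

end TwoForms

/-! ### Stokes' theorem and the residue theorem -/

section Stokes

set_option linter.unusedSectionVars false

variable {X : Type*} [TopologicalSpace X] [ChartedSpace ℂ X]

/-- Stokes' theorem for compactly supported forms on an open subset of the plane. -/
theorem integral_dCoeff_eq_zero {β : ℂ → ℂ →L[ℝ] ℂ} {U K : Set ℂ} (hU : IsOpen U)
    (hK : IsCompact K) (hKU : K ⊆ U) (hβ : ∀ w ∈ U, ContDiffAt ℝ ∞ β w)
    (hz : ∀ w ∈ U \ K, β w = 0) : ∫ w in U, dCoeff β w = 0 := by
  set β' : ℂ → ℂ →L[ℝ] ℂ := U.indicator β with hβ'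
  have h0 : ∀ w ∉ K, β' w = 0 := by
    intro w hw
    by_cases hwU : w ∈ U
    · rw [hβ', indicator_of_mem hwU, hz w ⟨hwU, hw⟩]
    · rw [hβ', indicator_of_notMem hwU]
  have h0' : ∀ w ∉ K, β' =ᶠ[𝓝 w] fun _ => 0 := fun w hw => by
    filter_upwards [hK.isClosed.isOpen_compl.mem_nhds hw] with x hx using h0 x hx
  have h1 : ∀ w ∈ U, β' =ᶠ[𝓝 w] β := fun w hw => by
    filter_upwards [hU.mem_nhds hw] with x hx
    rw [hβ', indicator_of_mem hx]
  have hs : ∀ w, ContDiffAt ℝ ∞ β' w := by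
    intro w
    by_cases hw : w ∈ K
    · exact (hβ w (hKU hw)).congr_of_eventuallyEq (h1 w (hKU hw))
    · exact contDiffAt_const.congr_of_eventuallyEq (h0' w hw)
  have hd0 : ∀ w ∉ K, dCoeff β' w = 0 := by
    intro w hw
    simp [dCoeff, (h0' w hw).fderiv_eq]
  obtain ⟨R, hR0, hR⟩ := hK.isBounded.subset_ball_lt 0 0
  have hR1 : ∀ w ∈ K, ‖w‖ < R := fun w hw => by simpa using hR hw
  have hcont : Continuous (dCoeff β') :=
    continuous_iff_continuousAt.2 fun w => dCoeff_continuousAt (hs w)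
  -- The extension by zero is smooth everywhere, in particular at `0`. The circulations around `0`
  -- therefore tend both to zero and to minus the integral over a large disk.
  have hlim := tendsto_circ_of_integrableOn (β := β') (c := 0) hR0 (lt_add_one R)
    (fun w _ _ => hs w) (fun w hw _ => h0 w fun h => by
      have := hR1 w h
      rw [sub_zero] at hw
      linarith) ((hcont.continuousOn.integrableOn_compact
        (isCompact_closedBall (0 : ℂ) (R + 1))).mono_set Metric.ball_subset_closedBall)
  have hlim0 := tendsto_circ_zero (hs 0).continuousAt
  have h2 := neg_eq_zero.1 (tendsto_nhds_unique hlim hlim0)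
  have e1 : ∫ w in U, dCoeff β w = ∫ w in U, dCoeff β' w :=
    setIntegral_congr_fun hU.measurableSet fun w hw => by
      simp only [dCoeff, (h1 w hw).fderiv_eq]
  have e2 : ∫ w in U, dCoeff β' w = ∫ w in K, dCoeff β' w :=
    setIntegral_eq_of_subset_of_forall_sdiff_eq_zero hU.measurableSet hKU fun w hw => hd0 w hw.2
  have e3 : ∫ w in Metric.ball (0 : ℂ) (R + 1), dCoeff β' w = ∫ w in K, dCoeff β' w :=
    setIntegral_eq_of_subset_of_forall_sdiff_eq_zero measurableSet_ball
      (hR.trans (Metric.ball_subset_ball (by linarith))) fun w hw => hd0 w hw.2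
  rw [e1, e2, ← e3, h2]

open Classical in
/-- The exterior derivative of a `1`-form that is smooth off the finite set `S`. -/
def dForm (S : Finset X) (a : OneForm X) (e : OpenPartialHomeomorph X ℂ) (w : ℂ) : ℂ :=
  if e.symm w ∈ S then 0 else dCoeff (inChart a e) w

variable {S : Finset X} {a b : OneForm X} {e : OpenPartialHomeomorph X ℂ} {w : ℂ}

theorem dForm_of_mem (h : e.symm w ∈ S) : dForm S a e w = 0 := if_pos h

theorem dForm_of_notMem (h : e.symm w ∉ S) : dForm S a e w = dCoeff (inChart a e) w := if_neg h

/-- The value `0` on `S` is compatible with every change of chart, because `S` is a set of points of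
the surface; so the law holds at singular points as well. -/
theorem isTwoForm_dForm (h : ∀ p ∉ S, FormSmoothAt a p) : IsTwoForm X (dForm S a) := by
  intro e he e' he' w hw hw'
  have h1 : e'.symm (e' (e.symm w)) = e.symm w := e'.left_inv hw'
  by_cases hS : e.symm w ∈ S
  · rw [dForm_of_mem hS, dForm_of_mem (by rwa [h1]), mul_zero]
  · rw [dForm_of_notMem hS, dForm_of_notMem (by rwa [h1])]
    exact (h _ hS).dCoeff_transition he he' hw hw'

theorem eventually_comp_symm {P : X → Prop} (hw : w ∈ e.target) (h : ∀ᶠ x in 𝓝 (e.symm w), P x) :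
    ∀ᶠ x in 𝓝 w, P (e.symm x) :=
  (e.symm.continuousAt hw).eventually h

theorem inChart_eventually_congr (hw : w ∈ e.target) (h : ∀ᶠ x in 𝓝 (e.symm w), a x = b x) :
    inChart a e =ᶠ[𝓝 w] inChart b e :=
  (eventually_comp_symm hw h).mono fun _ hx => inChart_congr hx

theorem dCoeff_inChart_congr (hw : w ∈ e.target) (h : ∀ᶠ x in 𝓝 (e.symm w), a x = b x) :
    dCoeff (inChart a e) w = dCoeff (inChart b e) w := by
  simp only [dCoeff, (inChart_eventually_congr hw h).fderiv_eq]

theorem dCoeff_zero_form : dCoeff (inChart (0 : OneForm X) e) w = 0 := by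
  rw [show inChart (0 : OneForm X) e = fun _ => 0 from funext fun w => inChart_zero e w]
  simp [dCoeff]

theorem dCoeff_inChart_add (he : e ∈ holAtlas X) (hw : w ∈ e.target)
    (ha : FormSmoothAt a (e.symm w)) (hb : FormSmoothAt b (e.symm w)) :
    dCoeff (inChart (a + b) e) w = dCoeff (inChart a e) w + dCoeff (inChart b e) w := by
  have h1 := (ha.contDiffAt_symm he hw).differentiableAt (by simp)
  have h2 := (hb.contDiffAt_symm he hw).differentiableAt (by simp)
  rw [show inChart (a + b) e = inChart a e + inChart b e from funext fun w => inChart_add e w]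
  unfold dCoeff
  rw [fderiv_add h1 h2]
  simp only [add_apply]
  ring

theorem dForm_add (h₁ : ∀ p ∉ S, FormSmoothAt a p) (h₂ : ∀ p ∉ S, FormSmoothAt b p)
    (he : e ∈ holAtlas X) (hw : w ∈ e.target) :
    dForm S (a + b) e w = dForm S a e w + dForm S b e w := by
  by_cases hS : e.symm w ∈ S
  · simp [dForm_of_mem hS]
  · simp only [dForm_of_notMem hS]
    exact dCoeff_inChart_add he hw (h₁ _ hS) (h₂ _ hS)

variable [IsManifold 𝓘(ℂ) ω X]

theorem formSmoothAt_sum {ι : Type*} (s : Finset ι) (F : ι → OneForm X) {p : X}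
    (h : ∀ i ∈ s, FormSmoothAt (F i) p) : FormSmoothAt (∑ i ∈ s, F i) p := by
  classical
  induction s using Finset.induction_on with
  | empty => simpa using formSmoothAt_zero
  | insert i s hi ih =>
    rw [Finset.sum_insert hi]
    exact (h i (Finset.mem_insert_self _ _)).add (ih fun j hj => h j (Finset.mem_insert_of_mem hj))

theorem dForm_sum {ι : Type*} (s : Finset ι) (F : ι → OneForm X)
    (h : ∀ i ∈ s, ∀ p ∉ S, FormSmoothAt (F i) p) (he : e ∈ holAtlas X) (hw : w ∈ e.target) :
    dForm S (∑ i ∈ s, F i) e w = ∑ i ∈ s, dForm S (F i) e w := by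
  classical
  induction s using Finset.induction_on with
  | empty =>
    by_cases hS : e.symm w ∈ S
    · simp [dForm_of_mem hS]
    · simp [dForm_of_notMem hS, dCoeff_zero_form]
  | insert i s hi ih =>
    have h' : ∀ j ∈ s, ∀ p ∉ S, FormSmoothAt (F j) p := fun j hj =>
      h j (Finset.mem_insert_of_mem hj)
    rw [Finset.sum_insert hi, Finset.sum_insert hi, dForm_add (h i (Finset.mem_insert_self _ _))
      (fun p hp => formSmoothAt_sum s F fun j hj => h' j hj p hp) he hw, ih h']

variable [T2Space X] [CompactSpace X]

theorem chart_mem_holAtlas (x : X) : chartAt ℂ x ∈ holAtlas X :=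
  IsManifold.chart_mem_maximalAtlas x

theorem smulForm_eventually_zero {φ : X → ℝ} {p : X} (h : p ∉ tsupport φ) (a : OneForm X) :
    ∀ᶠ x in 𝓝 p, smulForm φ a x = (0 : OneForm X) x := by
  have := notMem_tsupport_iff_eventuallyEq.1 h
  filter_upwards [this] with x hx
  unfold smulForm
  rw [hx]
  exact zero_smul ℝ (a x)

theorem dCoeff_smulForm_eq_zero {φ : X → ℝ} (hw : w ∈ e.target) (h : e.symm w ∉ tsupport φ) :
    dCoeff (inChart (smulForm φ a) e) w = 0 := by
  rw [dCoeff_inChart_congr hw (smulForm_eventually_zero h a), dCoeff_zero_form]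

theorem integrableForm_dForm_empty (h : ∀ p, FormSmoothAt a p) : IntegrableForm X (dForm ∅ a) := by
  refine integrableForm_of_continuousOn fun x w hw => ContinuousAt.continuousWithinAt ?_
  have : dForm ∅ a (chartAt ℂ x) = dCoeff (inChart a (chartAt ℂ x)) := by
    ext w; simp [dForm]
  rw [this]
  exact dCoeff_continuousAt ((h _).contDiffAt_symm (chart_mem_holAtlas x) hw)

/-- The derivative of a form supported in a chart has integral zero. -/
theorem surfaceIntegral_dForm_smulForm (h : ∀ p, FormSmoothAt a p) {φ : X → ℝ}
    (hφ : ContMDiff 𝓘(ℝ, ℂ) 𝓘(ℝ, ℝ) ∞ φ) (he : e ∈ holAtlas X) (hs : tsupport φ ⊆ e.source) :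
    surfaceIntegral (X := X) (dForm ∅ (smulForm φ a)) = 0 := by
  have hsm : ∀ p, FormSmoothAt (smulForm φ a) p := fun p => (h p).smulForm hφ.contMDiffAt
  have hK : IsCompact (e '' tsupport φ) :=
    (isClosed_tsupport _).isCompact.image_of_continuousOn (e.continuousOn.mono hs)
  rw [((isTwoForm_dForm fun p _ => hsm p).surfaceIntegral_eq (integrableForm_dForm_empty hsm) he
    ?_).2]
  · have : dForm ∅ (smulForm φ a) e = dCoeff (inChart (smulForm φ a) e) := by
      ext w; simp [dForm]
    rw [this]
    refine integral_dCoeff_eq_zero e.open_target hK ?_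
      (fun w hw => (hsm _).contDiffAt_symm he hw) fun w hw => ?_
    · rintro _ ⟨y, hy, rfl⟩
      exact e.map_source (hs hy)
    · have h0 : φ (e.symm w) = 0 := image_eq_zero_of_notMem_tsupport
        fun h' => hw.2 ⟨_, h', e.right_inv hw.1⟩
      rw [inChart_smulForm, h0]; exact zero_smul ℝ (inChart a e w)
  · intro e' he' w hw hw'
    rw [dForm_of_notMem (by simp), dCoeff_smulForm_eq_zero hw fun h' => hw' (hs h')]

theorem surfaceIntegral_congr (f₁ f₂ : OpenPartialHomeomorph X ℂ → ℂ → ℂ)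
    (h : ∀ e ∈ holAtlas X, ∀ w ∈ e.target, f₁ e w = f₂ e w) :
    surfaceIntegral (X := X) f₁ = surfaceIntegral (X := X) f₂ :=
  surfaceIntegral_congr_off_finite ∅ fun e he w hw _ =>
    h e (IsManifold.subset_maximalAtlas he) w hw

/-- **Stokes' theorem** on a compact Riemann surface. -/
theorem surfaceIntegral_dForm_eq_zero (h : ∀ p, FormSmoothAt a p) :
    surfaceIntegral (X := X) (dForm ∅ a) = 0 := by
  have hφ : ∀ x, ContMDiff 𝓘(ℝ, ℂ) 𝓘(ℝ, ℝ) ∞ (chartPartition X x) := fun x =>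
    (chartPartition X x).contMDiff
  have hsm : ∀ x p, FormSmoothAt (smulForm (chartPartition X x) a) p := fun x p =>
    (h p).smulForm (hφ x).contMDiffAt
  -- Writing the form as a sum of forms supported in single charts reduces the theorem to the plane.
  have hsum : a = ∑ x ∈ partitionIndex X, smulForm (chartPartition X x) a := by
    funext p
    rw [Finset.sum_apply]
    unfold smulForm
    have h1 : (∑ x ∈ partitionIndex X, (chartPartition X x) p • a p) =
        (∑ x ∈ partitionIndex X, chartPartition X x p) • a p := (Finset.sum_smul).symm
    rw [h1, sum_partition]
    exact (one_smul ℝ (a p)).symm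
  have h1 : surfaceIntegral (X := X) (dForm ∅ a) = surfaceIntegral (X := X)
      (∑ x ∈ partitionIndex X, dForm ∅ (smulForm (chartPartition X x) a)) := by
    refine surfaceIntegral_congr _ _ fun e he w hw => ?_
    conv_lhs => rw [hsum]
    rw [dForm_sum _ _ (fun x _ p _ => hsm x p) he hw]
    simp only [Finset.sum_apply]
  rw [h1, surfaceIntegral_sum _ _ fun x _ => integrableForm_dForm_empty (hsm x)]
  exact Finset.sum_eq_zero fun x _ => surfaceIntegral_dForm_smulForm h (hφ x)
    (chart_mem_holAtlas x) (chartPartition_subordinate x)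

theorem exists_bump {p : X} {V : Set X} (hV : V ∈ 𝓝 p) :
    ∃ φ : X → ℝ, ContMDiff 𝓘(ℝ, ℂ) 𝓘(ℝ, ℝ) ∞ φ ∧ (∀ᶠ x in 𝓝 p, φ x = 1) ∧ tsupport φ ⊆ V := by
  obtain ⟨f, -, hf⟩ := (SmoothBumpFunction.nhds_basis_tsupport (I := 𝓘(ℝ, ℂ)) p).mem_iff.1 hV
  exact ⟨f, f.contMDiff, f.eventuallyEq_one, hf⟩

theorem eventually_notMem_finset {p : X} (hp : p ∉ S) : ∀ᶠ x in 𝓝 p, x ∉ S :=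
  S.finite_toSet.isClosed.isOpen_compl.mem_nhds hp

theorem dForm_smulForm_const {φ : X → ℝ} {c : ℝ} (he : e ∈ holAtlas X)
    (ha : ∀ p ∉ S, FormSmoothAt a p) (hw : w ∈ e.target) (h : ∀ᶠ x in 𝓝 (e.symm w), φ x = c) :
    dForm S (smulForm φ a) e w = c * dForm S a e w := by
  by_cases hS : e.symm w ∈ S
  · simp [dForm_of_mem hS]
  · rw [dForm_of_notMem hS, dForm_of_notMem hS]
    have hev : inChart (smulForm φ a) e =ᶠ[𝓝 w] fun w => c • inChart a e w := by
      filter_upwards [eventually_comp_symm hw h] with x hx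
      rw [inChart_smulForm, hx]
    have hd := ((ha _ hS).contDiffAt_symm he hw).differentiableAt (by simp)
    unfold dCoeff
    rw [hev.fderiv_eq, fderiv_fun_const_smul hd]
    simp
    ring

/-- In `d(φ a) = φ da + dφ ∧ a` the first term is integrable because `φ` is bounded. The second is
smooth off `S` and vanishes near `S`, where `φ` is locally constant, so its coefficient is
continuous. -/
theorem IntegrableForm.dForm_smulForm {φ : X → ℝ} (ha : ∀ p ∉ S, FormSmoothAt a p)
    (hi : IntegrableForm X (dForm S a)) (hφ : ContMDiff 𝓘(ℝ, ℂ) 𝓘(ℝ, ℝ) ∞ φ)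
    (hc : ∀ p ∈ S, ∃ c : ℝ, ∀ᶠ x in 𝓝 p, φ x = c) :
    IntegrableForm X (dForm S (smulForm φ a)) := by
  have hsm : ∀ p ∉ S, FormSmoothAt (ChernWeil.smulForm φ a) p := fun p hp =>
    (ha p hp).smulForm hφ.contMDiffAt
  have h1 : IntegrableForm X (dForm S (smulForm φ a) - ChernWeil.smulTwo φ (dForm S a)) := by
    refine integrableForm_of_continuousOn fun x w hw => ContinuousAt.continuousWithinAt ?_
    have he := chart_mem_holAtlas x
    by_cases hS : (chartAt ℂ x).symm w ∈ S
    · obtain ⟨c, hc⟩ := hc _ hS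
      refine (continuousAt_const (y := (0 : ℂ))).congr ?_
      filter_upwards [eventually_comp_symm hw hc.eventually_nhds,
        (chartAt ℂ x).open_target.eventually_mem hw] with y hy hy'
      simp only [Pi.sub_apply, ChernWeil.smulTwo]
      rw [dForm_smulForm_const he ha hy' hy, hy.self_of_nhds, sub_self]
    · have hev := eventually_comp_symm hw (eventually_notMem_finset hS)
      have h2 : ContinuousAt (dForm S (smulForm φ a) (chartAt ℂ x)) w :=
        (dCoeff_continuousAt ((hsm _ hS).contDiffAt_symm he hw)).congr
          (hev.mono fun y hy => (dForm_of_notMem hy).symm)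
      have h3 : ContinuousAt (dForm S a (chartAt ℂ x)) w :=
        (dCoeff_continuousAt ((ha _ hS).contDiffAt_symm he hw)).congr
          (hev.mono fun y hy => (dForm_of_notMem hy).symm)
      refine h2.sub (ContinuousAt.mul ?_ h3)
      exact (Complex.continuous_ofReal.comp hφ.continuous).continuousAt.comp
        ((chartAt ℂ x).symm.continuousAt hw)
  have h2 := h1.add (hi.smulTwo hφ.continuous)
  simpa using h2

theorem circ_congr {β β' : ℂ → ℂ →L[ℝ] ℂ} {c : ℂ} {R : ℝ} (hR : 0 < R)
    (h : ∀ w, 0 < ‖w - c‖ → ‖w - c‖ < R → β w = β' w) : circ β c =ᶠ[𝓝[>] 0] circ β' c := by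
  filter_upwards [Ioo_mem_nhdsGT hR] with r hr
  unfold circ
  congr 1
  ext θ
  have := norm_circleMap_sub (c := c) hr.1 θ
  rw [h _ (by rw [this]; exact hr.1) (by rw [this]; exact hr.2)]

theorem circ_congr_nhds {β β' : ℂ → ℂ →L[ℝ] ℂ} {c : ℂ} (h : ∀ᶠ w in 𝓝[≠] c, β w = β' w) :
    circ β c =ᶠ[𝓝[>] 0] circ β' c := by
  rw [eventually_nhdsWithin_iff, Metric.eventually_nhds_iff] at h
  obtain ⟨R, hR, h⟩ := h
  refine circ_congr hR fun w h1 h2 => h (by rwa [dist_eq_norm]) ?_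
  intro h3
  rw [mem_singleton_iff] at h3
  simp [h3] at h1

/-- The contribution of a singular point. -/
theorem tendsto_circ_inChart {φ : X → ℝ} {p : X} (ha : ∀ q ∉ S, FormSmoothAt a q)
    (hi : IntegrableForm X (dForm S (smulForm φ a))) (hφ : ContMDiff 𝓘(ℝ, ℂ) 𝓘(ℝ, ℝ) ∞ φ)
    (h1 : ∀ᶠ x in 𝓝 p, φ x = 1) (he : e ∈ holAtlas X) (hpe : p ∈ e.source) {R R' : ℝ}
    (hR' : 0 < R') (hR : R' < R) (hball : Metric.ball (e p) R ⊆ e.target)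
    (hs : tsupport φ ⊆ (e.source ∩ e ⁻¹' Metric.ball (e p) R') ∩ {x | x ∈ S → x = p}) :
    Tendsto (circ (inChart a e) (e p)) (𝓝[>] 0)
      (𝓝 (-surfaceIntegral (X := X) (dForm S (smulForm φ a)))) := by
  have hsm : ∀ p ∉ S, FormSmoothAt (smulForm φ a) p := fun p hp =>
    (ha p hp).smulForm hφ.contMDiffAt
  have hzero : ∀ e' ∈ holAtlas X, ∀ w ∈ e'.target, e'.symm w ∉ tsupport φ →
      dForm S (smulForm φ a) e' w = 0 := by
    intro e' he' w hw hw'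
    by_cases hS : e'.symm w ∈ S
    · exact dForm_of_mem hS
    · rw [dForm_of_notMem hS, dCoeff_smulForm_eq_zero hw hw']
  obtain ⟨hInt, heq⟩ := (isTwoForm_dForm hsm).surfaceIntegral_eq hi he
    fun e' he' w hw hw' => hzero e' he' w hw fun h => hw' (hs h).1.1
  have hoff : ∀ w ∈ e.target \ Metric.ball (e p) R, dForm S (smulForm φ a) e w = 0 := by
    intro w hw
    refine hzero e he w hw.1 fun h => hw.2 ?_
    have := (hs h).1.2
    simp only [mem_preimage, e.right_inv hw.1] at this
    exact Metric.ball_subset_ball hR.le this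
  have hae : dForm S (smulForm φ a) e =ᵐ[volume.restrict (Metric.ball (e p) R)]
      dCoeff (inChart (smulForm φ a) e) := by
    refine ae_restrict_of_ae_restrict_of_subset hball ?_
    exact ae_of_off_finite S e fun w _ hw => dForm_of_notMem hw
  have hev : circ (inChart a e) (e p) =ᶠ[𝓝[>] 0] circ (inChart (smulForm φ a) e) (e p) := by
    refine circ_congr_nhds (Filter.Eventually.filter_mono nhdsWithin_le_nhds ?_)
    have hpt := e.map_source hpe
    rw [← e.left_inv hpe] at h1
    filter_upwards [eventually_comp_symm hpt h1] with w hw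
    rw [inChart_smulForm, hw, one_smul]
  rw [heq, setIntegral_eq_of_subset_of_forall_sdiff_eq_zero e.open_target.measurableSet hball hoff,
    integral_congr_ae hae]
  refine Tendsto.congr' hev.symm (tendsto_circ_of_integrableOn hR' hR ?_ ?_
    ((hInt.mono_set hball).congr hae))
  · intro w hw0 hwR
    have hwt : w ∈ e.target := hball (by rwa [mem_ball_iff_norm])
    by_cases hS : e.symm w ∈ tsupport φ
    · refine (hsm _ fun h => ?_).contDiffAt_symm he hwt
      have h2 := (hs hS).2 h
      have h3 : w = e p := by rw [← h2, e.right_inv hwt]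
      rw [h3] at hw0
      simp at hw0
    · refine FormSmoothAt.contDiffAt_symm he hwt ?_
      exact formSmoothAt_zero.congr (smulForm_eventually_zero hS a)
  · intro w hw1 hwR
    have hwt : w ∈ e.target := hball (by rwa [mem_ball_iff_norm])
    have h0 : φ (e.symm w) = 0 := image_eq_zero_of_notMem_tsupport fun h => by
      have := (hs h).1.2
      simp only [mem_preimage, e.right_inv hwt, mem_ball_iff_norm] at this
      linarith
    rw [inChart_smulForm, h0]; exact zero_smul ℝ (inChart a e w)

theorem exists_bump_in_chart (S : Finset X) {p : X} (hpe : p ∈ e.source) {R : ℝ} (hR : 0 < R) :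
    ∃ φ : X → ℝ, ContMDiff 𝓘(ℝ, ℂ) 𝓘(ℝ, ℝ) ∞ φ ∧ (∀ᶠ x in 𝓝 p, φ x = 1) ∧
      tsupport φ ⊆ (e.source ∩ e ⁻¹' Metric.ball (e p) R) ∩ {x | x ∈ S → x = p} := by
  classical
  refine exists_bump (inter_mem ?_ ?_)
  · exact (e.isOpen_inter_preimage Metric.isOpen_ball).mem_nhds ⟨hpe, Metric.mem_ball_self hR⟩
  · have := eventually_notMem_finset (S := S.erase p) (Finset.notMem_erase p S)
    filter_upwards [this] with x hx hxS
    by_contra h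
    exact hx (Finset.mem_erase.2 ⟨h, hxS⟩)

/-- **Residue theorem**: if `a` is a `1`-form on a compact Riemann surface, smooth off the finite
set `S`, with integrable exterior derivative, then its circulations around the points of `S`
converge, and their sum is the opposite of the integral of `da`. -/
theorem residue_theorem (S : Finset X) (a : OneForm X) (ha : ∀ p ∉ S, FormSmoothAt a p)
    (hi : IntegrableForm X (dForm S a)) (c : X → OpenPartialHomeomorph X ℂ)
    (hc : ∀ p ∈ S, c p ∈ holAtlas X) (hpc : ∀ p ∈ S, p ∈ (c p).source) :
    ∃ L : X → ℂ, (∀ p ∈ S, Tendsto (circ (inChart a (c p)) (c p p)) (𝓝[>] 0) (𝓝 (L p))) ∧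
      surfaceIntegral (X := X) (dForm S a) + ∑ p ∈ S, L p = 0 := by
  classical
  have hR : ∀ p : X, ∃ R : ℝ, p ∈ S → 0 < R ∧ Metric.ball (c p p) R ⊆ (c p).target := by
    intro p
    by_cases hp : p ∈ S
    · obtain ⟨R, hR⟩ := Metric.isOpen_iff.1 (c p).open_target _ ((c p).map_source (hpc p hp))
      exact ⟨R, fun _ => hR⟩
    · exact ⟨0, fun h => absurd h hp⟩
  choose R hR using hR
  have hφ : ∀ p : X, ∃ φ : X → ℝ, p ∈ S → ContMDiff 𝓘(ℝ, ℂ) 𝓘(ℝ, ℝ) ∞ φ ∧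
      (∀ᶠ x in 𝓝 p, φ x = 1) ∧ tsupport φ ⊆
        ((c p).source ∩ c p ⁻¹' Metric.ball (c p p) (R p / 2)) ∩ {x | x ∈ S → x = p} := by
    intro p
    by_cases hp : p ∈ S
    · obtain ⟨φ, h⟩ := exists_bump_in_chart S (hpc p hp) (half_pos (hR p hp).1)
      exact ⟨φ, fun _ => h⟩
    · exact ⟨0, fun h => absurd h hp⟩
  choose φ hφ using hφ
  have hφz : ∀ p ∈ S, ∀ q ∈ S, q ≠ p → ∀ᶠ x in 𝓝 q, φ p x = 0 := by
    intro p hp q hq hqp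
    exact notMem_tsupport_iff_eventuallyEq.1 fun h => hqp (((hφ p hp).2.2 h).2 hq)
  have hφi : ∀ p ∈ S, IntegrableForm X (dForm S (smulForm (φ p) a)) := by
    intro p hp
    refine hi.dForm_smulForm ha (hφ p hp).1 fun q hq => ?_
    by_cases h : q = p
    · subst h; exact ⟨1, (hφ q hp).2.1⟩
    · exact ⟨0, hφz p hp q hq h⟩
  -- The form splits as `f a + ∑ φ_p a`. The factor `f` vanishes near `S`, so `f a` is smooth
  -- everywhere and its derivative integrates to zero by Stokes; each `φ_p a` has at most one
  -- singular point and lives in one coordinate disk.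
  set f : X → ℝ := fun x => 1 - ∑ p ∈ S, φ p x with hf
  have hfs : ContMDiff 𝓘(ℝ, ℂ) 𝓘(ℝ, ℝ) ∞ f :=
    contMDiff_const.sub (contMDiff_finsetSum fun p hp => (hφ p hp).1)
  have hf0 : ∀ p ∈ S, ∀ᶠ x in 𝓝 p, f x = 0 := by
    intro p hp
    have h1 : ∀ᶠ x in 𝓝 p, ∀ q ∈ S, φ q x = if q = p then 1 else 0 := by
      rw [Filter.eventually_all_finset]
      intro q hq
      by_cases h : q = p
      · subst h; simpa using (hφ q hp).2.1
      · simpa [h] using hφz q hq p hp (Ne.symm h)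
    filter_upwards [h1] with x hx
    rw [hf]
    simp only
    rw [Finset.sum_congr rfl hx]
    simp [hp]
  have hfa : ∀ p, FormSmoothAt (smulForm f a) p := by
    intro p
    by_cases hp : p ∈ S
    · refine formSmoothAt_zero.congr ?_
      filter_upwards [hf0 p hp] with x hx
      unfold smulForm
      rw [hx]
      exact zero_smul ℝ (a x)
    · exact (ha p hp).smulForm hfs.contMDiffAt
  have hdec : a = smulForm f a + ∑ p ∈ S, smulForm (φ p) a := by
    funext x
    rw [Pi.add_apply, Finset.sum_apply]
    unfold smulForm
    have h1 : (∑ p ∈ S, φ p x • a x) = (∑ p ∈ S, φ p x) • a x := (Finset.sum_smul).symm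
    rw [h1]
    have h2 : f x • a x + (∑ p ∈ S, φ p x) • a x = (f x + ∑ p ∈ S, φ p x) • a x :=
      (add_smul _ _ _).symm
    rw [h2, hf]
    simp only [sub_add_cancel]
    exact (one_smul ℝ (a x)).symm
  have hfi : IntegrableForm X (dForm S (smulForm f a)) :=
    hi.dForm_smulForm ha hfs fun p hp => ⟨0, hf0 p hp⟩
  have hf1 : surfaceIntegral (X := X) (dForm S (smulForm f a)) = 0 := by
    rw [← surfaceIntegral_dForm_eq_zero hfa]
    refine surfaceIntegral_congr_off_finite S fun e he w hw hS => ?_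
    rw [dForm_of_notMem hS, dForm_of_notMem (by simp)]
  refine ⟨fun p => -surfaceIntegral (X := X) (dForm S (smulForm (φ p) a)), fun p hp => ?_, ?_⟩
  · exact tendsto_circ_inChart ha (hφi p hp) (hφ p hp).1 (hφ p hp).2.1 (hc p hp) (hpc p hp)
      (half_pos (hR p hp).1) (half_lt_self (hR p hp).1) (hR p hp).2 (hφ p hp).2.2
  · have h1 : surfaceIntegral (X := X) (dForm S a) = surfaceIntegral (X := X)
        (dForm S (smulForm f a) + ∑ p ∈ S, dForm S (smulForm (φ p) a)) := by
      refine surfaceIntegral_congr _ _ fun e he w hw => ?_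
      conv_lhs => rw [hdec]
      have hsm : ∀ q ∈ S, ∀ p ∉ S, FormSmoothAt (smulForm (φ q) a) p := fun q hq p hp =>
        (ha p hp).smulForm (hφ q hq).1.contMDiffAt
      rw [dForm_add (fun p _ => hfa p)
        (fun p hp => formSmoothAt_sum S _ fun q hq => hsm q hq p hp) he hw,
        dForm_sum S _ hsm he hw]
      simp only [Pi.add_apply, Finset.sum_apply]
    rw [h1, surfaceIntegral_add hfi (integrableForm_sum _ _ hφi), surfaceIntegral_sum _ _ hφi, hf1,
      Finset.sum_neg_distrib]
    ring

/-- The circulation of a closed form around an isolated singularity does not depend on the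
coordinate. -/
theorem tendsto_circ_closed {p : X} (ha : ∀ᶠ x in 𝓝[≠] p, FormSmoothAt a x)
    (hd : ∀ᶠ x in 𝓝[≠] p, ∀ e ∈ holAtlas X, x ∈ e.source → dCoeff (inChart a e) (e x) = 0) :
    ∃ L : ℂ, ∀ e ∈ holAtlas X, p ∈ e.source →
      Tendsto (circ (inChart a e) (e p)) (𝓝[>] 0) (𝓝 L) := by
  classical
  have hboth := ha.and hd
  rw [eventually_nhdsWithin_iff] at hboth
  obtain ⟨φ, hφ, hφ1, hφs⟩ := exists_bump hboth
  have hsm : ∀ x ∉ ({p} : Finset X), FormSmoothAt (smulForm φ a) x := by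
    intro x hx
    by_cases h : x ∈ tsupport φ
    · exact ((hφs h) (by simpa using hx)).1.smulForm hφ.contMDiffAt
    · exact formSmoothAt_zero.congr (smulForm_eventually_zero h a)
  -- Where `φ = 1` the derivative of `φ a` is that of the closed form `a`, so it vanishes around `p`
  -- and its coefficient is continuous there.
  have hi : IntegrableForm X (dForm {p} (smulForm φ a)) := by
    refine integrableForm_of_continuousOn fun x w hw => ContinuousAt.continuousWithinAt ?_
    have he := chart_mem_holAtlas x
    by_cases hS : (chartAt ℂ x).symm w ∈ ({p} : Finset X)
    · refine (continuousAt_const (y := (0 : ℂ))).congr ?_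
      have hwp : (chartAt ℂ x).symm w = p := by simpa using hS
      have h1 := hφ1.eventually_nhds.and (hboth : ∀ᶠ x in 𝓝 p, _)
      rw [← hwp] at h1
      filter_upwards [eventually_comp_symm hw h1,
        (chartAt ℂ x).open_target.eventually_mem hw] with y hy hy'
      by_cases hyp : (chartAt ℂ x).symm y ∈ ({p} : Finset X)
      · rw [dForm_of_mem hyp]
      · have hyp' : (chartAt ℂ x).symm y ∈ ({(chartAt ℂ x).symm w} : Set X)ᶜ := by
          simpa [hwp] using hyp
        rw [dForm_of_notMem hyp]
        have h3 : ∀ᶠ z in 𝓝 ((chartAt ℂ x).symm y), smulForm φ a z = a z := by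
          filter_upwards [hy.1] with z hz
          unfold smulForm
          rw [hz]
          exact one_smul ℝ (a z)
        rw [dCoeff_inChart_congr hy' h3]
        have h4 := (hy.2 hyp').2 _ he ((chartAt ℂ x).map_target hy')
        rw [(chartAt ℂ x).right_inv hy'] at h4
        exact h4.symm
    · have hev := eventually_comp_symm hw (eventually_notMem_finset hS)
      exact (dCoeff_continuousAt ((hsm _ hS).contDiffAt_symm he hw)).congr
          (hev.mono fun y hy => (dForm_of_notMem hy).symm)
  -- The limit is given as an integral over the surface, in which the coordinate `e` does not occur.
  refine ⟨-surfaceIntegral (X := X) (dForm {p} (smulForm φ a)), fun e he hpe => ?_⟩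
  obtain ⟨L, hL, hsum⟩ := residue_theorem {p} (smulForm φ a) hsm hi (fun _ => e)
    (fun _ _ => he) (fun q hq => by rw [Finset.mem_singleton.1 hq]; exact hpe)
  rw [Finset.sum_singleton] at hsum
  rw [← eq_neg_of_add_eq_zero_right hsum]
  refine (hL p (Finset.mem_singleton_self p)).congr' ?_
  refine circ_congr_nhds (Filter.Eventually.filter_mono nhdsWithin_le_nhds ?_)
  rw [← e.left_inv hpe] at hφ1
  filter_upwards [eventually_comp_symm (e.map_source hpe) hφ1] with w hw
  rw [inChart_smulForm, hw, one_smul]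

end Stokes

/-! ### Connection forms in a trivialisation, and curvature -/

section Gauge

set_option linter.unusedSectionVars false

variable {ι : Type*} {X : Type*} [TopologicalSpace X] [ChartedSpace ℂ X] {U : Set X}
  {P : CircleBundle ι X U} {W W' : Set X} {h h' : ι → X → Circle} {x : X} {i j : ι}

theorem CircleBundle.smoothAt_g (P : CircleBundle ι X U) (hi : x ∈ P.base i) (hj : x ∈ P.base j) :
    SmoothCircleAt (P.g i j) x :=
  (P.smooth_g i j).smoothCircleAt
    (((P.isOpen_base i).inter (P.isOpen_base j)).mem_nhds ⟨hi, hj⟩)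

theorem CircleBundle.eventually_base (P : CircleBundle ι X U) (hi : x ∈ P.base i) :
    ∀ᶠ y in 𝓝 x, y ∈ P.base i :=
  (P.isOpen_base i).mem_nhds hi

theorem CircleBundle.exists_base (P : CircleBundle ι X U) (hx : x ∈ U) : ∃ i, x ∈ P.base i := by
  rw [← P.iUnion_base] at hx
  exact mem_iUnion.1 hx

theorem CircleBundle.IsTrivialisation.smoothAt (hh : P.IsTrivialisation W h) (hW : IsOpen W)
    (hi : x ∈ P.base i) (hx : x ∈ W) : SmoothCircleAt (h i) x :=
  (hh.1 i).smoothCircleAt (((P.isOpen_base i).inter hW).mem_nhds ⟨hi, hx⟩)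

/-- Passing from the index `c` to `i` adds `dlog (P.g c i)` to the connection form and also to
`dlog` of the trivialisation, so the choice of index made in `formIn` is immaterial. -/
theorem Connection.formIn_eq (A : Connection P) (hh : P.IsTrivialisation W h) (hW : IsOpen W)
    (hi : x ∈ P.base i) (hx : x ∈ W) : A.formIn h x = A.form i x - dlog (h i) x := by
  have hex : ∃ i, x ∈ P.base i := ⟨i, hi⟩
  unfold Connection.formIn
  rw [dif_pos hex]
  set c := Classical.choose hex
  have hc : x ∈ P.base c := Classical.choose_spec hex
  rw [A.gauge c i x ⟨hc, hi⟩]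
  have h1 : h i =ᶠ[𝓝 x] fun y => h c y * P.g c i y := by
    filter_upwards [P.eventually_base hi, P.eventually_base hc, hW.mem_nhds hx] with y h1 h2 h3
    exact hh.2 i c y ⟨⟨h1, h2⟩, h3⟩
  rw [dlog_congr h1, dlog_mul (hh.smoothAt hW hc hx) (P.smoothAt_g hc hi)]
  abel

open Classical in
/-- The transition function between two trivialisations: a point with coordinate `c` in the
trivialisation `h'` has coordinate `ratio P h h' x * c` in the trivialisation `h`. -/
def ratio (P : CircleBundle ι X U) (h h' : ι → X → Circle) (x : X) : Circle :=
  if hx : ∃ i, x ∈ P.base i then h (Classical.choose hx) x * (h' (Classical.choose hx) x)⁻¹ else 1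

theorem ratio_eq (hh : P.IsTrivialisation W h) (hh' : P.IsTrivialisation W' h')
    (hi : x ∈ P.base i) (hx : x ∈ W) (hx' : x ∈ W') : ratio P h h' x = h i x * (h' i x)⁻¹ := by
  have hex : ∃ i, x ∈ P.base i := ⟨i, hi⟩
  unfold ratio
  rw [dif_pos hex]
  set c := Classical.choose hex
  have hc : x ∈ P.base c := Classical.choose_spec hex
  rw [hh.2 i c x ⟨⟨hi, hc⟩, hx⟩, hh'.2 i c x ⟨⟨hi, hc⟩, hx'⟩, mul_inv, mul_mul_mul_comm,
    mul_inv_cancel, mul_one]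

theorem ratio_eventuallyEq (hh : P.IsTrivialisation W h) (hh' : P.IsTrivialisation W' h')
    (hW : IsOpen W) (hW' : IsOpen W') (hi : x ∈ P.base i) (hx : x ∈ W) (hx' : x ∈ W') :
    ratio P h h' =ᶠ[𝓝 x] fun y => h i y * (h' i y)⁻¹ := by
  filter_upwards [P.eventually_base hi, hW.mem_nhds hx, hW'.mem_nhds hx'] with y h1 h2 h3
  exact ratio_eq hh hh' h1 h2 h3

theorem smoothAt_ratio (hh : P.IsTrivialisation W h) (hh' : P.IsTrivialisation W' h')
    (hW : IsOpen W) (hW' : IsOpen W') (hU : x ∈ U) (hx : x ∈ W) (hx' : x ∈ W') :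
    SmoothCircleAt (ratio P h h') x := by
  obtain ⟨i, hi⟩ := P.exists_base hU
  exact ((hh.smoothAt hW hi hx).mul (hh'.smoothAt hW' hi hx').inv).congr
    (ratio_eventuallyEq hh hh' hW hW' hi hx hx')

theorem Connection.formIn_eq_add_dlog (A : Connection P) (hh : P.IsTrivialisation W h)
    (hh' : P.IsTrivialisation W' h') (hW : IsOpen W) (hW' : IsOpen W') (hU : x ∈ U) (hx : x ∈ W)
    (hx' : x ∈ W') : A.formIn h' x = A.formIn h x + dlog (ratio P h h') x := by
  obtain ⟨i, hi⟩ := P.exists_base hU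
  rw [A.formIn_eq hh hW hi hx, A.formIn_eq hh' hW' hi hx',
    dlog_congr (ratio_eventuallyEq hh hh' hW hW' hi hx hx'),
    dlog_mul (hh.smoothAt hW hi hx) (hh'.smoothAt hW' hi hx').inv,
    dlog_inv (hh'.smoothAt hW' hi hx')]
  abel

variable [IsManifold 𝓘(ℂ) ω X] {e : OpenPartialHomeomorph X ℂ} {w : ℂ}

theorem Connection.formSmoothAt (A : Connection P) (hi : x ∈ P.base i) :
    FormSmoothAt (A.form i) x :=
  (A.smooth_form i).formSmoothAt (P.isOpen_base i) hi

theorem Connection.dCoeff_form_eq (A : Connection P) (he : e ∈ holAtlas X) (hw : w ∈ e.target)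
    (hi : e.symm w ∈ P.base i) (hj : e.symm w ∈ P.base j) :
    dCoeff (inChart (A.form i) e) w = dCoeff (inChart (A.form j) e) w := by
  have h1 : ∀ᶠ y in 𝓝 (e.symm w), A.form j y = (A.form i + dlog (P.g i j)) y := by
    filter_upwards [P.eventually_base hi, P.eventually_base hj] with y h1 h2
    exact A.gauge i j y ⟨h1, h2⟩
  have h2 : ∀ᶠ y in 𝓝 (e.symm w), SmoothCircleAt (P.g i j) y := by
    filter_upwards [P.eventually_base hi, P.eventually_base hj] with y h1 h2
    exact P.smoothAt_g h1 h2
  rw [dCoeff_inChart_congr hw h1, dCoeff_inChart_add he hw (A.formSmoothAt hi)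
    (formSmoothAt_dlog h2), dCoeff_inChart_dlog he hw h2, add_zero]

theorem Connection.curvature_eq (A : Connection P) (he : e ∈ holAtlas X) (hw : w ∈ e.target)
    (hi : e.symm w ∈ P.base i) : A.curvature e w = dCoeff (inChart (A.form i) e) w := by
  have hex : ∃ i, e.symm w ∈ P.base i := ⟨i, hi⟩
  unfold Connection.curvature
  rw [dif_pos hex]
  exact A.dCoeff_form_eq he hw (Classical.choose_spec hex) hi

theorem Connection.formIn_eventuallyEq (A : Connection P) (hh : P.IsTrivialisation W h)
    (hW : IsOpen W) (hi : x ∈ P.base i) (hx : x ∈ W) :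
    ∀ᶠ y in 𝓝 x, A.formIn h y = (A.form i - dlog (h i)) y := by
  filter_upwards [P.eventually_base hi, hW.mem_nhds hx] with y h1 h2
  exact A.formIn_eq hh hW h1 h2

theorem CircleBundle.IsTrivialisation.eventually_smoothAt (hh : P.IsTrivialisation W h)
    (hW : IsOpen W) (hi : x ∈ P.base i) (hx : x ∈ W) : ∀ᶠ y in 𝓝 x, SmoothCircleAt (h i) y := by
  filter_upwards [P.eventually_base hi, hW.mem_nhds hx] with y h1 h2
  exact hh.smoothAt hW h1 h2

theorem Connection.formIn_smoothAt (A : Connection P) (hh : P.IsTrivialisation W h)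
    (hW : IsOpen W) (hU : x ∈ U) (hx : x ∈ W) : FormSmoothAt (A.formIn h) x := by
  obtain ⟨i, hi⟩ := P.exists_base hU
  exact ((A.formSmoothAt hi).sub (formSmoothAt_dlog (hh.eventually_smoothAt hW hi hx))).congr
    (A.formIn_eventuallyEq hh hW hi hx)

/-- The structure group is abelian: a change of trivialisation alters the connection form by the
closed form `dlog (h i)`, so the curvature is unchanged. -/
theorem Connection.dCoeff_formIn (A : Connection P) (hh : P.IsTrivialisation W h)
    (hW : IsOpen W) (he : e ∈ holAtlas X) (hw : w ∈ e.target) (hU : e.symm w ∈ U)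
    (hx : e.symm w ∈ W) : dCoeff (inChart (A.formIn h) e) w = A.curvature e w := by
  obtain ⟨i, hi⟩ := P.exists_base hU
  have hs := hh.eventually_smoothAt hW hi hx
  have h1 : ∀ᶠ y in 𝓝 (e.symm w), A.form i y = (A.formIn h + dlog (h i)) y := by
    filter_upwards [A.formIn_eventuallyEq hh hW hi hx] with y hy
    rw [Pi.add_apply, hy, Pi.sub_apply]
    exact (sub_add_cancel _ _).symm
  rw [A.curvature_eq he hw hi, dCoeff_inChart_congr hw h1, dCoeff_inChart_add he hw
    (A.formIn_smoothAt hh hW hU hx) (formSmoothAt_dlog hs), dCoeff_inChart_dlog he hw hs, add_zero]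

theorem Connection.integrableForm_curvature [T2Space X] [CompactSpace X] (A : Connection P)
    (hA : A.CurvatureExtends) (S : Finset X) (hS : ∀ x ∉ S, x ∈ U) :
    IntegrableForm X A.curvature := by
  classical
  choose f hf1 hf2 using hA
  -- The continuous extensions are given only for charts of the atlas. This suffices, since
  -- integrability is tested in the preferred charts and needs no transformation law.
  let F : OpenPartialHomeomorph X ℂ → ℂ → ℂ := fun e w =>
    if h : e ∈ atlas ℂ X then f e h w else 0
  have hF : IntegrableForm X F := by
    refine integrableForm_of_continuousOn fun x => ?_
    have : F (chartAt ℂ x) = f _ (chart_mem_atlas ℂ x) := by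
      ext w; simp only [F, dif_pos (chart_mem_atlas ℂ x)]
    rw [this]
    exact hf1 _ _
  refine hF.congr_off_finite S fun e he w hw hwS => ?_
  simp only [F, dif_pos he]
  exact hf2 e he w hw (hS _ hwS)

end Gauge

/-! ### Transversality in the plane -/

section Perturbation

/-- All zeros of `h` in `K` are nondegenerate. -/
def NondegenerateOn (h : ℂ → ℂ) (K : Set ℂ) : Prop :=
  ∀ w ∈ K, h w = 0 → (fderiv ℝ h w).det ≠ 0

/-- Having a zero with zero determinant is a closed condition on the pair formed by the parameter
and the point. It fails for the parameter `0` all along the compact set `K`, hence for all small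
parameters, by the tube lemma. -/
theorem NondegenerateOn.perturb {h k : ℂ → ℂ} {K : Set ℂ} (hK : IsCompact K)
    (hh : ∀ w ∈ K, ContDiffAt ℝ ∞ h w) (hk : ∀ w ∈ K, ContDiffAt ℝ ∞ k w)
    (hn : NondegenerateOn h K) :
    ∀ᶠ c : ℂ in 𝓝 0, NondegenerateOn (fun w => h w + c * k w) K := by
  have key : ∀ w ∈ K, ∀ᶠ q : ℂ × ℂ in 𝓝 (0 : ℂ) ×ˢ 𝓝 w,
      ¬(h q.2 + q.1 * k q.2 = 0 ∧ (fderiv ℝ h q.2 + q.1 • fderiv ℝ k q.2).det = 0) := by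
    intro w hw
    rw [← nhds_prod_eq]
    have c1 : ContinuousAt (fun q : ℂ × ℂ => q.2) (0, w) := continuousAt_snd
    have hc : ContinuousAt (fun q : ℂ × ℂ => h q.2 + q.1 * k q.2) (0, w) :=
      (ContinuousAt.comp (f := Prod.snd) (hh w hw).continuousAt c1).add
        (continuousAt_fst.mul (ContinuousAt.comp (f := Prod.snd) (hk w hw).continuousAt c1))
    have hd : ContinuousAt (fun q : ℂ × ℂ => (fderiv ℝ h q.2 + q.1 • fderiv ℝ k q.2).det)
        (0, w) := by
      have d1 : ContinuousAt (fderiv ℝ h) w := ((hh w hw).fderiv_right (m := 0) (by simp)).continuousAt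
      have d2 : ContinuousAt (fderiv ℝ k) w := ((hk w hw).fderiv_right (m := 0) (by simp)).continuousAt
      have d3 : ContinuousAt (fun q : ℂ × ℂ => fderiv ℝ h q.2 + q.1 • fderiv ℝ k q.2) (0, w) :=
        (ContinuousAt.comp (f := Prod.snd) d1 c1).add
          (continuousAt_fst.smul (ContinuousAt.comp (f := Prod.snd) d2 c1))
      exact ContinuousLinearMap.continuous_det.continuousAt.comp d3
    by_cases h0 : h w = 0
    · have h1 := hn w hw h0
      have h2 := hd.eventually_ne (y := 0) (by simpa using h1)
      exact h2.mono fun q hq h' => hq h'.2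
    · have h2 := hc.eventually_ne (y := 0) (by simpa using h0)
      exact h2.mono fun q hq h' => hq h'.1
  have h1 := hK.eventually_forall_of_forall_eventually (x₀ := (0 : ℂ))
    (P := fun c w => ¬(h w + c * k w = 0 ∧ (fderiv ℝ h w + c • fderiv ℝ k w).det = 0))
    fun w hw => by
      rw [nhds_prod_eq]
      exact key w hw
  filter_upwards [h1] with c hc w hw hz
  have h3 := hc w hw
  have h4 : fderiv ℝ (fun w => h w + c * k w) w = fderiv ℝ h w + c • fderiv ℝ k w := by
    have e1 := ((hh w hw).differentiableAt (by simp))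
    have e2 := ((hk w hw).differentiableAt (by simp))
    rw [fderiv_fun_add e1 (e2.const_mul c), fderiv_const_mul e2]
  rw [h4]
  exact fun h5 => h3 ⟨hz, h5⟩

/-- Sard's theorem: a degenerate zero of `h + c` makes `-c` a critical value of `h` on `K`, and
critical values form a null set. -/
theorem nondegenerateOn_ae {h : ℂ → ℂ} {K : Set ℂ} (hh : ∀ w ∈ K, ContDiffAt ℝ ∞ h w) :
    ∀ᵐ c : ℂ, NondegenerateOn (fun w => h w + c) K := by
  set s := {w ∈ K | (fderiv ℝ h w).det = 0} with hs
  have h0 : volume (h '' s) = 0 := addHaar_image_eq_zero_of_det_fderivWithin_eq_zero volume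
    (fun w hw => ((hh w hw.1).differentiableAt (by simp)).hasFDerivAt.hasFDerivWithinAt)
    (fun w hw => hw.2)
  have h1 : volume ((fun c : ℂ => -c) ⁻¹' (h '' s)) = 0 := by
    rw [Measure.measure_preimage_neg, h0]
  filter_upwards [measure_eq_zero_iff_ae_notMem.1 h1] with c hc w hw hz hd
  rw [fderiv_add_const] at hd
  exact hc ⟨w, ⟨hw, hd⟩, eq_neg_of_add_eq_zero_left hz⟩

theorem NondegenerateOn.isolated {h : ℂ → ℂ} {K : Set ℂ} {w : ℂ} (hn : NondegenerateOn h K)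
    (hw : w ∈ K) (hh : ContDiffAt ℝ ∞ h w) : ∀ᶠ x in 𝓝[≠] w, h x ≠ 0 := by
  by_cases h0 : h w = 0
  · have hd := (hh.differentiableAt (by simp)).hasFDerivAt
    have hdet := hn w hw h0
    set L := ContinuousLinearMap.toContinuousLinearEquivOfDetNeZero _ hdet
    refine hd.eventually_ne (c := 0) ?_
    exact ⟨_, L.antilipschitz⟩
  · exact (hh.continuousAt.eventually_ne h0).filter_mono nhdsWithin_le_nhds

end Perturbation

/-! ### Normalising a nonzero complex number -/

section Direction

/-- The direction of a nonzero complex number. -/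
def direction (z : ℂ) : Circle := Circle.exp z.arg

theorem coe_direction {z : ℂ} (hz : z ≠ 0) : (direction z : ℂ) = z / ‖z‖ := by
  have h : (‖z‖ : ℂ) ≠ 0 := by simpa using hz
  rw [direction, Circle.coe_exp, eq_div_iff h, mul_comm]
  exact Complex.norm_mul_exp_arg_mul_I z

theorem direction_mul (g : Circle) {z : ℂ} (hz : z ≠ 0) : direction (g * z) = g * direction z := by
  apply Circle.coe_injective
  rw [Circle.coe_mul, coe_direction hz, coe_direction (mul_ne_zero (Circle.coe_ne_zero g) hz),
    norm_mul, Circle.norm_coe, one_mul, mul_div_assoc]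

theorem contDiffAt_direction {z : ℂ} (hz : z ≠ 0) :
    ContDiffAt ℝ ∞ (fun z => (direction z : ℂ)) z := by
  have h1 : ContDiffAt ℝ ∞ (fun z : ℂ => z / (‖z‖ : ℂ)) z := by
    have hn : ContDiffAt ℝ ∞ (fun z : ℂ => (‖z‖ : ℂ)) z :=
      Complex.ofRealCLM.contDiff.contDiffAt.comp z (contDiffAt_norm ℝ hz)
    have hz' : ((‖z‖ : ℝ) : ℂ) ≠ 0 := by simpa using hz
    simp only [div_eq_mul_inv]
    exact contDiffAt_id.mul (hn.inv hz')
  refine h1.congr_of_eventuallyEq ?_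
  filter_upwards [isOpen_ne.mem_nhds hz] with w hw
  exact coe_direction hw

end Direction

/-! ### Existence of a section with finitely many singularities -/

section LineSections

set_option linter.unusedSectionVars false

variable {κ : Type*} {Y : Type*} [TopologicalSpace Y] [ChartedSpace ℂ Y]
  (Q : CircleBundle κ Y univ)

/-- Smooth sections of the complex line bundle associated with `Q`. -/
def IsLineSection (σ : κ → Y → ℂ) : Prop :=
  (∀ a, ∀ x ∈ Q.base a, ContMDiffAt 𝓘(ℝ, ℂ) 𝓘(ℝ, ℂ) ∞ (σ a) x) ∧
    ∀ a b, ∀ x ∈ Q.base a ∩ Q.base b, σ a x = Q.g a b x * σ b x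

variable {Q}

theorem IsLineSection.add_const_mul {σ ψ : κ → Y → ℂ} (hσ : IsLineSection Q σ)
    (hψ : IsLineSection Q ψ) (c : ℂ) : IsLineSection Q fun a x => σ a x + c * ψ a x := by
  refine ⟨fun a x hx => ?_, fun a b x hx => ?_⟩
  · have h : ContDiff ℝ ∞ fun q : ℂ × ℂ => q.1 + c * q.2 := by fun_prop
    exact h.contMDiff.contMDiffAt.comp x ((hσ.1 a x hx).prodMk_space (hψ.1 a x hx))
  · simp only
    rw [hσ.2 a b x hx, hψ.2 a b x hx]
    ring

theorem CircleBundle.g_self (Q : CircleBundle κ Y univ) {a : κ} {x : Y} (hx : x ∈ Q.base a) :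
    Q.g a a x = 1 :=
  mul_eq_left.1 (Q.cocycle a a a x ⟨⟨hx, hx⟩, hx⟩)

open Classical in
/-- A section supported near a point. -/
def bumpSection (Q : CircleBundle κ Y univ) (b : κ) (φ : Y → ℝ) (a : κ) (x : Y) : ℂ :=
  if x ∈ Q.base b then (φ x : ℂ) * Q.g a b x else 0

theorem isLineSection_bumpSection {b : κ} {φ : Y → ℝ} (hφ : ContMDiff 𝓘(ℝ, ℂ) 𝓘(ℝ, ℝ) ∞ φ)
    (hs : tsupport φ ⊆ Q.base b) : IsLineSection Q (bumpSection Q b φ) := by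
  refine ⟨fun a x hx => ?_, fun a c x hx => ?_⟩
  · by_cases hb : x ∈ Q.base b
    · have h1 : ContMDiffAt 𝓘(ℝ, ℂ) 𝓘(ℝ, ℂ) ∞ (fun y => (φ y : ℂ) * (Q.g a b y : ℂ)) x := by
        have h : ContDiff ℝ ∞ fun q : ℝ × ℂ => (q.1 : ℂ) * q.2 :=
          (Complex.ofRealCLM.contDiff.comp contDiff_fst).mul contDiff_snd
        exact h.contMDiff.contMDiffAt.comp x
          (ContMDiffAt.prodMk_space hφ.contMDiffAt (Q.smoothAt_g hx hb))
      refine h1.congr_of_eventuallyEq ?_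
      filter_upwards [Q.eventually_base hb] with y hy
      simp [bumpSection, hy]
    · have h0 : ∀ᶠ y in 𝓝 x, φ y = 0 := notMem_tsupport_iff_eventuallyEq.1 fun h => hb (hs h)
      refine (contMDiffAt_const (c := (0 : ℂ))).congr_of_eventuallyEq ?_
      filter_upwards [h0] with y hy
      simp [bumpSection, hy]
  · by_cases hb : x ∈ Q.base b
    · simp only [bumpSection, if_pos hb]
      rw [← Q.cocycle a c b x ⟨hx, hb⟩, Circle.coe_mul]
      ring
    · simp [bumpSection, hb]

variable [T2Space Y] [CompactSpace Y] [IsManifold 𝓘(ℂ) ω Y]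

/-- Near every point there are a bump section and a disk on which it is nowhere zero. -/
theorem exists_local_data (Q : CircleBundle κ Y univ) (y : Y) :
    ∃ (b : κ) (φ : Y → ℝ) (r : ℝ), IsLineSection Q (bumpSection Q b φ) ∧ 0 < r ∧
      ∀ w ∈ Metric.closedBall (chartAt ℂ y y) r, w ∈ (chartAt ℂ y).target ∧
        (chartAt ℂ y).symm w ∈ Q.base b ∧ ∀ᶠ z in 𝓝 ((chartAt ℂ y).symm w), φ z = 1 := by
  obtain ⟨b, hb⟩ := Q.exists_base (mem_univ y)
  obtain ⟨φ, hφ, hφ1, hφs⟩ := exists_bump ((Q.isOpen_base b).mem_nhds hb)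
  have hyt := mem_chart_target ℂ y
  have h1 : ∀ᶠ z in 𝓝 ((chartAt ℂ y).symm (chartAt ℂ y y)),
      z ∈ Q.base b ∧ ∀ᶠ z' in 𝓝 z, φ z' = 1 := by
    rw [(chartAt ℂ y).left_inv (mem_chart_source ℂ y)]
    exact (Q.eventually_base hb).and hφ1.eventually_nhds
  have h2 := ((chartAt ℂ y).open_target.eventually_mem hyt).and (eventually_comp_symm hyt h1)
  obtain ⟨r, hr, h3⟩ := Metric.nhds_basis_closedBall.eventually_iff.1 h2
  exact ⟨b, φ, r, isLineSection_bumpSection hφ hφs, hr, fun w hw => h3 hw⟩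

theorem IsLineSection.contDiffAt {σ : κ → Y → ℂ} (hσ : IsLineSection Q σ)
    {e : OpenPartialHomeomorph Y ℂ} (he : e ∈ holAtlas Y) {w : ℂ} (hw : w ∈ e.target) {a : κ}
    (ha : e.symm w ∈ Q.base a) : ContDiffAt ℝ ∞ (fun w => σ a (e.symm w)) w :=
  contDiffAt_comp_symm he hw (hσ.1 a _ ha)

/-- The associated line bundle has a section with only isolated zeros. -/
theorem exists_lineSection_isolated (Q : CircleBundle κ Y univ) :
    ∃ σ, IsLineSection Q σ ∧ ∀ x a, x ∈ Q.base a → ∀ᶠ z in 𝓝[≠] x, σ a z ≠ 0 := by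
  classical
  choose b φ r hsec hr hdat using exists_local_data Q
  -- The disks are treated one at a time. A multiple `c ψ` of a section that is a constant frame
  -- over the new disk is added: generic `c` makes the zeros there nondegenerate by Sard, and small
  -- `c` keeps the earlier disks good.
  have key : ∀ t : Finset Y, ∃ σ, IsLineSection Q σ ∧ ∀ y ∈ t,
      NondegenerateOn (fun w => σ (b y) ((chartAt ℂ y).symm w))
        (Metric.closedBall (chartAt ℂ y y) (r y)) := by
    intro t
    induction t using Finset.induction_on with
    | empty =>
      refine ⟨fun _ _ => 0, ⟨fun a x hx => contMDiffAt_const, fun a c x hx => by simp⟩, by simp⟩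
    | insert y t hy ih =>
      obtain ⟨σ, hσ, hn⟩ := ih
      set ψ := bumpSection Q (b y) (φ y) with hψ
      have hsm : ∀ (τ : κ → Y → ℂ), IsLineSection Q τ → ∀ y,
          ∀ w ∈ Metric.closedBall (chartAt ℂ y y) (r y),
          ContDiffAt ℝ ∞ (fun w => τ (b y) ((chartAt ℂ y).symm w)) w := fun τ hτ y w hw =>
        hτ.contDiffAt (chart_mem_holAtlas y) (hdat y w hw).1 (hdat y w hw).2.1
      have h1 : ∀ᶠ c : ℂ in 𝓝 0, ∀ y' ∈ t, NondegenerateOn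
          (fun w => σ (b y') ((chartAt ℂ y').symm w) + c * ψ (b y') ((chartAt ℂ y').symm w))
            (Metric.closedBall (chartAt ℂ y' y') (r y')) := by
        rw [Filter.eventually_all_finset]
        intro y' hy'
        exact (hn y' hy').perturb (isCompact_closedBall _ _) (hsm σ hσ y') (hsm ψ (hsec y) y')
      have h2 := nondegenerateOn_ae (hsm σ hσ y)
      -- A set of full measure is dense, so it meets the neighbourhood of `0` of admissible small
      -- parameters.
      obtain ⟨c, hc2, hc1⟩ := (Measure.dense_of_ae h2).inter_nhds_nonempty h1
      refine ⟨_, hσ.add_const_mul (hsec y) c, fun y' hy' => ?_⟩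
      rcases Finset.mem_insert.1 hy' with rfl | hy'
      · have hloc : ∀ w ∈ Metric.closedBall (chartAt ℂ y' y') (r y'),
            (fun w => σ (b y') ((chartAt ℂ y').symm w) + c * ψ (b y') ((chartAt ℂ y').symm w))
              =ᶠ[𝓝 w] fun w => σ (b y') ((chartAt ℂ y').symm w) + c := by
          intro w hw
          obtain ⟨d1, d2, d3⟩ := hdat y' w hw
          filter_upwards [eventually_comp_symm d1 (d3.and (Q.eventually_base d2))] with z hz
          simp only [hψ, bumpSection, if_pos hz.2, hz.1, Q.g_self hz.2]
          simp
        intro w hw hz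
        have h3 := hloc w hw
        have h4 := h3.fderiv_eq (𝕜 := ℝ)
        have h5 := h3.eq_of_nhds
        have h6 : σ (b y') ((chartAt ℂ y').symm w) + c = 0 := h5.symm.trans hz
        have h7 := hc2 w hw h6
        rw [← h4] at h7
        exact h7
      · exact hc1 y' hy'
  have hcov : ∀ y : Y, (chartAt ℂ y).source ∩ chartAt ℂ y ⁻¹'
      Metric.ball (chartAt ℂ y y) (r y) ∈ 𝓝 y := fun y =>
    ((chartAt ℂ y).isOpen_inter_preimage Metric.isOpen_ball).mem_nhds
      ⟨mem_chart_source ℂ y, Metric.mem_ball_self (hr y)⟩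
  obtain ⟨t, -, ht⟩ := isCompact_univ.elim_nhds_subcover _ fun y _ => hcov y
  obtain ⟨σ, hσ, hn⟩ := key t
  refine ⟨σ, hσ, fun x a ha => ?_⟩
  obtain ⟨y, hy, hxs, hxb⟩ := by
    simpa only [mem_iUnion, exists_prop] using ht (mem_univ x)
  set e := chartAt ℂ y with he
  have hxK : e x ∈ Metric.closedBall (e y) (r y) := Metric.ball_subset_closedBall hxb
  have hxd := hdat y _ hxK
  have h1 := (hn y hy).isolated hxK
    (hσ.contDiffAt (chart_mem_holAtlas y) hxd.1 hxd.2.1)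
  have h2 : Tendsto e (𝓝[≠] x) (𝓝[≠] (e x)) := by
    refine tendsto_nhdsWithin_iff.2 ⟨(e.continuousAt hxs).tendsto.mono_left nhdsWithin_le_nhds, ?_⟩
    rw [eventually_nhdsWithin_iff]
    filter_upwards [e.open_source.mem_nhds hxs] with z hz hzx h
    exact hzx (e.injOn hz hxs h)
  have hxb' : x ∈ Q.base (b y) := by
    have := hxd.2.1
    rwa [e.left_inv hxs] at this
  filter_upwards [h2.eventually h1, nhdsWithin_le_nhds (Q.eventually_base ha),
    nhdsWithin_le_nhds (Q.eventually_base hxb'),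
    nhdsWithin_le_nhds (e.open_source.mem_nhds hxs)] with z hz hza hzb hzs
  rw [e.left_inv hzs] at hz
  rw [hσ.2 a (b y) z ⟨hza, hzb⟩]
  exact mul_ne_zero (Circle.coe_ne_zero _) hz

theorem punctured_ball_of_eventually {e : OpenPartialHomeomorph Y ℂ} {x : Y} (hx : x ∈ e.source)
    {p : Y → Prop} (h : ∀ᶠ z in 𝓝[≠] x, p z) :
    ∃ R > 0, ∀ w, 0 < ‖w - e x‖ → ‖w - e x‖ < R → w ∈ e.target ∧ p (e.symm w) := by
  rw [eventually_nhdsWithin_iff, ← e.left_inv hx] at h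
  have hxt := e.map_source hx
  obtain ⟨R, hR, h1⟩ := Metric.eventually_nhds_iff.1
    ((e.open_target.eventually_mem hxt).and (eventually_comp_symm hxt h))
  refine ⟨R, hR, fun w h2 h3 => ?_⟩
  obtain ⟨h4, h5⟩ := h1 (by rwa [dist_eq_norm])
  refine ⟨h4, h5 fun h6 => ?_⟩
  rw [mem_singleton_iff] at h6
  have : w = e x := e.symm.injOn h4 hxt h6
  simp [this] at h2

theorem CircleBundle.IsSection.eventually_smoothAt {F : Finset Y} {s : κ → Y → Circle}
    (hs : Q.IsSection (F : Set Y)ᶜ s) {x : Y} {a : κ} (ha : x ∈ Q.base a) :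
    ∀ᶠ z in 𝓝[≠] x, SmoothCircleAt (s a) z := by
  classical
  have h1 := eventually_notMem_finset (S := F.erase x) (Finset.notMem_erase x F)
  rw [eventually_nhdsWithin_iff]
  filter_upwards [Q.eventually_base ha, h1] with z hz hzF hzx
  have hzF' : z ∉ F := fun h => hzF (Finset.mem_erase.2 ⟨hzx, h⟩)
  exact (hs.1 a).smoothCircleAt (((Q.isOpen_base a).inter
    F.finite_toSet.isClosed.isOpen_compl).mem_nhds ⟨hz, hzF'⟩)

theorem CircleBundle.IsSection.exists_hasIndex {F : Finset Y} {s : κ → Y → Circle}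
    (hs : Q.IsSection (F : Set Y)ᶜ s) (x : Y) : ∃ n, Q.HasIndex s x n := by
  obtain ⟨a, ha⟩ := Q.exists_base (mem_univ x)
  obtain ⟨R, hR, h1⟩ := punctured_ball_of_eventually (mem_chart_source ℂ x)
    (hs.eventually_smoothAt ha)
  obtain ⟨n, hn⟩ := exists_winding_punctured (h := fun w => s a ((chartAt ℂ x).symm w)) hR
    fun w h2 h3 => (h1 w h2 h3).2.comp_symm (chart_mem_holAtlas x) (h1 w h2 h3).1
  exact ⟨n, a, ha, hn⟩

/-- Every circle bundle over a compact Riemann surface has a section with finitely many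
singularities. -/
theorem CircleBundle.exists_hasDegree (Q : CircleBundle κ Y univ) : ∃ d, Q.HasDegree d := by
  classical
  obtain ⟨σ, hσ, hiso⟩ := exists_lineSection_isolated Q
  set Z : Set Y := {x | ∃ a, x ∈ Q.base a ∧ σ a x = 0} with hZ
  have hZ0 : ∀ x a, x ∈ Q.base a → x ∉ Z → σ a x ≠ 0 := fun x a ha hx h => hx ⟨a, ha, h⟩
  have hfin : Z.Finite := by
    -- Each point has a neighbourhood containing no other zero; finitely many of these cover, so
    -- there are finitely many zeros.
    have h1 : ∀ x : Y, {z | z ∈ Z → z = x} ∈ 𝓝 x := by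
      intro x
      obtain ⟨a, ha⟩ := Q.exists_base (mem_univ x)
      have h2 := hiso x a ha
      rw [eventually_nhdsWithin_iff] at h2
      filter_upwards [h2, Q.eventually_base ha] with z hz hza
      rintro ⟨c, hzc, hz0⟩
      by_contra hzx
      apply hz hzx
      rw [hσ.2 a c z ⟨hza, hzc⟩, hz0, mul_zero]
    obtain ⟨t, -, ht⟩ := isCompact_univ.elim_nhds_subcover _ fun x _ => h1 x
    refine t.finite_toSet.subset fun z hz => ?_
    obtain ⟨x, hx, hzx⟩ := by simpa only [mem_iUnion, exists_prop] using ht (mem_univ z)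
    rw [hzx hz]
    exact hx
  set s : κ → Y → Circle := fun a x => direction (σ a x) with hs
  have hsec : Q.IsSection (hfin.toFinset : Set Y)ᶜ s := by
    simp only [Finite.coe_toFinset]
    refine ⟨fun a x hx => ContMDiffAt.contMDiffWithinAt ?_, fun a c x hx => ?_⟩
    · exact (contDiffAt_direction (hZ0 x a hx.1 hx.2)).contMDiffAt.comp x (hσ.1 a x hx.1)
    · simp only [hs]
      rw [hσ.2 a c x hx.1, direction_mul _ (hZ0 x c hx.1.2 hx.2)]
  choose n hn using fun x => hsec.exists_hasIndex x
  exact ⟨_, hfin.toFinset, s, n, hsec, fun x _ => hn x, rfl⟩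

end LineSections

/-! ### Coordinate disks at the marked points and nodes -/

section Disks

set_option linter.unusedSectionVars false

variable {X : Type*} [TopologicalSpace X] [ChartedSpace ℂ X] {n k : ℕ}
  {C : MarkedNodalCurve X n k} (D : CoordDisks C)

theorem CoordDisks.eq_of_mem {s t : Fin n ⊕ Fin k × Bool} {p : X} (hs : p ∈ (D.z s).source)
    (ht : p ∈ (D.z t).source) : s = t := by
  by_contra h
  exact (D.disjoint s t h).le_bot ⟨hs, ht⟩

theorem CoordDisks.mem_regular {s : Fin n ⊕ Fin k × Bool} {p : X} (hs : p ∈ (D.z s).source)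
    (hp : p ≠ C.point s) : p ∈ C.regular := by
  rintro ⟨t, rfl⟩
  have := D.eq_of_mem hs (D.mem_source t)
  exact hp (by rw [this])

theorem CoordDisks.norm_lt_one {s : Fin n ⊕ Fin k × Bool} {p : X} (hs : p ∈ (D.z s).source) :
    ‖D.z s p‖ < 1 := by
  have := (D.z s).map_source hs
  rwa [D.target_eq, mem_ball_zero_iff] at this

theorem CoordDisks.mem_target {s : Fin n ⊕ Fin k × Bool} {w : ℂ} (hw : ‖w‖ < 1) :
    w ∈ (D.z s).target := by
  rwa [D.target_eq, mem_ball_zero_iff]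

theorem CoordDisks.ne_point {s : Fin n ⊕ Fin k × Bool} {p : X} (h : 0 < ‖D.z s p‖) :
    p ≠ C.point s := by
  rintro rfl
  simp [D.map_point] at h

/-- A closed disk of radius less than `1` is a compact image of a closed disk of the plane, hence
closed in the whole Hausdorff surface and not merely in the coordinate domain. -/
theorem CoordDisks.isClosed_disk [T2Space X] (s : Fin n ⊕ Fin k × Bool) {r : ℝ} (hr : r < 1) :
    IsClosed {p | p ∈ (D.z s).source ∧ ‖D.z s p‖ ≤ r} := by
  have hsub : Metric.closedBall (0 : ℂ) r ⊆ (D.z s).target := by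
    rw [D.target_eq]
    exact Metric.closedBall_subset_ball hr
  have h1 : IsCompact ((D.z s).symm '' Metric.closedBall (0 : ℂ) r) :=
    (isCompact_closedBall _ _).image_of_continuousOn ((D.z s).continuousOn_symm.mono hsub)
  convert h1.isClosed using 1
  ext p
  constructor
  · rintro ⟨h2, h3⟩
    exact ⟨D.z s p, by simpa using h3, (D.z s).left_inv h2⟩
  · rintro ⟨w, hw, rfl⟩
    refine ⟨(D.z s).map_target (hsub hw), ?_⟩
    rw [(D.z s).right_inv (hsub hw)]
    simpa using hw

/-- The complement of closed coordinate disks around the preimages of the nodes. -/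
def CoordDisks.outside (r : Fin k × Bool → ℝ) : Set X :=
  {p | ∀ j, p ∈ (D.z (Sum.inr j)).source → r j < ‖D.z (Sum.inr j) p‖}

theorem CoordDisks.isOpen_outside [T2Space X] {r : Fin k × Bool → ℝ} (hr : ∀ j, r j < 1) :
    IsOpen (D.outside r) := by
  have : D.outside r =
      ⋂ j, {p | p ∈ (D.z (Sum.inr j)).source ∧ ‖D.z (Sum.inr j) p‖ ≤ r j}ᶜ := by
    ext p
    simp only [CoordDisks.outside, mem_ofPred_eq, mem_iInter, mem_compl_iff, not_and, not_le]
  rw [this]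
  exact isOpen_iInter_of_finite fun j => (D.isClosed_disk _ (hr j)).isOpen_compl

theorem CoordDisks.truncated_eq_outside (ε : Fin k → ℂ) :
    D.truncated ε = D.outside fun j => ‖ε j.1‖ := by
  ext p
  simp only [CoordDisks.truncated, CoordDisks.outside, mem_ofPred_eq, Prod.forall]

theorem CoordDisks.mem_outside_of_mem {r : Fin k × Bool → ℝ} {j : Fin k × Bool} {p : X}
    (hp : p ∈ (D.z (Sum.inr j)).source) (h : r j < ‖D.z (Sum.inr j) p‖) : p ∈ D.outside r := by
  intro i hi
  have := D.eq_of_mem hi hp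
  rw [Sum.inr.injEq] at this
  subst this
  exact h

theorem CoordDisks.mark_mem_outside (r : Fin k × Bool → ℝ) {m : Fin n} {p : X}
    (hp : p ∈ (D.z (Sum.inl m)).source) : p ∈ D.outside r := by
  intro i hi
  have := D.eq_of_mem hi hp
  simp at this

theorem isOpen_regular [T2Space X] (C : MarkedNodalCurve X n k) : IsOpen C.regular :=
  (finite_range C.point).isClosed.isOpen_compl

end Disks

/-! ### Local biholomorphisms and pull-back of the index -/

section SmoothingMap

set_option linter.unusedSectionVars false

variable {X : Type*} [TopologicalSpace X] [ChartedSpace ℂ X]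
  {Y : Type*} [TopologicalSpace Y] [ChartedSpace ℂ Y] [IsManifold 𝓘(ℂ) ω X]
  [IsManifold 𝓘(ℂ) ω Y]

/-- A local biholomorphism pulls back coordinates. -/
theorem exists_chart_of_localBiholomorphism {q : X → Y} {p : X}
    (h : IsLocalDiffeomorphAt 𝓘(ℂ) 𝓘(ℂ) ω q p) :
    ∃ e ∈ holAtlas X, p ∈ e.source ∧ (∀ x ∈ e.source, q x ∈ (chartAt ℂ (q p)).source ∧
      e x = chartAt ℂ (q p) (q x)) := by
  obtain ⟨Φ, hp, hΦ⟩ := h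
  let Ψ : OpenPartialHomeomorph X Y :=
    { toPartialEquiv := Φ.toPartialEquiv
      open_source := Φ.open_source
      open_target := Φ.open_target
      continuousOn_toFun := Φ.contMDiffOn_toFun.continuousOn
      continuousOn_invFun := Φ.contMDiffOn_invFun.continuousOn }
  have hΨ : ∀ x ∈ Ψ.source, q x = Ψ x := fun x hx => hΦ hx
  set c := chartAt ℂ (q p)
  have hc : c ∈ holAtlas Y := IsManifold.chart_mem_maximalAtlas _
  refine ⟨Ψ ≫ₕ c, ?_, ?_, ?_⟩
  · refine OpenPartialHomeomorph.mem_maximalAtlas_of_contMDiffOn (I := 𝓘(ℂ)) (n := ω)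
      (Ψ ≫ₕ c) ?_ ?_
    · refine (contMDiffOn_of_mem_maximalAtlas hc).comp
        (Φ.contMDiffOn_toFun.mono ?_) ?_
      · intro x hx
        rw [OpenPartialHomeomorph.trans_source] at hx
        exact hx.1
      · intro x hx
        rw [OpenPartialHomeomorph.trans_source] at hx
        exact hx.2
    · refine Φ.contMDiffOn_invFun.comp
        ((contMDiffOn_symm_of_mem_maximalAtlas hc).mono ?_) ?_
      · intro x hx
        rw [OpenPartialHomeomorph.trans_target] at hx
        exact hx.1
      · intro x hx
        rw [OpenPartialHomeomorph.trans_target] at hx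
        exact hx.2
  · rw [OpenPartialHomeomorph.trans_source]
    refine ⟨hp, ?_⟩
    rw [mem_preimage, ← hΨ p hp]
    exact mem_chart_source ℂ (q p)
  · intro x hx
    rw [OpenPartialHomeomorph.trans_source] at hx
    rw [hΨ x hx.1]
    exact ⟨hx.2, rfl⟩

theorem eventually_punctured_nhds {Z : Type*} [TopologicalSpace Z] [T1Space Z] {p : Z}
    {P : Z → Prop} (h : ∀ᶠ x in 𝓝[≠] p, P x) : ∀ᶠ x in 𝓝[≠] p, ∀ᶠ z in 𝓝 x, P z := by
  rw [eventually_nhdsWithin_iff] at h ⊢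
  filter_upwards [h.eventually_nhds] with x hx hxp
  filter_upwards [hx, isOpen_compl_singleton.mem_nhds hxp] with z h1 h2 using h1 h2

variable {q : X → Y} {p : X}

theorem eventuallyEq_of_chart {e : OpenPartialHomeomorph X ℂ} (hp : p ∈ e.source)
    (h : ∀ x ∈ e.source, q x ∈ (chartAt ℂ (q p)).source ∧ e x = chartAt ℂ (q p) (q x)) :
    q =ᶠ[𝓝 p] fun x => (chartAt ℂ (q p)).symm (e x) := by
  filter_upwards [e.open_source.mem_nhds hp] with x hx
  rw [(h x hx).2, (chartAt ℂ (q p)).left_inv (h x hx).1]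

theorem contMDiffAt_real_of_localBiholomorphism (h : IsLocalDiffeomorphAt 𝓘(ℂ) 𝓘(ℂ) ω q p) :
    ContMDiffAt 𝓘(ℝ, ℂ) 𝓘(ℝ, ℂ) ∞ q p := by
  obtain ⟨e, he, hp, heq⟩ := exists_chart_of_localBiholomorphism h
  refine ContMDiffAt.congr_of_eventuallyEq ?_ (eventuallyEq_of_chart hp heq)
  have hc : chartAt ℂ (q p) ∈ holAtlas Y := IsManifold.chart_mem_maximalAtlas _
  refine ContMDiffAt.comp p ?_ (contMDiffAt_of_mem_maximalAtlas (holAtlas_subset_real he) hp)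
  rw [(heq p hp).2]
  exact contMDiffAt_symm_of_mem_maximalAtlas (holAtlas_subset_real hc) (mem_chart_target ℂ (q p))

theorem SmoothCircleAt.comp_localBiholomorphism {g : Y → Circle}
    (h : IsLocalDiffeomorphAt 𝓘(ℂ) 𝓘(ℂ) ω q p) (hg : SmoothCircleAt g (q p)) :
    SmoothCircleAt (fun x => g (q x)) p :=
  ContMDiffAt.comp (g := fun y => (g y : ℂ)) p hg (contMDiffAt_real_of_localBiholomorphism h)

theorem tendsto_punctured_of_localBiholomorphism (h : IsLocalDiffeomorphAt 𝓘(ℂ) 𝓘(ℂ) ω q p) :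
    Tendsto q (𝓝[≠] p) (𝓝[≠] (q p)) := by
  obtain ⟨e, he, hp, heq⟩ := exists_chart_of_localBiholomorphism h
  refine tendsto_nhdsWithin_iff.2
    ⟨(contMDiffAt_real_of_localBiholomorphism h).continuousAt.tendsto.mono_left nhdsWithin_le_nhds, ?_⟩
  rw [eventually_nhdsWithin_iff]
  filter_upwards [e.open_source.mem_nhds hp] with x hx hxp h1
  apply hxp
  apply e.injOn hx hp
  rw [(heq x hx).2, (heq p hp).2, h1]

theorem eventually_localDiffeomorphAt (h : IsLocalDiffeomorphAt 𝓘(ℂ) 𝓘(ℂ) ω q p) :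
    ∀ᶠ x in 𝓝 p, IsLocalDiffeomorphAt 𝓘(ℂ) 𝓘(ℂ) ω q x := by
  obtain ⟨Φ, hp, hΦ⟩ := h
  filter_upwards [Φ.open_source.mem_nhds hp] with x hx
  exact ⟨Φ, hx, hΦ⟩

variable {κ : Type*} {Q : CircleBundle κ Y univ} [T2Space X] [CompactSpace X] [T2Space Y] [CompactSpace Y]

/-- The index of a section is the limit of its normalised circulations after pull-back by a local
biholomorphism. -/
theorem tendsto_circ_dlog_pullback {F : Finset Y} {s : κ → Y → Circle}
    (hs : Q.IsSection (F : Set Y)ᶜ s) (h : IsLocalDiffeomorphAt 𝓘(ℂ) 𝓘(ℂ) ω q p) {N : ℤ}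
    (hN : Q.HasIndex s (q p) N) : ∃ a, q p ∈ Q.base a ∧ ∀ e ∈ holAtlas X, p ∈ e.source →
      Tendsto (circ (inChart (dlog fun x => s a (q x)) e) (e p)) (𝓝[>] 0)
        (𝓝 (2 * Real.pi * Complex.I * N)) := by
  obtain ⟨a, ha, hw⟩ := hN
  refine ⟨a, ha, ?_⟩
  have hsm : ∀ᶠ x in 𝓝[≠] p, SmoothCircleAt (fun x => s a (q x)) x := by
    filter_upwards [(tendsto_punctured_of_localBiholomorphism h).eventually (hs.eventually_smoothAt ha),
      nhdsWithin_le_nhds (eventually_localDiffeomorphAt h)] with x h1 h2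
    exact h1.comp_localBiholomorphism h2
  have hsm2 : ∀ᶠ x in 𝓝[≠] p, ∀ᶠ z in 𝓝 x, SmoothCircleAt (fun x => s a (q x)) z := by
    exact eventually_punctured_nhds hsm
  -- The pulled back form is closed near `p`, so its limit circulation exists and is the same in
  -- every coordinate. It is then computed in the coordinate pulled back by `q`, where the circles
  -- are those in the definition of the index.
  obtain ⟨L, hL⟩ := tendsto_circ_closed (a := dlog fun x => s a (q x)) (p := p)
    (hsm2.mono fun x hx => formSmoothAt_dlog hx)
    (hsm2.mono fun x hx e he hxe => dCoeff_inChart_dlog he (e.map_source hxe)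
      (by rwa [e.left_inv hxe]))
  suffices hLN : L = 2 * Real.pi * Complex.I * N by
    rw [← hLN]; exact hL
  obtain ⟨e, he, hp, heq⟩ := exists_chart_of_localBiholomorphism h
  refine tendsto_nhds_unique (hL e he hp) (tendsto_const_nhds.congr' ?_)
  obtain ⟨R, hR, hball⟩ := punctured_ball_of_eventually hp hsm
  obtain ⟨R', hR', hball'⟩ := punctured_ball_of_eventually (mem_chart_source ℂ (q p))
    (hs.eventually_smoothAt ha)
  have hsymm : ∀ w ∈ e.target, q (e.symm w) = (chartAt ℂ (q p)).symm w := by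
    intro w hw
    have h1 := heq _ (e.map_target hw)
    rw [e.right_inv hw] at h1
    conv_rhs => rw [h1.2]
    exact ((chartAt ℂ (q p)).left_inv h1.1).symm
  have hform : ∀ w, 0 < ‖w - e p‖ → ‖w - e p‖ < R → inChart (dlog fun x => s a (q x)) e w =
      dlogC (fun w => s a ((chartAt ℂ (q p)).symm w)) w := by
    intro w h1 h2
    obtain ⟨h3, h4⟩ := hball w h1 h2
    rw [inChart_dlog he h3 h4]
    apply dlogC_congr
    filter_upwards [e.open_target.mem_nhds h3] with z hz
    rw [hsymm z hz]
  have h5 := circ_congr hR hform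
  filter_upwards [h5, hw, Ioo_mem_nhdsGT hR'] with r h6 h7 h8
  rw [h6, (heq p hp).2, circ_dlogC_of_hasWinding _ h7]
  intro θ
  have h9 := norm_circleMap_sub (c := chartAt ℂ (q p) (q p)) h8.1 θ
  have h10 := hball' (circleMap (chartAt ℂ (q p) (q p)) r θ) (by rw [h9]; exact h8.1)
    (by rw [h9]; exact h8.2)
  exact h10.2.comp_symm (IsManifold.chart_mem_maximalAtlas _) h10.1

end SmoothingMap

/-! ### Pulling a section back to the normalisation -/

section Gluing

set_option linter.unusedSectionVars false

variable {X : Type*} [TopologicalSpace X] [ChartedSpace ℂ X] {n k : ℕ}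
  {C : MarkedNodalCurve X n k} {D : CoordDisks C} {ι : Type*} {P : CircleBundle ι X C.regular}
  {T : Framing D P} {Y : Type*} [TopologicalSpace Y] [ChartedSpace ℂ Y]
  {S : Smoothing D Y} {κ : Type*} {Q : CircleBundle κ Y univ} (E : Extension T S Q)
  {F : Finset Y} {s : κ → Y → Circle}

/-- The trivialisation of `P` given by the pull-back of a section of `Q`. -/
def Extension.pullTriv (s : κ → Y → Circle) (i : ι) (p : X) : Circle :=
  E.u i (Classical.choose (Q.exists_base (mem_univ (S.q p)))) p *
    (s (Classical.choose (Q.exists_base (mem_univ (S.q p)))) (S.q p))⁻¹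

/-- Changing the trivialisation of `Q` multiplies `u` and `s` by the same factor, so the quotient
does not depend on it. The quotient is `u s⁻¹`, since the pulled back section has coordinate `u⁻¹ s`
and must become the constant `1`. -/
theorem Extension.pullTriv_eq (hs : Q.IsSection (F : Set Y)ᶜ s) {i : ι} {a : κ} {p : X}
    (hp : p ∈ D.truncated S.ε) (hi : p ∈ P.base i) (ha : S.q p ∈ Q.base a) (hF : S.q p ∉ F) :
    E.pullTriv s i p = E.u i a p * (s a (S.q p))⁻¹ := by
  unfold Extension.pullTriv
  set c := Classical.choose (Q.exists_base (mem_univ (S.q p)))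
  have hc : S.q p ∈ Q.base c := Classical.choose_spec (Q.exists_base (mem_univ (S.q p)))
  rw [E.change_right i a c p hp hi ha hc, hs.2 c a (S.q p) ⟨⟨hc, ha⟩, hF⟩, mul_inv,
    mul_mul_mul_comm, mul_inv_cancel, one_mul]

/-- The domain of the pulled back trivialisation. -/
def pullDomain (S : Smoothing D Y) (F : Finset Y) : Set X :=
  D.truncated S.ε ∩ C.regular ∩ S.q ⁻¹' (F : Set Y)ᶜ

theorem Smoothing.localDiffeomorphAt (S : Smoothing D Y) {p : X} (hp : p ∈ D.truncated S.ε) :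
    IsLocalDiffeomorphAt 𝓘(ℂ) 𝓘(ℂ) ω S.q p :=
  S.isLocalBiholomorphism ⟨p, hp⟩

variable [IsManifold 𝓘(ℂ) ω X] [IsManifold 𝓘(ℂ) ω Y] [T2Space X] [T2Space Y]

theorem Smoothing.continuousAt (S : Smoothing D Y) {p : X} (hp : p ∈ D.truncated S.ε) :
    ContinuousAt S.q p :=
  (contMDiffAt_real_of_localBiholomorphism (S.localDiffeomorphAt hp)).continuousAt

theorem Smoothing.isOpen_truncated (S : Smoothing D Y) : IsOpen (D.truncated S.ε) := by
  rw [D.truncated_eq_outside]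
  exact D.isOpen_outside fun j => S.norm_ε_lt_one j.1

theorem isOpen_pullDomain (S : Smoothing D Y) (F : Finset Y) : IsOpen (pullDomain S F) := by
  unfold pullDomain
  refine ContinuousOn.isOpen_inter_preimage (fun p hp => ?_)
    (S.isOpen_truncated.inter (isOpen_regular C)) F.finite_toSet.isClosed.isOpen_compl
  exact (S.continuousAt hp.1).continuousWithinAt

theorem Extension.smoothAt_u {i : ι} {a : κ} {p : X} (hp : p ∈ D.truncated S.ε)
    (hi : p ∈ P.base i) (ha : S.q p ∈ Q.base a) : SmoothCircleAt (E.u i a) p := by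
  refine (E.smooth_u i a).smoothCircleAt ?_
  refine inter_mem (inter_mem (S.isOpen_truncated.mem_nhds hp) ((P.isOpen_base i).mem_nhds hi)) ?_
  exact (S.continuousAt hp).preimage_mem_nhds ((Q.isOpen_base a).mem_nhds ha)

theorem smoothAt_section (hs : Q.IsSection (F : Set Y)ᶜ s) {a : κ} {y : Y} (ha : y ∈ Q.base a)
    (hF : y ∉ F) : SmoothCircleAt (s a) y :=
  (hs.1 a).smoothCircleAt (((Q.isOpen_base a).inter
    F.finite_toSet.isClosed.isOpen_compl).mem_nhds ⟨ha, hF⟩)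

theorem smoothAt_section_comp (hs : Q.IsSection (F : Set Y)ᶜ s) {a : κ} {p : X}
    (hp : p ∈ D.truncated S.ε) (ha : S.q p ∈ Q.base a) (hF : S.q p ∉ F) :
    SmoothCircleAt (fun x => s a (S.q x)) p :=
  (smoothAt_section hs ha hF).comp_localBiholomorphism (S.localDiffeomorphAt hp)

theorem Extension.pullTriv_eventuallyEq (hs : Q.IsSection (F : Set Y)ᶜ s) {i : ι} {a : κ} {p : X}
    (hp : p ∈ pullDomain S F) (hi : p ∈ P.base i) (ha : S.q p ∈ Q.base a) :
    E.pullTriv s i =ᶠ[𝓝 p] fun x => E.u i a x * (s a (S.q x))⁻¹ := by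
  filter_upwards [(isOpen_pullDomain S F).mem_nhds hp, P.eventually_base hi,
    (S.continuousAt hp.1.1).eventually (Q.eventually_base ha)] with x h1 h2 h3
  exact E.pullTriv_eq hs h1.1.1 h2 h3 h1.2

theorem Extension.isTrivialisation_pullTriv (hs : Q.IsSection (F : Set Y)ᶜ s) :
    P.IsTrivialisation (pullDomain S F) (E.pullTriv s) := by
  refine ⟨fun i p hp => ContMDiffAt.contMDiffWithinAt ?_, fun i j p hp => ?_⟩
  · obtain ⟨a, ha⟩ := Q.exists_base (mem_univ (S.q p))
    exact ((E.smoothAt_u hp.2.1.1 hp.1 ha).mul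
      (smoothAt_section_comp hs hp.2.1.1 ha hp.2.2).inv).congr
        (E.pullTriv_eventuallyEq hs hp.2 hp.1 ha)
  · obtain ⟨a, ha⟩ := Q.exists_base (mem_univ (S.q p))
    rw [E.pullTriv_eq hs hp.2.1.1 hp.1.1 ha hp.2.2, E.pullTriv_eq hs hp.2.1.1 hp.1.2 ha hp.2.2,
      E.change_left j i a p hp.2.1.1 hp.1.2 hp.1.1 ha]
    exact mul_right_comm _ _ _

/-- The punctured coordinate disk. -/
def puncturedDisk (D : CoordDisks C) (t : Fin n ⊕ Fin k × Bool) : Set X :=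
  (D.z t).source \ {C.point t}

theorem isOpen_puncturedDisk (t : Fin n ⊕ Fin k × Bool) : IsOpen (puncturedDisk D t) :=
  (D.z t).open_source.sdiff isClosed_singleton

theorem puncturedDisk_subset (t : Fin n ⊕ Fin k × Bool) : puncturedDisk D t ⊆ C.regular :=
  fun _ hp => D.mem_regular hp.1 hp.2

/-- The coordinate of the pulled back section in the trivialisation over a punctured disk. -/
def Extension.coord (s : κ → Y → Circle) (t : Fin n ⊕ Fin k × Bool) : X → Circle :=
  ratio P (T.triv t) (E.pullTriv s)

/-- The grouping isolates the quotient of `u` by the given trivialisation, which is the quantity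
controlled by the gluing conditions `neck` and `mark` of `Extension`. -/
theorem Extension.coord_eq (hs : Q.IsSection (F : Set Y)ᶜ s) {t : Fin n ⊕ Fin k × Bool} {i : ι}
    {a : κ} {p : X} (hp : p ∈ pullDomain S F) (ht : p ∈ puncturedDisk D t) (hi : p ∈ P.base i)
    (ha : S.q p ∈ Q.base a) :
    E.coord s t p = (E.u i a p * (T.triv t i p)⁻¹)⁻¹ * s a (S.q p) := by
  unfold Extension.coord
  rw [ratio_eq (T.isTrivialisation t) (E.isTrivialisation_pullTriv hs) hi ht hp,
    E.pullTriv_eq hs hp.1.1 hi ha hp.2]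
  simp only [mul_inv, inv_inv]
  rw [← mul_assoc, mul_comm (T.triv t i p)]

theorem Extension.smoothAt_coord (hs : Q.IsSection (F : Set Y)ᶜ s) {t : Fin n ⊕ Fin k × Bool}
    {p : X} (hp : p ∈ pullDomain S F) (ht : p ∈ puncturedDisk D t) :
    SmoothCircleAt (E.coord s t) p :=
  smoothAt_ratio (T.isTrivialisation t) (E.isTrivialisation_pullTriv hs) (isOpen_puncturedDisk t)
    (isOpen_pullDomain S F) (puncturedDisk_subset t ht) ht hp

theorem Extension.eventually_smoothAt_coord (hs : Q.IsSection (F : Set Y)ᶜ s)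
    {t : Fin n ⊕ Fin k × Bool} {p : X} (hp : p ∈ pullDomain S F) (ht : p ∈ puncturedDisk D t) :
    ∀ᶠ x in 𝓝 p, SmoothCircleAt (E.coord s t) x := by
  filter_upwards [(isOpen_pullDomain S F).mem_nhds hp, (isOpen_puncturedDisk t).mem_nhds ht]
    with x h1 h2
  exact E.smoothAt_coord hs h1 h2

theorem Extension.formIn_pullTriv (A : Connection P) (hs : Q.IsSection (F : Set Y)ᶜ s)
    {t : Fin n ⊕ Fin k × Bool} {p : X} (hp : p ∈ pullDomain S F) (ht : p ∈ puncturedDisk D t) :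
    A.formIn (E.pullTriv s) p = A.formIn (T.triv t) p + dlog (E.coord s t) p :=
  A.formIn_eq_add_dlog (T.isTrivialisation t) (E.isTrivialisation_pullTriv hs)
    (isOpen_puncturedDisk t) (isOpen_pullDomain S F) (puncturedDisk_subset t ht) ht hp

theorem Smoothing.map_plumbed (S : Smoothing D Y) {l : Fin k} {b : Bool} {p p' : X}
    (hp : p ∈ D.truncated S.ε) (hp' : p' ∈ D.truncated S.ε) (h : D.Plumbed S.ε l b p p') :
    S.q p = S.q p' :=
  (S.map_eq_iff p hp p' hp').2 (Or.inr ⟨l, b, h⟩)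

theorem truncated_norm_pos (S : Smoothing D Y) {j : Fin k × Bool} {p : X}
    (hp : p ∈ D.truncated S.ε) (hj : p ∈ (D.z (Sum.inr j)).source) :
    ‖S.ε j.1‖ < ‖D.z (Sum.inr j) p‖ := hp j.1 j.2 hj

theorem truncated_mem_puncturedDisk (S : Smoothing D Y) {j : Fin k × Bool} {p : X}
    (hp : p ∈ D.truncated S.ε) (hj : p ∈ (D.z (Sum.inr j)).source) :
    p ∈ puncturedDisk D (Sum.inr j) :=
  ⟨hj, D.ne_point ((norm_nonneg _).trans_lt (truncated_norm_pos S hp hj))⟩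

/-- Plumbed points have the same image under `q`, hence the same value of `s`, and the condition
`neck` equates the remaining factors. -/
theorem Extension.coord_plumbed (hs : Q.IsSection (F : Set Y)ᶜ s) {l : Fin k} {b : Bool} {p p' : X}
    (hp : p ∈ D.truncated S.ε) (hp' : p' ∈ D.truncated S.ε) (h : D.Plumbed S.ε l b p p')
    (hF : S.q p ∉ F) : E.coord s (Sum.inr (l, b)) p = E.coord s (Sum.inr (l, !b)) p' := by
  have hq := S.map_plumbed hp hp' h
  have hd := truncated_mem_puncturedDisk S hp h.1
  have hd' := truncated_mem_puncturedDisk S hp' h.2.1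
  have hr := puncturedDisk_subset _ hd
  have hr' := puncturedDisk_subset _ hd'
  obtain ⟨i, hi⟩ := P.exists_base hr
  obtain ⟨j, hj⟩ := P.exists_base hr'
  obtain ⟨a, ha⟩ := Q.exists_base (mem_univ (S.q p))
  rw [E.coord_eq hs ⟨⟨hp, hr⟩, hF⟩ hd hi ha,
    E.coord_eq hs ⟨⟨hp', hr'⟩, by rw [mem_preimage, ← hq]; exact hF⟩ hd' hj (by rwa [← hq]),
    E.neck l b p hp p' hp' h i j a hi hj ha, hq]

/-- Every point in a neck is identified with a point in the opposite disk. -/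
theorem Smoothing.exists_partner (S : Smoothing D Y) {l : Fin k} {b : Bool} {p : X}
    (hp : p ∈ D.truncated S.ε) (hb : p ∈ (D.z (Sum.inr (l, b))).source) :
    ∃ p' ∈ D.truncated S.ε, D.Plumbed S.ε l b p p' ∧
      ‖D.z (Sum.inr (l, b)) p‖ * ‖D.z (Sum.inr (l, !b)) p'‖ = ‖S.ε l‖ := by
  have h1 : ‖S.ε l‖ < ‖D.z (Sum.inr (l, b)) p‖ := hp l b hb
  have h0 : 0 < ‖D.z (Sum.inr (l, b)) p‖ := (norm_nonneg _).trans_lt h1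
  have hz : D.z (Sum.inr (l, b)) p ≠ 0 := norm_pos_iff.1 h0
  have h2 := D.norm_lt_one hb
  have hε : 0 < ‖S.ε l‖ := norm_pos_iff.2 (S.ε_ne_zero l)
  set w := S.ε l / D.z (Sum.inr (l, b)) p with hw
  have hnw : ‖w‖ = ‖S.ε l‖ / ‖D.z (Sum.inr (l, b)) p‖ := norm_div _ _
  have hw1 : ‖w‖ < 1 := by rwa [hnw, div_lt_one h0]
  have hwt := D.mem_target (s := Sum.inr (l, !b)) hw1
  have hzp : D.z (Sum.inr (l, !b)) ((D.z (Sum.inr (l, !b))).symm w) = w :=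
    (D.z (Sum.inr (l, !b))).right_inv hwt
  refine ⟨(D.z (Sum.inr (l, !b))).symm w, ?_, ⟨hb, (D.z _).map_target hwt, ?_⟩, ?_⟩
  · rw [D.truncated_eq_outside]
    refine D.mem_outside_of_mem ((D.z _).map_target hwt) ?_
    rw [hzp, hnw, lt_div_iff₀ h0]
    nlinarith
  · rw [hzp, hw, mul_div_cancel₀ _ hz]
  · rw [hzp, hnw, mul_div_cancel₀ _ h0.ne']

/-- Round annuli in the necks, matching under the identification, that contain no singular point
of the section. -/
structure NeckRadii (S : Smoothing D Y) (F : Finset Y) where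
  inner : Fin k × Bool → ℝ
  outer : Fin k × Bool → ℝ
  norm_lt : ∀ j, ‖S.ε j.1‖ < inner j
  lt : ∀ j, inner j < outer j
  lt_one : ∀ j, outer j < 1
  mul_eq : ∀ l b, outer (l, b) * inner (l, !b) = ‖S.ε l‖
  free : ∀ j p, p ∈ (D.z (Sum.inr j)).source → inner j ≤ ‖D.z (Sum.inr j) p‖ →
    ‖D.z (Sum.inr j) p‖ ≤ outer j → S.q p ∉ F

theorem exists_Icc_disjoint_finite {a b : ℝ} (hab : a < b) {B : Set ℝ} (hB : B.Finite) :
    ∃ c d, a < c ∧ c < d ∧ d < b ∧ ∀ t ∈ Icc c d, t ∉ B := by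
  have hinf : (Ioo a b \ B).Nonempty := ((Ioo_infinite hab).sdiff hB).nonempty
  obtain ⟨t, ht⟩ := hinf
  obtain ⟨δ, hδ, hball⟩ := Metric.nhds_basis_closedBall.mem_iff.1
    ((isOpen_Ioo.sdiff hB.isClosed).mem_nhds ht)
  rw [Real.closedBall_eq_Icc] at hball
  have h1 := hball (left_mem_Icc.2 (by linarith))
  have h2 := hball (right_mem_Icc.2 (by linarith))
  exact ⟨t - δ, t + δ, h1.1.1, by linarith, h2.1.2, fun x hx => (hball hx).2⟩

/-- Plumbed points lie in opposite disks, so `q` is injective on the truncation of a single one. -/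
theorem finite_singular_disk (S : Smoothing D Y) (F : Finset Y) (l : Fin k) :
    {p | p ∈ D.truncated S.ε ∧ p ∈ (D.z (Sum.inr (l, false))).source ∧ S.q p ∈ F}.Finite := by
  refine Finite.of_finite_image (f := S.q) (F.finite_toSet.subset ?_) ?_
  · rintro _ ⟨p, hp, rfl⟩
    exact hp.2.2
  · intro p hp p' hp' h
    rcases (S.map_eq_iff p hp.1 p' hp'.1).1 h with h | ⟨l', b', h1, h2, -⟩
    · exact h
    · have e1 := D.eq_of_mem h1 hp.2.1
      have e2 := D.eq_of_mem h2 hp'.2.1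
      simp only [Sum.inr.injEq, Prod.mk.injEq] at e1 e2
      rw [e1.2] at e2
      simp at e2

/-- On the side `false` an interval `[c, d]` is chosen that misses the finitely many radii of
singular points. Plumbing sends the radius `r` to `‖ε‖ / r`, which forces `[‖ε‖ / d, ‖ε‖ / c]` on
the side `true`; this annulus is free of singular points because its points are plumbed to those of
the first. -/
theorem exists_neckRadii (S : Smoothing D Y) (F : Finset Y) : Nonempty (NeckRadii S F) := by
  have h : ∀ l : Fin k, ∃ c d, ‖S.ε l‖ < c ∧ c < d ∧ d < 1 ∧ ∀ t ∈ Icc c d,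
      t ∉ (fun p => ‖D.z (Sum.inr (l, false)) p‖) ''
        {p | p ∈ D.truncated S.ε ∧ p ∈ (D.z (Sum.inr (l, false))).source ∧ S.q p ∈ F} :=
    fun l => exists_Icc_disjoint_finite (S.norm_ε_lt_one l) ((finite_singular_disk S F l).image _)
  choose c d hc hcd hd hfree using h
  have hε : ∀ l, 0 < ‖S.ε l‖ := fun l => norm_pos_iff.2 (S.ε_ne_zero l)
  have hc0 : ∀ l, 0 < c l := fun l => (hε l).trans (hc l)
  have hd0 : ∀ l, 0 < d l := fun l => (hc0 l).trans (hcd l)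
  have hnl : ∀ j : Fin k × Bool, ‖S.ε j.1‖ < if j.2 then ‖S.ε j.1‖ / d j.1 else c j.1 := by
    rintro ⟨l, b⟩
    cases b
    · exact hc l
    · simp only [if_true]
      rw [lt_div_iff₀ (hd0 l)]
      nlinarith [hε l, hd l]
  have hfree0 : ∀ (l : Fin k) p, p ∈ (D.z (Sum.inr (l, false))).source →
      c l ≤ ‖D.z (Sum.inr (l, false)) p‖ → ‖D.z (Sum.inr (l, false)) p‖ ≤ d l → S.q p ∉ F := by
    intro l p hp h1 h2 hF
    refine hfree l _ ⟨h1, h2⟩ ⟨p, ⟨?_, hp, hF⟩, rfl⟩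
    rw [D.truncated_eq_outside]
    exact D.mem_outside_of_mem hp ((hc l).trans_le h1)
  refine ⟨⟨fun j => if j.2 then ‖S.ε j.1‖ / d j.1 else c j.1,
    fun j => if j.2 then ‖S.ε j.1‖ / c j.1 else d j.1, hnl, ?_, ?_, ?_, ?_⟩⟩
  · rintro ⟨l, b⟩
    cases b
    · exact hcd l
    · simp only [if_true]
      exact div_lt_div_of_pos_left (hε l) (hc0 l) (hcd l)
  · rintro ⟨l, b⟩
    cases b
    · exact hd l
    · simp only [if_true]
      rw [div_lt_one (hc0 l)]
      exact hc l
  · intro l b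
    cases b
    · simp [mul_div_cancel₀ _ (hd0 l).ne']
    · simp [div_mul_cancel₀ _ (hc0 l).ne']
  · rintro ⟨l, b⟩ p hp h1 h2
    cases b
    · exact hfree0 l p hp h1 h2
    · simp only [if_true] at h1 h2
      have htr : p ∈ D.truncated S.ε := by
        rw [D.truncated_eq_outside]
        refine D.mem_outside_of_mem hp (lt_of_lt_of_le ?_ h1)
        simpa using hnl (l, true)
      obtain ⟨p', hp', hpl, hmul⟩ := S.exists_partner htr hp
      have h0 : 0 < ‖D.z (Sum.inr (l, true)) p‖ := lt_of_lt_of_le (div_pos (hε l) (hd0 l)) h1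
      rw [S.map_plumbed htr hp' hpl]
      simp only [Bool.not_true] at hmul hpl
      rw [div_le_iff₀ (hd0 l)] at h1
      rw [le_div_iff₀ (hc0 l)] at h2
      refine hfree0 l p' hpl.2.1 ?_ ?_
      · by_contra h3
        nlinarith
      · by_contra h3
        nlinarith

end Gluing

/-! ### A radial cut-off function -/

section Cutoff

/-- A smooth function of a real variable which is `0` near `(-∞, a]` and `1` near `[b, ∞)`. -/
def cutoff (a b t : ℝ) : ℝ := Real.smoothTransition (3 * (t - a) / (b - a) - 1)

theorem contDiff_cutoff (a b : ℝ) : ContDiff ℝ ∞ (cutoff a b) := by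
  unfold cutoff
  exact Real.smoothTransition.contDiff.comp (by fun_prop)

/-- The factor `3` in `cutoff` leaves a margin of a third of the interval at either end, so the
cut-off is locally constant around both boundary circles. -/
theorem cutoff_eq_zero {a b t : ℝ} (hab : a < b) (ht : t < a + (b - a) / 3) : cutoff a b t = 0 := by
  refine Real.smoothTransition.zero_of_nonpos ?_
  rw [sub_nonpos, div_le_one (by linarith)]
  linarith

theorem cutoff_eq_one {a b t : ℝ} (hab : a < b) (ht : b - (b - a) / 3 < t) : cutoff a b t = 1 := by
  refine Real.smoothTransition.one_of_one_le ?_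
  rw [le_sub_iff_add_le, le_div_iff₀ (by linarith)]
  linarith

end Cutoff

/-! ### Cutting off a logarithmic form in an annulus -/

section Ring

set_option linter.unusedSectionVars false

variable {X : Type*} [TopologicalSpace X] [ChartedSpace ℂ X] [IsManifold 𝓘(ℂ) ω X]
  {z : OpenPartialHomeomorph X ℂ} {a b : ℝ} {g : X → Circle}

/-- The closed annulus `a ≤ |z| ≤ b` in a coordinate disk. -/
def ring (z : OpenPartialHomeomorph X ℂ) (a b : ℝ) : Set X :=
  {p | p ∈ z.source ∧ a ≤ ‖z p‖ ∧ ‖z p‖ ≤ b}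

/-- The form `g⁻¹ dg`, cut off inside the annulus `a ≤ |z| ≤ b`. -/
def ringForm (z : OpenPartialHomeomorph X ℂ) (a b : ℝ) (g : X → Circle) : OneForm X :=
  smulForm (fun p => cutoff a b ‖z p‖) (dlog g)

open Classical in
/-- The part over the annulus `a ≤ |z| ≤ b` of the exterior derivative of the cut off form. -/
def ringTwo (z : OpenPartialHomeomorph X ℂ) (a b : ℝ) (g : X → Circle)
    (e : OpenPartialHomeomorph X ℂ) (w : ℂ) : ℂ :=
  if e.symm w ∈ ring z a b then dCoeff (inChart (ringForm z a b g) e) w else 0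

theorem continuousAt_norm_chart {p : X} (hp : p ∈ z.source) : ContinuousAt (fun x => ‖z x‖) p :=
  (z.continuousAt hp).norm

theorem ringForm_eventually_zero (hab : a < b) {p : X} (hp : p ∈ z.source) (h : ‖z p‖ ≤ a) :
    ∀ᶠ x in 𝓝 p, ringForm z a b g x = (0 : OneForm X) x := by
  have h1 : ‖z p‖ < a + (b - a) / 3 := by linarith
  filter_upwards [(continuousAt_norm_chart hp).eventually_lt continuousAt_const h1] with x hx
  unfold ringForm smulForm
  beta_reduce
  rw [cutoff_eq_zero hab hx]
  exact zero_smul ℝ (dlog g x)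

theorem ringForm_eq_dlog (hab : a < b) {p : X} (h : b ≤ ‖z p‖) : ringForm z a b g p = dlog g p := by
  unfold ringForm smulForm
  beta_reduce
  rw [cutoff_eq_one hab (by linarith)]
  exact one_smul ℝ (dlog g p)

theorem ringForm_eventually_dlog (hab : a < b) {p : X} (hp : p ∈ z.source) (h : b ≤ ‖z p‖) :
    ∀ᶠ x in 𝓝 p, ringForm z a b g x = dlog g x := by
  have h1 : b - (b - a) / 3 < ‖z p‖ := by linarith
  filter_upwards [continuousAt_const.eventually_lt (continuousAt_norm_chart hp) h1] with x hx
  unfold ringForm smulForm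
  beta_reduce
  rw [cutoff_eq_one hab hx]
  exact one_smul ℝ (dlog g x)

theorem formSmoothAt_ringForm (hz : z ∈ holAtlas X) (ha : 0 < a) (hab : a < b) {p : X}
    (hp : p ∈ z.source) (hg : a ≤ ‖z p‖ → ∀ᶠ x in 𝓝 p, SmoothCircleAt g x) :
    FormSmoothAt (ringForm z a b g) p := by
  rcases le_total ‖z p‖ a with h | h
  · exact formSmoothAt_zero.congr (ringForm_eventually_zero hab hp h)
  · refine (formSmoothAt_dlog (hg h)).smulForm ?_
    have h0 : z p ≠ 0 := norm_pos_iff.1 (ha.trans_le h)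
    have h1 : ContDiffAt ℝ ∞ (fun w : ℂ => cutoff a b ‖w‖) (z p) :=
      (contDiff_cutoff a b).contDiffAt.comp (z p) (contDiffAt_norm ℝ h0)
    exact ContMDiffAt.comp (g := fun w : ℂ => cutoff a b ‖w‖) p h1.contMDiffAt
      (contMDiffAt_of_mem_maximalAtlas (holAtlas_subset_real hz) hp)

theorem dCoeff_ringForm_eq_zero (hab : a < b) {e : OpenPartialHomeomorph X ℂ} {w : ℂ}
    (he : e ∈ holAtlas X) (hw : w ∈ e.target) (hp : e.symm w ∈ z.source)
    (h : ‖z (e.symm w)‖ ≤ a ∨ b ≤ ‖z (e.symm w)‖ ∧ ∀ᶠ x in 𝓝 (e.symm w), SmoothCircleAt g x) :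
    dCoeff (inChart (ringForm z a b g) e) w = 0 := by
  rcases h with h | ⟨h, hg⟩
  · rw [dCoeff_inChart_congr hw (ringForm_eventually_zero hab hp h), dCoeff_zero_form]
  · rw [dCoeff_inChart_congr hw (ringForm_eventually_dlog hab hp h), dCoeff_inChart_dlog he hw hg]

/-- Off the annulus the cut-off form is zero or `dlog g`, closed in both cases, so restricting its
derivative to the annulus loses nothing. Smoothness of `g` is not needed inside the inner circle. -/
theorem ringTwo_eq_dCoeff (hab : a < b) {e : OpenPartialHomeomorph X ℂ} {w : ℂ}
    (he : e ∈ holAtlas X) (hw : w ∈ e.target) (hp : e.symm w ∈ z.source)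
    (hg : a ≤ ‖z (e.symm w)‖ → ∀ᶠ x in 𝓝 (e.symm w), SmoothCircleAt g x) :
    ringTwo z a b g e w = dCoeff (inChart (ringForm z a b g) e) w := by
  unfold ringTwo
  split_ifs with h
  · rfl
  · symm
    refine dCoeff_ringForm_eq_zero hab he hw hp ?_
    by_cases h1 : ‖z (e.symm w)‖ ≤ a
    · exact Or.inl h1
    · push Not at h1
      refine Or.inr ⟨?_, hg h1.le⟩
      by_contra h2
      exact h ⟨hp, h1.le, (not_le.1 h2).le⟩

theorem ringTwo_of_notMem {e : OpenPartialHomeomorph X ℂ} {w : ℂ} (h : e.symm w ∉ ring z a b) :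
    ringTwo z a b g e w = 0 := if_neg h

theorem isTwoForm_ringTwo
    (hg : ∀ p ∈ ring z a b, ∀ᶠ x in 𝓝 p, SmoothCircleAt g x)
    (hz : z ∈ holAtlas X) (ha : 0 < a) (hab : a < b) :
    IsTwoForm X (ringTwo z a b g) := by
  intro e he e' he' w hw hw'
  have h1 : e'.symm (e' (e.symm w)) = e.symm w := e'.left_inv hw'
  unfold ringTwo
  rw [h1]
  split_ifs with h
  · exact (formSmoothAt_ringForm hz ha hab h.1 fun _ => hg _ h).dCoeff_transition he he' hw hw'
  · rw [mul_zero]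

variable [T2Space X] [CompactSpace X]

theorem integrableForm_ringTwo
    (hg : ∀ p ∈ ring z a b, ∀ᶠ x in 𝓝 p, SmoothCircleAt g x)
    (hz : z ∈ holAtlas X) (ha : 0 < a) (hab : a < b)
    (hclosed : IsClosed (ring z a b)) : IntegrableForm X (ringTwo z a b g) := by
  refine integrableForm_of_continuousOn fun x w hw => ContinuousAt.continuousWithinAt ?_
  have he := chart_mem_holAtlas x
  by_cases h : (chartAt ℂ x).symm w ∈ ring z a b
  · have h1 := dCoeff_continuousAt
      ((formSmoothAt_ringForm hz ha hab h.1 fun _ => hg _ h).contDiffAt_symm he hw)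
    refine h1.congr ?_
    filter_upwards [(chartAt ℂ x).open_target.eventually_mem hw, eventually_comp_symm hw
      (z.open_source.eventually_mem h.1), eventually_comp_symm hw (hg _ h).eventually_nhds]
      with v h2 h3 h4
    exact (ringTwo_eq_dCoeff hab he h2 h3 fun _ => h4).symm
  · refine (continuousAt_const (y := (0 : ℂ))).congr ?_
    filter_upwards [eventually_comp_symm hw (hclosed.isOpen_compl.eventually_mem h)] with v hv
    exact (ringTwo_of_notMem hv).symm

/-- Green's formula on the annulus: the cut-off form vanishes on the inner circle and equals `dlog
g` on the outer one. -/
theorem surfaceIntegral_ringTwo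
    (hg : ∀ p ∈ ring z a b, ∀ᶠ x in 𝓝 p, SmoothCircleAt g x)
    (hz : z ∈ holAtlas X) (ha : 0 < a) (hab : a < b)
    (hclosed : IsClosed (ring z a b)) (hball : Metric.closedBall 0 b ⊆ z.target) :
    surfaceIntegral (X := X) (ringTwo z a b g) = circ (inChart (dlog g) z) 0 b := by
  have hmem : ∀ w : ℂ, a ≤ ‖w‖ → ‖w‖ ≤ b → w ∈ z.target ∧ z.symm w ∈ ring z a b := by
    intro w h1 h2
    have h3 : w ∈ z.target := hball (by simpa using h2)
    refine ⟨h3, z.map_target h3, ?_⟩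
    rw [z.right_inv h3]
    exact ⟨h1, h2⟩
  rw [((isTwoForm_ringTwo hg hz ha hab).surfaceIntegral_eq
    (integrableForm_ringTwo hg hz ha hab hclosed) hz
    fun e' _ w _ h => ringTwo_of_notMem fun h' => h h'.1).2]
  have hsub : {w : ℂ | a < ‖w - 0‖ ∧ ‖w - 0‖ ≤ b} ⊆ z.target := by
    rintro w ⟨h1, h2⟩
    rw [sub_zero] at h1 h2
    exact (hmem w h1.le h2).1
  rw [setIntegral_eq_of_subset_of_forall_sdiff_eq_zero z.open_target.measurableSet hsub]
  · have h1 : ∫ w in {w : ℂ | a < ‖w - 0‖ ∧ ‖w - 0‖ ≤ b}, ringTwo z a b g z w =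
        ∫ w in {w : ℂ | a < ‖w - 0‖ ∧ ‖w - 0‖ ≤ b}, dCoeff (inChart (ringForm z a b g) z) w := by
      refine setIntegral_congr_fun ?_ ?_
      · have hm : Measurable fun w : ℂ => ‖w - 0‖ := by fun_prop
        exact (measurableSet_lt measurable_const hm).inter (measurableSet_le hm measurable_const)
      · rintro w ⟨h1, h2⟩
        rw [sub_zero] at h1 h2
        exact if_pos (hmem w h1.le h2).2
    rw [h1, green_annulus hab.le ha]
    · have h2 : circ (inChart (ringForm z a b g) z) 0 a = 0 := by
        unfold circ
        refine (intervalIntegral.integral_congr fun θ _ => ?_).trans intervalIntegral.integral_zero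
        have h3 : ‖circleMap 0 a θ‖ = a := by simpa using norm_circleMap_sub (c := 0) ha θ
        obtain ⟨h4, h5⟩ := hmem (circleMap 0 a θ) h3.ge (h3.le.trans hab.le)
        rw [inChart_congr (b := 0) (ringForm_eventually_zero hab h5.1
          (by rw [z.right_inv h4, h3])).self_of_nhds, inChart_zero]
        rfl
      have h3 : circ (inChart (ringForm z a b g) z) 0 b = circ (inChart (dlog g) z) 0 b := by
        unfold circ
        congr 1
        ext θ
        have h3 : ‖circleMap 0 b θ‖ = b := by
          simpa using norm_circleMap_sub (c := 0) (ha.trans hab) θ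
        obtain ⟨h4, h5⟩ := hmem (circleMap 0 b θ) (h3.ge.trans' hab.le) h3.le
        rw [inChart_congr (ringForm_eq_dlog hab (by rw [z.right_inv h4, h3]))]
      rw [h2, h3, sub_zero]
    · intro w h1 h2
      rw [sub_zero] at h1 h2
      obtain ⟨h3, h4⟩ := hmem w h1 h2
      exact (formSmoothAt_ringForm hz ha hab h4.1 fun _ => hg _ h4).contDiffAt_symm hz h3
  · rintro w ⟨h1, h2⟩
    by_cases h3 : z.symm w ∈ ring z a b
    · unfold ringTwo
      rw [if_pos h3]
      refine dCoeff_ringForm_eq_zero hab hz h1 h3.1 (Or.inl ?_)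
      have h4 := h3.2
      rw [z.right_inv h1] at h4 ⊢
      by_contra h5
      exact h2 ⟨by rw [sub_zero]; exact not_le.1 h5, by rw [sub_zero]; exact h4.2⟩
    · exact ringTwo_of_notMem h3

end Ring

/-! ### Cancellation of the windings on the two sides of a neck -/

section Neck

set_option linter.unusedSectionVars false

theorem HasWinding.reflect {γ : ℝ → Circle} {N : ℤ} (h : HasWinding γ N) (c : ℝ) :
    HasWinding (fun θ => γ (c - θ)) (-N) := by
  obtain ⟨φ, h1, h2, h3⟩ := h
  refine ⟨fun θ => φ (c - θ), by fun_prop, fun θ => h2 _, fun θ => ?_⟩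
  have := h3 (c - (θ + 2 * Real.pi))
  rw [show c - (θ + 2 * Real.pi) + 2 * Real.pi = c - θ by ring] at this
  push_cast
  linarith

variable {X : Type*} [TopologicalSpace X] [ChartedSpace ℂ X] {n k : ℕ}
  {C : MarkedNodalCurve X n k} {D : CoordDisks C} {ι : Type*} {P : CircleBundle ι X C.regular}
  {T : Framing D P} {Y : Type*} [TopologicalSpace Y] [ChartedSpace ℂ Y]
  {S : Smoothing D Y} {κ : Type*} {Q : CircleBundle κ Y univ} (E : Extension T S Q)
  {F : Finset Y} {s : κ → Y → Circle}
  [IsManifold 𝓘(ℂ) ω X] [IsManifold 𝓘(ℂ) ω Y] [T2Space X] [T2Space Y]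

theorem NeckRadii.inner_pos (R : NeckRadii S F) (j : Fin k × Bool) : 0 < R.inner j :=
  (norm_nonneg _).trans_lt (R.norm_lt j)

theorem NeckRadii.mem_truncated (R : NeckRadii S F) {j : Fin k × Bool} {p : X}
    (hp : p ∈ (D.z (Sum.inr j)).source) (h : R.inner j ≤ ‖D.z (Sum.inr j) p‖) :
    p ∈ D.truncated S.ε := by
  rw [D.truncated_eq_outside]
  exact D.mem_outside_of_mem hp ((R.norm_lt j).trans_le h)

theorem NeckRadii.ring_subset (R : NeckRadii S F) {j : Fin k × Bool} {p : X}
    (hp : p ∈ ring (D.z (Sum.inr j)) (R.inner j) (R.outer j)) :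
    p ∈ pullDomain S F ∧ p ∈ puncturedDisk D (Sum.inr j) := by
  have h1 := R.mem_truncated hp.1 hp.2.1
  have h2 := truncated_mem_puncturedDisk S h1 hp.1
  exact ⟨⟨⟨h1, puncturedDisk_subset _ h2⟩, R.free j p hp.1 hp.2.1 hp.2.2⟩, h2⟩

theorem NeckRadii.eventually_smoothAt_coord (R : NeckRadii S F) (hs : Q.IsSection (F : Set Y)ᶜ s)
    {j : Fin k × Bool} {p : X} (hp : p ∈ ring (D.z (Sum.inr j)) (R.inner j) (R.outer j)) :
    ∀ᶠ x in 𝓝 p, SmoothCircleAt (E.coord s (Sum.inr j)) x :=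
  E.eventually_smoothAt_coord hs (R.ring_subset hp).1 (R.ring_subset hp).2

theorem NeckRadii.symm_mem_ring (R : NeckRadii S F) {j : Fin k × Bool} {w : ℂ}
    (h1 : R.inner j ≤ ‖w‖) (h2 : ‖w‖ ≤ R.outer j) : w ∈ (D.z (Sum.inr j)).target ∧
      (D.z (Sum.inr j)).symm w ∈ ring (D.z (Sum.inr j)) (R.inner j) (R.outer j) := by
  have h3 : w ∈ (D.z (Sum.inr j)).target := D.mem_target (h2.trans_lt (R.lt_one j))
  refine ⟨h3, (D.z _).map_target h3, ?_⟩
  rw [(D.z _).right_inv h3]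
  exact ⟨h1, h2⟩

theorem NeckRadii.isClosed_ring (R : NeckRadii S F) (j : Fin k × Bool) :
    IsClosed (ring (D.z (Sum.inr j)) (R.inner j) (R.outer j)) := by
  have h1 := D.isClosed_disk (Sum.inr j) (R.lt_one j)
  have h2 : IsCompact ((D.z (Sum.inr j)).symm '' {w | R.inner j ≤ ‖w‖ ∧ ‖w‖ ≤ R.outer j}) := by
    refine IsCompact.image_of_continuousOn ?_ ((D.z _).continuousOn_symm.mono fun w hw =>
      (R.symm_mem_ring hw.1 hw.2).1)
    refine (isCompact_closedBall (0 : ℂ) (R.outer j)).of_isClosed_subset ?_ fun w hw => ?_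
    · exact (isClosed_le continuous_const continuous_norm).inter
        (isClosed_le continuous_norm continuous_const)
    · simpa using hw.2
  convert h2.isClosed using 1
  ext p
  constructor
  · rintro ⟨h3, h4⟩
    exact ⟨D.z _ p, h4, (D.z _).left_inv h3⟩
  · rintro ⟨w, hw, rfl⟩
    exact (R.symm_mem_ring hw.1 hw.2).2

/-- The circulation of `dlog` of the coordinate of the section around a neck. -/
def Extension.neckCirc (s : κ → Y → Circle) (j : Fin k × Bool) (r : ℝ) : ℂ :=
  circ (inChart (dlog (E.coord s (Sum.inr j))) (D.z (Sum.inr j))) 0 r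

/-- The form `dlog` is closed and the annulus is free of singular points. This is needed because
plumbing matches the outer circle of one side with the inner circle of the other. -/
theorem Extension.neckCirc_inner_eq_outer (R : NeckRadii S F) (hs : Q.IsSection (F : Set Y)ᶜ s)
    (j : Fin k × Bool) : E.neckCirc s j (R.outer j) = E.neckCirc s j (R.inner j) := by
  refine circ_eq_of_dCoeff_eq_zero (R.lt j).le (R.inner_pos j) (fun w h1 h2 => ?_) fun w h1 h2 => ?_
  all_goals
    rw [sub_zero] at h1 h2
    obtain ⟨h3, h4⟩ := R.symm_mem_ring h1 h2
  · exact (formSmoothAt_dlog (R.eventually_smoothAt_coord E hs h4)).contDiffAt_symm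
      (D.holomorphic _) h3
  · exact dCoeff_inChart_dlog (D.holomorphic _) h3 (R.eventually_smoothAt_coord E hs h4)

theorem Extension.neckCirc_of_hasWinding (R : NeckRadii S F) (hs : Q.IsSection (F : Set Y)ᶜ s)
    {j : Fin k × Bool} {r : ℝ} (h1 : R.inner j ≤ r) (h2 : r ≤ R.outer j) {N : ℤ}
    (hN : HasWinding (fun θ => E.coord s (Sum.inr j) ((D.z (Sum.inr j)).symm (circleMap 0 r θ))) N) :
    E.neckCirc s j r = 2 * Real.pi * Complex.I * N := by
  have hnorm : ∀ θ, ‖circleMap 0 r θ‖ = r := fun θ => by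
    simpa using norm_circleMap_sub (c := 0) ((R.inner_pos j).trans_le h1) θ
  have hmem : ∀ θ, _ := fun θ => R.symm_mem_ring (w := circleMap 0 r θ) (j := j)
    (by rwa [hnorm]) (by rwa [hnorm])
  have hsm : ∀ θ, _ := fun θ => (R.eventually_smoothAt_coord E hs (hmem θ).2).self_of_nhds
  rw [← circ_dlogC_of_hasWinding
    (fun θ => (hsm θ).comp_symm (D.holomorphic _) (hmem θ).1) hN]
  unfold Extension.neckCirc circ
  congr 1
  ext θ
  rw [inChart_dlog (D.holomorphic _) (hmem θ).1 (hsm θ)]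

theorem Extension.exists_neck_winding (R : NeckRadii S F) (hs : Q.IsSection (F : Set Y)ᶜ s)
    {j : Fin k × Bool} {r : ℝ} (h1 : R.inner j ≤ r) (h2 : r ≤ R.outer j) : ∃ N,
    HasWinding (fun θ => E.coord s (Sum.inr j) ((D.z (Sum.inr j)).symm (circleMap 0 r θ))) N := by
  have hnorm : ∀ θ, ‖circleMap 0 r θ‖ = r := fun θ => by
    simpa using norm_circleMap_sub (c := 0) ((R.inner_pos j).trans_le h1) θ
  have hmem : ∀ θ, _ := fun θ => R.symm_mem_ring (w := circleMap 0 r θ) (j := j)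
    (by rwa [hnorm]) (by rwa [hnorm])
  refine exists_hasWinding (contDiff_comp_circleMap
    (h := fun w => E.coord s (Sum.inr j) ((D.z (Sum.inr j)).symm w)) fun θ => ?_) fun θ => ?_
  · exact (R.eventually_smoothAt_coord E hs (hmem θ).2).self_of_nhds.comp_symm
      (D.holomorphic _) (hmem θ).1
  · simp only [periodic_circleMap 0 r θ]

/-- The contributions of the two sides of a neck cancel. -/
theorem Extension.neckCirc_add (R : NeckRadii S F) (hs : Q.IsSection (F : Set Y)ᶜ s) (l : Fin k) :
    E.neckCirc s (l, false) (R.outer (l, false)) + E.neckCirc s (l, true) (R.outer (l, true)) =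
      0 := by
  obtain ⟨N, hN⟩ := E.exists_neck_winding R hs (j := (l, false)) le_rfl (R.lt _).le
  rw [E.neckCirc_inner_eq_outer R hs (l, false),
    E.neckCirc_of_hasWinding R hs le_rfl (R.lt _).le hN]
  have hin := R.inner_pos (l, false)
  have hout := (R.inner_pos (l, true)).trans (R.lt (l, true))
  have hprod := R.mul_eq l true
  rw [Bool.not_true] at hprod
  -- The point of angle `θ` on the outer circle of the side `true` is plumbed to the point of angle
  -- `arg ε - θ` on the inner circle of the side `false`, and the section has the same coordinate at
  -- both. The reversal of the angle changes the sign of the winding number.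
  have hγ : (fun θ => E.coord s (Sum.inr (l, true))
      ((D.z (Sum.inr (l, true))).symm (circleMap 0 (R.outer (l, true)) θ))) = fun θ =>
      E.coord s (Sum.inr (l, false)) ((D.z (Sum.inr (l, false))).symm
        (circleMap 0 (R.inner (l, false)) ((S.ε l).arg - θ))) := by
    funext θ
    have n1 : ‖circleMap 0 (R.outer (l, true)) θ‖ = R.outer (l, true) := by
      simpa using norm_circleMap_sub (c := 0) hout θ
    have n2 : ‖circleMap 0 (R.inner (l, false)) ((S.ε l).arg - θ)‖ = R.inner (l, false) := by
      simpa using norm_circleMap_sub (c := 0) hin ((S.ε l).arg - θ)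
    obtain ⟨t1, m1⟩ := R.symm_mem_ring (w := circleMap 0 (R.outer (l, true)) θ) (j := (l, true))
      (n1.ge.trans' (R.lt _).le) n1.le
    obtain ⟨t2, m2⟩ := R.symm_mem_ring (w := circleMap 0 (R.inner (l, false)) ((S.ε l).arg - θ))
      (j := (l, false)) n2.ge (n2.le.trans (R.lt _).le)
    refine E.coord_plumbed hs (b := true) (R.ring_subset m1).1.1.1 (R.ring_subset m2).1.1.1
      ⟨m1.1, m2.1, ?_⟩ (R.ring_subset m1).1.2
    rw [Bool.not_true, (D.z _).right_inv t1, (D.z _).right_inv t2]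
    rw [circleMap_zero, circleMap_zero, mul_mul_mul_comm, ← Complex.ofReal_mul, hprod,
      ← Complex.exp_add]
    conv_rhs => rw [← Complex.norm_mul_exp_arg_mul_I (S.ε l)]
    congr 2
    push_cast
    ring
  rw [E.neckCirc_of_hasWinding R hs (R.lt _).le le_rfl (N := -N)]
  · push_cast
    ring
  · rw [hγ]
    exact hN.reflect _

end Neck

/-! ### The global one-form on the normalisation -/

section Global

set_option linter.unusedSectionVars false

variable {X : Type*} [TopologicalSpace X] [ChartedSpace ℂ X] {n k : ℕ}
  {C : MarkedNodalCurve X n k} {D : CoordDisks C} {ι : Type*} {P : CircleBundle ι X C.regular}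
  {T : Framing D P} {Y : Type*} [TopologicalSpace Y] [ChartedSpace ℂ Y]
  {S : Smoothing D Y} {κ : Type*} {Q : CircleBundle κ Y univ} (E : Extension T S Q)
  {F : Finset Y} {s : κ → Y → Circle}

/-- The contribution of a neck to the global form. -/
def Extension.twist (s : κ → Y → Circle) (R : NeckRadii S F) (j : Fin k × Bool) : OneForm X :=
  ringForm (D.z (Sum.inr j)) (R.inner j) (R.outer j) (E.coord s (Sum.inr j))

open Classical in
/-- A form interpolating between the connection form in the trivialisation pulled back from a
section of `Q`, away from the nodes, and those in the given trivialisations, near the nodes. -/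
def Extension.globalForm (A : Connection P) (s : κ → Y → Circle) (R : NeckRadii S F) : OneForm X :=
  fun p =>
    if h : ∃ j, p ∈ (D.z (Sum.inr j)).source then
      A.formIn (T.triv (Sum.inr (Classical.choose h))) p + E.twist s R (Classical.choose h) p
    else A.formIn (E.pullTriv s) p

theorem Extension.globalForm_of_mem (A : Connection P) (R : NeckRadii S F) {j : Fin k × Bool}
    {p : X} (hp : p ∈ (D.z (Sum.inr j)).source) :
    E.globalForm A s R p = (A.formIn (T.triv (Sum.inr j)) + E.twist s R j) p := by
  have h : ∃ j, p ∈ (D.z (Sum.inr j)).source := ⟨j, hp⟩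
  have h1 := D.eq_of_mem (Classical.choose_spec h) hp
  rw [Sum.inr.injEq] at h1
  unfold Extension.globalForm
  rw [dif_pos h, h1]
  rfl

variable [IsManifold 𝓘(ℂ) ω X] [IsManifold 𝓘(ℂ) ω Y] [T2Space X] [T2Space Y]

/-- Beyond the outer circle the cut-off is `1`, and adding the full `dlog` of the coordinate is the
gauge transformation from the given trivialisation to the pulled back one. So the two definitions
agree on their overlap. -/
theorem Extension.globalForm_outside (A : Connection P) (hs : Q.IsSection (F : Set Y)ᶜ s)
    (R : NeckRadii S F) {p : X} (hp : p ∈ D.outside R.outer) (hp' : p ∈ pullDomain S F) :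
    E.globalForm A s R p = A.formIn (E.pullTriv s) p := by
  by_cases h : ∃ j, p ∈ (D.z (Sum.inr j)).source
  · obtain ⟨j, hj⟩ := h
    rw [E.globalForm_of_mem A R hj, E.formIn_pullTriv A hs hp'
      (truncated_mem_puncturedDisk S hp'.1.1 hj), Pi.add_apply]
    unfold Extension.twist
    rw [ringForm_eq_dlog (R.lt j) (hp j hj).le]
  · unfold Extension.globalForm
    rw [dif_neg h]

theorem NeckRadii.isOpen_outside (R : NeckRadii S F) : IsOpen (D.outside R.outer) :=
  D.isOpen_outside R.lt_one

theorem NeckRadii.outside_subset (R : NeckRadii S F) : D.outside R.outer ⊆ D.truncated S.ε := by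
  intro p hp
  rw [D.truncated_eq_outside]
  exact fun j hj => ((R.norm_lt j).trans (R.lt j)).trans (hp j hj)

/-- The singular points of the global form away from the nodes. -/
def NeckRadii.singularSet (R : NeckRadii S F) : Set X := {p | p ∈ D.outside R.outer ∧ S.q p ∈ F}

/-- If two plumbed points both lay outside the outer circles, the product of their radii would
exceed outer times inner, which is `‖ε‖`. -/
theorem NeckRadii.injOn_singularSet (R : NeckRadii S F) : InjOn S.q R.singularSet := by
  intro p hp p' hp' h
  rcases (S.map_eq_iff p (R.outside_subset hp.1) p' (R.outside_subset hp'.1)).1 h with h | ⟨l, b, h⟩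
  · exact h
  · exfalso
    have h1 := hp.1 (l, b) h.1
    have h2 := hp'.1 (l, !b) h.2.1
    have h3 := congrArg norm h.2.2
    rw [norm_mul, ← R.mul_eq l b] at h3
    have h4 := R.lt (l, !b)
    have h5 := R.inner_pos (l, b)
    have h6 := R.lt (l, b)
    have h7 := R.inner_pos (l, !b)
    nlinarith

/-- A preimage inside the outer circle lies inside the inner one, as the annulus is free. Its
plumbing partner then lies beyond the outer circle of the other side. -/
theorem NeckRadii.surjOn_singularSet (R : NeckRadii S F) : SurjOn S.q R.singularSet F := by
  intro y hy
  obtain ⟨p, hp, rfl⟩ := S.surjOn (mem_univ y)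
  by_cases ho : p ∈ D.outside R.outer
  · exact ⟨p, ⟨ho, hy⟩, rfl⟩
  · simp only [CoordDisks.outside, mem_ofPred_eq, not_forall, not_lt] at ho
    obtain ⟨⟨l, b⟩, hj, hle⟩ := ho
    have hlt : ‖D.z (Sum.inr (l, b)) p‖ < R.inner (l, b) := by
      by_contra h
      exact R.free _ p hj (not_lt.1 h) hle hy
    obtain ⟨p', hp', hpl, hmul⟩ := S.exists_partner hp hj
    refine ⟨p', ⟨D.mem_outside_of_mem hpl.2.1 ?_, ?_⟩, (S.map_plumbed hp hp' hpl).symm⟩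
    · have h1 := R.mul_eq l (!b)
      rw [Bool.not_not] at h1
      rw [← h1] at hmul
      have h2 : 0 < ‖D.z (Sum.inr (l, b)) p‖ :=
        (norm_nonneg _).trans_lt (truncated_norm_pos S hp hj)
      have h3 := (R.inner_pos (l, !b)).trans (R.lt (l, !b))
      by_contra h4
      rw [not_lt] at h4
      nlinarith
    · rw [← S.map_plumbed hp hp' hpl]
      exact hy

theorem NeckRadii.finite_singularSet (R : NeckRadii S F) : R.singularSet.Finite :=
  Finite.of_finite_image (F.finite_toSet.subset (by rintro _ ⟨p, hp, rfl⟩; exact hp.2))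
    R.injOn_singularSet

open Classical in
/-- The singular points of the global form. -/
def NeckRadii.singular (R : NeckRadii S F) : Finset X :=
  Finset.univ.image C.branch ∪ R.finite_singularSet.toFinset

theorem NeckRadii.notMem_singular (R : NeckRadii S F) (hF : ∀ m, S.q (C.mark m) ∈ F) {p : X}
    (hp : p ∉ R.singular) : p ∈ C.regular ∧ (p ∈ D.outside R.outer → S.q p ∉ F) := by
  classical
  unfold NeckRadii.singular at hp
  simp only [Finset.mem_union, Finset.mem_image, Finset.mem_univ, true_and, Finite.mem_toFinset,
    not_or, not_exists] at hp
  refine ⟨?_, fun h1 h2 => hp.2 ⟨h1, h2⟩⟩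
  rintro ⟨m | j, rfl⟩
  · exact hp.2 ⟨D.mark_mem_outside _ (D.mem_source (Sum.inl m)), hF m⟩
  · exact hp.1 j rfl

/-- The two local descriptions of the global form cover the complement of its singular points. -/
theorem NeckRadii.cases (R : NeckRadii S F) (hF : ∀ m, S.q (C.mark m) ∈ F) {p : X}
    (hp : p ∉ R.singular) : (p ∈ D.outside R.outer ∧ p ∈ pullDomain S F) ∨
      ∃ j, p ∈ puncturedDisk D (Sum.inr j) ∧ ‖D.z (Sum.inr j) p‖ ≤ R.outer j := by
  obtain ⟨h1, h2⟩ := R.notMem_singular hF hp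
  by_cases ho : p ∈ D.outside R.outer
  · exact Or.inl ⟨ho, ⟨R.outside_subset ho, h1⟩, h2 ho⟩
  · simp only [CoordDisks.outside, mem_ofPred_eq, not_forall, not_lt] at ho
    obtain ⟨j, hj, hle⟩ := ho
    refine Or.inr ⟨j, ⟨hj, ?_⟩, hle⟩
    rintro rfl
    exact h1 ⟨_, rfl⟩

theorem Extension.globalForm_eventually_outside (A : Connection P)
    (hs : Q.IsSection (F : Set Y)ᶜ s) (R : NeckRadii S F) {p : X} (hp : p ∈ D.outside R.outer)
    (hp' : p ∈ pullDomain S F) :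
    ∀ᶠ x in 𝓝 p, E.globalForm A s R x = A.formIn (E.pullTriv s) x := by
  filter_upwards [R.isOpen_outside.mem_nhds hp, (isOpen_pullDomain S F).mem_nhds hp'] with x h1 h2
  exact E.globalForm_outside A hs R h1 h2

theorem Extension.globalForm_eventually_disk (A : Connection P) (R : NeckRadii S F)
    {j : Fin k × Bool} {p : X} (hp : p ∈ (D.z (Sum.inr j)).source) :
    ∀ᶠ x in 𝓝 p, E.globalForm A s R x = (A.formIn (T.triv (Sum.inr j)) + E.twist s R j) x := by
  filter_upwards [(D.z (Sum.inr j)).open_source.mem_nhds hp] with x h1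
  exact E.globalForm_of_mem A R h1

theorem Extension.formSmoothAt_twist (hs : Q.IsSection (F : Set Y)ᶜ s) (R : NeckRadii S F)
    {j : Fin k × Bool} {p : X} (hp : p ∈ (D.z (Sum.inr j)).source)
    (h : ‖D.z (Sum.inr j) p‖ ≤ R.outer j) : FormSmoothAt (E.twist s R j) p :=
  formSmoothAt_ringForm (D.holomorphic _) (R.inner_pos j) (R.lt j) hp fun h' =>
    R.eventually_smoothAt_coord E hs ⟨hp, h', h⟩

theorem Extension.formSmoothAt_globalForm (A : Connection P) (hs : Q.IsSection (F : Set Y)ᶜ s)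
    (R : NeckRadii S F) (hF : ∀ m, S.q (C.mark m) ∈ F) {p : X} (hp : p ∉ R.singular) :
    FormSmoothAt (E.globalForm A s R) p := by
  rcases R.cases hF hp with ⟨h1, h2⟩ | ⟨j, h1, h2⟩
  · exact (A.formIn_smoothAt (E.isTrivialisation_pullTriv hs) (isOpen_pullDomain S F) h2.1.2
      h2).congr (E.globalForm_eventually_outside A hs R h1 h2)
  · exact ((A.formIn_smoothAt (T.isTrivialisation _) (isOpen_puncturedDisk _)
      (puncturedDisk_subset _ h1) h1).add (E.formSmoothAt_twist hs R h1.1 h2)).congr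
        (E.globalForm_eventually_disk A R h1.1)

/-- The exterior derivative of the contribution of a neck. -/
def Extension.twistTwo (s : κ → Y → Circle) (R : NeckRadii S F) (j : Fin k × Bool) :
    OpenPartialHomeomorph X ℂ → ℂ → ℂ :=
  ringTwo (D.z (Sum.inr j)) (R.inner j) (R.outer j) (E.coord s (Sum.inr j))

theorem Extension.dCoeff_globalForm (A : Connection P) (hs : Q.IsSection (F : Set Y)ᶜ s)
    (R : NeckRadii S F) (hF : ∀ m, S.q (C.mark m) ∈ F) {e : OpenPartialHomeomorph X ℂ} {w : ℂ}
    (he : e ∈ holAtlas X) (hw : w ∈ e.target) (hp : e.symm w ∉ R.singular) :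
    dCoeff (inChart (E.globalForm A s R) e) w =
      A.curvature e w + ∑ j, E.twistTwo s R j e w := by
  rcases R.cases hF hp with ⟨h1, h2⟩ | ⟨j, h1, h2⟩
  · rw [dCoeff_inChart_congr hw (E.globalForm_eventually_outside A hs R h1 h2),
      A.dCoeff_formIn (E.isTrivialisation_pullTriv hs) (isOpen_pullDomain S F) he hw h2.1.2 h2,
      Finset.sum_eq_zero, add_zero]
    intro j _
    exact ringTwo_of_notMem fun h => (h1 j h.1).not_ge h.2.2
  · rw [dCoeff_inChart_congr hw (E.globalForm_eventually_disk A R h1.1), dCoeff_inChart_add he hw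
      (A.formIn_smoothAt (T.isTrivialisation _) (isOpen_puncturedDisk _)
        (puncturedDisk_subset _ h1) h1) (E.formSmoothAt_twist hs R h1.1 h2),
      A.dCoeff_formIn (T.isTrivialisation _) (isOpen_puncturedDisk _) he hw
        (puncturedDisk_subset _ h1) h1, Finset.sum_eq_single j]
    · congr 1
      exact (ringTwo_eq_dCoeff (R.lt j) he hw h1.1 fun h' =>
        R.eventually_smoothAt_coord E hs ⟨h1.1, h', h2⟩).symm
    · intro i _ hij
      refine ringTwo_of_notMem fun h => hij ?_
      exact Sum.inr.inj (D.eq_of_mem h.1 h1.1)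
    · intro h
      exact absurd (Finset.mem_univ j) h

variable [CompactSpace X]

/-- The cut-offs add to the curvature integral exactly the circulations around the necks, and these
cancel in pairs. -/
theorem Extension.integral_dForm_globalForm (A : Connection P) (hA : A.CurvatureExtends)
    (hs : Q.IsSection (F : Set Y)ᶜ s) (R : NeckRadii S F) (hF : ∀ m, S.q (C.mark m) ∈ F) :
    IntegrableForm X (dForm R.singular (E.globalForm A s R)) ∧
      surfaceIntegral (X := X) (dForm R.singular (E.globalForm A s R)) =
        surfaceIntegral (X := X) A.curvature := by
  have hi1 : IntegrableForm X A.curvature :=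
    A.integrableForm_curvature hA R.singular fun x hx => (R.notMem_singular hF hx).1
  have hi2 : ∀ j ∈ (Finset.univ : Finset (Fin k × Bool)), IntegrableForm X (E.twistTwo s R j) :=
    fun j _ => integrableForm_ringTwo (fun p hp => R.eventually_smoothAt_coord E hs hp)
      (D.holomorphic _) (R.inner_pos j) (R.lt j) (R.isClosed_ring j)
  have heq : ∀ e ∈ atlas ℂ X, ∀ w ∈ e.target, e.symm w ∉ R.singular →
      (A.curvature + ∑ j, E.twistTwo s R j) e w = dForm R.singular (E.globalForm A s R) e w := by
    intro e he w hw hp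
    rw [dForm_of_notMem hp, E.dCoeff_globalForm A hs R hF (IsManifold.subset_maximalAtlas he) hw hp]
    simp only [Pi.add_apply, Finset.sum_apply]
  refine ⟨(hi1.add (integrableForm_sum _ _ hi2)).congr_off_finite R.singular heq, ?_⟩
  rw [← surfaceIntegral_congr_off_finite R.singular heq,
    surfaceIntegral_add hi1 (integrableForm_sum _ _ hi2), surfaceIntegral_sum _ _ hi2]
  have h1 : ∀ j, surfaceIntegral (X := X) (E.twistTwo s R j) = E.neckCirc s j (R.outer j) := by
    intro j
    refine surfaceIntegral_ringTwo (fun p hp => R.eventually_smoothAt_coord E hs hp)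
      (D.holomorphic _) (R.inner_pos j) (R.lt j) (R.isClosed_ring j) fun w hw => ?_
    exact D.mem_target ((mem_closedBall_zero_iff.1 hw).trans_lt (R.lt_one j))
  simp only [h1]
  rw [Fintype.sum_prod_type, Finset.sum_eq_zero, add_zero]
  intro l _
  rw [Fintype.sum_bool, add_comm]
  exact E.neckCirc_add R hs l

end Global

/-! ### Linearity and locality of limits of circulations -/

section CircLimits

set_option linter.unusedSectionVars false

theorem intervalIntegrable_circ {β : ℂ → ℂ →L[ℝ] ℂ} {c : ℂ} {r : ℝ}
    (h : ∀ θ, ContinuousAt β (circleMap c r θ)) : IntervalIntegrable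
      (fun θ => β (circleMap c r θ) (deriv (circleMap c r) θ)) volume 0 (2 * Real.pi) := by
  refine Continuous.intervalIntegrable ?_ _ _
  have h1 : Continuous fun θ => β (circleMap c r θ) :=
    continuous_iff_continuousAt.2 fun θ =>
      ContinuousAt.comp (h θ) (continuous_circleMap c r).continuousAt
  refine h1.clm_apply ?_
  rw [show deriv (circleMap c r) = fun θ => circleMap 0 r θ * Complex.I from
    funext fun θ => deriv_circleMap c r θ]
  exact (continuous_circleMap 0 r).mul continuous_const

variable {X : Type*} [TopologicalSpace X] [ChartedSpace ℂ X] [T2Space X] [CompactSpace X]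
  [IsManifold 𝓘(ℂ) ω X] {a b : OneForm X} {p : X} {e : OpenPartialHomeomorph X ℂ}

theorem eventually_continuousAt_circle (he : e ∈ holAtlas X) (hp : p ∈ e.source)
    (ha : ∀ᶠ x in 𝓝[≠] p, FormSmoothAt a x) :
    ∀ᶠ r in 𝓝[>] (0 : ℝ), ∀ θ, ContinuousAt (inChart a e) (circleMap (e p) r θ) := by
  obtain ⟨R, hR, h⟩ := punctured_ball_of_eventually hp ha
  filter_upwards [Ioo_mem_nhdsGT hR] with r hr θ
  have h1 := norm_circleMap_sub (c := e p) hr.1 θ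
  obtain ⟨h2, h3⟩ := h (circleMap (e p) r θ) (by rw [h1]; exact hr.1) (by rw [h1]; exact hr.2)
  exact (h3.contDiffAt_symm he h2).continuousAt

theorem tendsto_circ_add (he : e ∈ holAtlas X) (hp : p ∈ e.source)
    (ha : ∀ᶠ x in 𝓝[≠] p, FormSmoothAt a x) (hb : ∀ᶠ x in 𝓝[≠] p, FormSmoothAt b x) {L M : ℂ}
    (hL : Tendsto (circ (inChart a e) (e p)) (𝓝[>] 0) (𝓝 L))
    (hM : Tendsto (circ (inChart b e) (e p)) (𝓝[>] 0) (𝓝 M)) :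
    Tendsto (circ (inChart (a + b) e) (e p)) (𝓝[>] 0) (𝓝 (L + M)) := by
  refine (hL.add hM).congr' ?_
  filter_upwards [eventually_continuousAt_circle he hp ha, eventually_continuousAt_circle he hp hb]
    with r h1 h2
  unfold circ
  rw [← intervalIntegral.integral_add (intervalIntegrable_circ h1) (intervalIntegrable_circ h2)]
  simp only [inChart_add, add_apply]

theorem tendsto_circ_sub (he : e ∈ holAtlas X) (hp : p ∈ e.source)
    (ha : ∀ᶠ x in 𝓝[≠] p, FormSmoothAt a x) (hb : ∀ᶠ x in 𝓝[≠] p, FormSmoothAt b x) {L M : ℂ}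
    (hL : Tendsto (circ (inChart a e) (e p)) (𝓝[>] 0) (𝓝 L))
    (hM : Tendsto (circ (inChart b e) (e p)) (𝓝[>] 0) (𝓝 M)) :
    Tendsto (circ (inChart (a - b) e) (e p)) (𝓝[>] 0) (𝓝 (L - M)) := by
  refine (hL.sub hM).congr' ?_
  filter_upwards [eventually_continuousAt_circle he hp ha, eventually_continuousAt_circle he hp hb]
    with r h1 h2
  unfold circ
  rw [← intervalIntegral.integral_sub (intervalIntegrable_circ h1) (intervalIntegrable_circ h2)]
  simp only [inChart_sub, sub_apply]

theorem tendsto_circ_of_smooth (he : e ∈ holAtlas X) (hp : p ∈ e.source) (ha : FormSmoothAt a p) :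
    Tendsto (circ (inChart a e) (e p)) (𝓝[>] 0) (𝓝 0) :=
  tendsto_circ_zero (ha.contDiffAt he hp).continuousAt

theorem tendsto_circ_congr (hp : p ∈ e.source) (h : ∀ᶠ x in 𝓝[≠] p, a x = b x) {L : ℂ}
    (hL : Tendsto (circ (inChart a e) (e p)) (𝓝[>] 0) (𝓝 L)) :
    Tendsto (circ (inChart b e) (e p)) (𝓝[>] 0) (𝓝 L) := by
  obtain ⟨R, hR, h1⟩ := punctured_ball_of_eventually hp h
  exact hL.congr' (circ_congr hR fun w h2 h3 => inChart_congr (h1 w h2 h3).2)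

end CircLimits

/-! ### Adding regular points to the singular set -/

section Enlarge

set_option linter.unusedSectionVars false

variable {Y : Type*} [TopologicalSpace Y] [ChartedSpace ℂ Y] [T2Space Y] [CompactSpace Y]
  [IsManifold 𝓘(ℂ) ω Y] {κ : Type*} {Q : CircleBundle κ Y univ} {F : Finset Y}
  {s : κ → Y → Circle}

/-- With `q` the identity, the index is, up to `2πi`, a limit of circulations of `dlog (s a)`, a
form that is smooth at `y`. -/
theorem CircleBundle.IsSection.hasIndex_zero (hs : Q.IsSection (F : Set Y)ᶜ s) {y : Y}
    (hy : y ∉ F) : Q.HasIndex s y 0 := by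
  obtain ⟨N, hN⟩ := hs.exists_hasIndex y
  suffices h : N = 0 by rwa [h] at hN
  obtain ⟨a, ha, h⟩ := tendsto_circ_dlog_pullback (q := fun x : Y => x) hs
    ((Diffeomorph.refl 𝓘(ℂ) Y ω).isLocalDiffeomorph y) hN
  have h1 := h (chartAt ℂ y) (chart_mem_holAtlas y) (mem_chart_source ℂ y)
  have h2 : FormSmoothAt (dlog (s a)) y := by
    refine formSmoothAt_dlog ?_
    filter_upwards [Q.eventually_base ha, eventually_notMem_finset hy] with x h2 h3
    exact smoothAt_section hs h2 h3
  have h3 := tendsto_nhds_unique h1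
    (tendsto_circ_of_smooth (chart_mem_holAtlas y) (mem_chart_source ℂ y) h2)
  have h4 : (2 * Real.pi * Complex.I : ℂ) ≠ 0 := Complex.two_pi_I_ne_zero
  exact_mod_cast (mul_eq_zero.1 h3).resolve_left h4

/-- Regular points may be added to the singular set of a section. -/
theorem CircleBundle.HasDegree.exists_superset {d : ℤ} (h : Q.HasDegree d) (G : Finset Y) :
    ∃ (F : Finset Y) (s : κ → Y → Circle) (N : Y → ℤ), G ⊆ F ∧ Q.IsSection (F : Set Y)ᶜ s ∧
      (∀ x ∈ F, Q.HasIndex s x (N x)) ∧ d = ∑ x ∈ F, N x := by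
  classical
  obtain ⟨F, s, N, hs, hN, hd⟩ := h
  have hsub : ((F ∪ G : Finset Y) : Set Y)ᶜ ⊆ (F : Set Y)ᶜ :=
    compl_subset_compl.2 (by exact_mod_cast Finset.subset_union_left)
  refine ⟨F ∪ G, s, fun x => if x ∈ F then N x else 0, Finset.subset_union_right,
    ⟨fun i => (hs.1 i).mono (inter_subset_inter_right _ hsub),
      fun i j x hx => hs.2 i j x ⟨hx.1, hsub hx.2⟩⟩, fun x _ => ?_, ?_⟩
  · by_cases hx : x ∈ F
    · simpa [hx] using hN x hx
    · simpa [hx] using hs.hasIndex_zero hx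
  · rw [hd, ← Finset.sum_subset (Finset.subset_union_left (s₁ := F) (s₂ := G))]
    · exact Finset.sum_congr rfl fun x hx => by simp [hx]
    · intro x _ hx
      simp [hx]

end Enlarge

/-! ### Limits at the singular points and the degree formula -/

section Limits

set_option linter.unusedSectionVars false

variable {X : Type*} [TopologicalSpace X] [ChartedSpace ℂ X] {n k : ℕ}
  {C : MarkedNodalCurve X n k} {D : CoordDisks C} {ι : Type*} {P : CircleBundle ι X C.regular}
  {T : Framing D P} {Y : Type*} [TopologicalSpace Y] [ChartedSpace ℂ Y]
  {S : Smoothing D Y} {κ : Type*} {Q : CircleBundle κ Y univ} (E : Extension T S Q)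
  {F : Finset Y} {s : κ → Y → Circle} [IsManifold 𝓘(ℂ) ω X] [IsManifold 𝓘(ℂ) ω Y]
  [T2Space X] [T2Space Y] [CompactSpace X] [CompactSpace Y]

/-- The residue is a `limUnder`, meaningful only once the limit exists. Existence is always supplied
by `residue_theorem`, through the integrability of the derivative. -/
theorem Framing.residue_of_tendsto (A : Connection P) {t : Fin n ⊕ Fin k × Bool} {L : ℂ}
    (h : Tendsto (circ (inChart (A.formIn (T.triv t)) (D.z t)) (D.z t (C.point t))) (𝓝[>] 0)
      (𝓝 L)) : 2 * Real.pi * T.residue A t = L := by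
  rw [D.map_point] at h
  have h1 : T.residue A t = (1 / (2 * Real.pi) : ℂ) * L := by
    unfold Framing.residue Connection.residue
    exact (h.const_mul _).limUnder_eq
  have h2 : (2 * Real.pi : ℂ) ≠ 0 := by exact_mod_cast Real.two_pi_pos.ne'
  rw [h1]
  field_simp

/-- Near the preimage of a node the cut-off is `0`, so the global form is the connection form in the
given trivialisation. -/
theorem Extension.branch_limit (A : Connection P) (R : NeckRadii S F) {j : Fin k × Bool} {L : ℂ}
    (h : Tendsto (circ (inChart (E.globalForm A s R) (D.z (Sum.inr j)))
      (D.z (Sum.inr j) (C.point (Sum.inr j)))) (𝓝[>] 0) (𝓝 L)) :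
    2 * Real.pi * T.residue A (Sum.inr j) = L := by
  refine Framing.residue_of_tendsto A (tendsto_circ_congr (D.mem_source _) ?_ h)
  have h1 := ringForm_eventually_zero (g := E.coord s (Sum.inr j)) (R.lt j)
    (D.mem_source (Sum.inr j)) (by rw [D.map_point, norm_zero]; exact (R.inner_pos j).le)
  refine Filter.Eventually.filter_mono nhdsWithin_le_nhds ?_
  filter_upwards [h1, E.globalForm_eventually_disk (s := s) A R (D.mem_source (Sum.inr j))]
    with x h2 h3
  rw [h3, Pi.add_apply]
  unfold Extension.twist
  rw [h2]
  exact add_zero _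

/-- A punctured neighbourhood of a point away from the nodes lies in the domain of the pulled back
trivialisation. -/
theorem NeckRadii.eventually_pullDomain (R : NeckRadii S F) {p : X} (hp : p ∈ D.outside R.outer) :
    ∀ᶠ x in 𝓝[≠] p, x ∈ D.outside R.outer ∧ x ∈ pullDomain S F := by
  classical
  have h1 := eventually_notMem_finset (Finset.notMem_erase p (Finset.univ.image C.point))
  have h2 := (tendsto_punctured_of_localBiholomorphism
    (S.localDiffeomorphAt (R.outside_subset hp))).eventually
      (eventually_nhdsWithin_of_eventually_nhds
        (eventually_notMem_finset (Finset.notMem_erase (S.q p) F)))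
  have h3 := (tendsto_punctured_of_localBiholomorphism
    (S.localDiffeomorphAt (R.outside_subset hp))).eventually self_mem_nhdsWithin
  filter_upwards [nhdsWithin_le_nhds (R.isOpen_outside.mem_nhds hp),
    eventually_nhdsWithin_of_eventually_nhds h1, h2, h3, self_mem_nhdsWithin] with x h4 h5 h6 h7 h8
  refine ⟨h4, ⟨R.outside_subset h4, ?_⟩, fun h => h6 (Finset.mem_erase.2 ⟨h7, h⟩)⟩
  rintro ⟨t, rfl⟩
  exact h5 (Finset.mem_erase.2 ⟨h8, Finset.mem_image.2 ⟨t, Finset.mem_univ _, rfl⟩⟩)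

theorem eventually_formSmoothAt_pullback (hs : Q.IsSection (F : Set Y)ᶜ s) {a : κ} {p : X}
    (hp : p ∈ D.truncated S.ε) (ha : S.q p ∈ Q.base a) :
    ∀ᶠ x in 𝓝[≠] p, FormSmoothAt (dlog fun x => s a (S.q x)) x := by
  have h1 : ∀ᶠ x in 𝓝[≠] p, SmoothCircleAt (fun x => s a (S.q x)) x := by
    filter_upwards [(tendsto_punctured_of_localBiholomorphism
        (S.localDiffeomorphAt hp)).eventually (hs.eventually_smoothAt ha),
      nhdsWithin_le_nhds (eventually_localDiffeomorphAt (S.localDiffeomorphAt hp))] with x h1 h2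
    exact h1.comp_localBiholomorphism h2
  exact (eventually_punctured_nhds h1).mono fun x hx => formSmoothAt_dlog hx

/-- The limit circulation of the global form at an unmarked singular point of the section. -/
theorem Extension.regular_limit (A : Connection P) (hs : Q.IsSection (F : Set Y)ᶜ s)
    (R : NeckRadii S F) {p : X} (hp : p ∈ D.outside R.outer) (hreg : p ∈ C.regular) {N : ℤ}
    (hN : Q.HasIndex s (S.q p) N) {e : OpenPartialHomeomorph X ℂ} (he : e ∈ holAtlas X)
    (hpe : p ∈ e.source) :
    Tendsto (circ (inChart (E.globalForm A s R) e) (e p)) (𝓝[>] 0)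
      (𝓝 (2 * Real.pi * Complex.I * N)) := by
  have htr := R.outside_subset hp
  obtain ⟨a, ha, hlim⟩ := tendsto_circ_dlog_pullback hs (S.localDiffeomorphAt htr) hN
  obtain ⟨i, hi⟩ := P.exists_base hreg
  have hu : ∀ᶠ x in 𝓝 p, SmoothCircleAt (E.u i a) x := by
    filter_upwards [S.isOpen_truncated.mem_nhds htr, P.eventually_base hi,
      (S.continuousAt htr).eventually (Q.eventually_base ha)] with x h1 h2 h3
    exact E.smoothAt_u h1 h2 h3
  -- Around `p` the global form is this form, smooth also at `p`, plus `dlog` of the pulled back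
  -- section; only the latter contributes to the limit.
  have hsm : ∀ᶠ x in 𝓝 p, FormSmoothAt (A.form i - dlog (E.u i a)) x := by
    filter_upwards [hu.eventually_nhds, P.eventually_base hi] with x h1 h2
    exact (A.formSmoothAt h2).sub (formSmoothAt_dlog h1)
  have h := tendsto_circ_add he hpe (eventually_nhdsWithin_of_eventually_nhds hsm)
    (eventually_formSmoothAt_pullback hs htr ha)
    (tendsto_circ_of_smooth he hpe hsm.self_of_nhds) (hlim e he hpe)
  rw [zero_add] at h
  refine tendsto_circ_congr hpe ?_ h
  filter_upwards [R.eventually_pullDomain hp,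
    eventually_nhdsWithin_of_eventually_nhds (P.eventually_base hi),
    eventually_nhdsWithin_of_eventually_nhds
      ((S.continuousAt htr).eventually (Q.eventually_base ha))] with x h1 h2 h3
  have hsx := smoothAt_section_comp hs h1.2.1.1 h3 h1.2.2
  rw [E.globalForm_outside A hs R h1.1 h1.2,
    A.formIn_eq (E.isTrivialisation_pullTriv hs) (isOpen_pullDomain S F) h2 h1.2,
    dlog_congr (E.pullTriv_eventuallyEq hs h1.2 h2 h3),
    dlog_mul (E.smoothAt_u h1.2.1.1 h2 h3) hsx.inv, dlog_inv hsx]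
  simp only [Pi.add_apply, Pi.sub_apply]
  abel

/-- The limit circulation of the global form at a marked point. -/
theorem Extension.mark_limit (A : Connection P) (hs : Q.IsSection (F : Set Y)ᶜ s)
    (R : NeckRadii S F) {m : Fin n} {N : ℤ}
    (hN : Q.HasIndex s (S.q (C.mark m)) N) {L : ℂ}
    (hL : Tendsto (circ (inChart (E.globalForm A s R) (D.z (Sum.inl m)))
      (D.z (Sum.inl m) (C.mark m))) (𝓝[>] 0) (𝓝 L)) :
    L = 2 * Real.pi * Complex.I * N + 2 * Real.pi * T.residue A (Sum.inl m) := by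
  set z := D.z (Sum.inl m)
  set p := C.mark m
  have he : z ∈ holAtlas X := D.holomorphic _
  have hpe : p ∈ z.source := D.mem_source (Sum.inl m)
  have hp : p ∈ D.outside R.outer := D.mark_mem_outside _ hpe
  have htr := R.outside_subset hp
  obtain ⟨a, ha, hlim⟩ := tendsto_circ_dlog_pullback hs (S.localDiffeomorphAt htr) hN
  obtain ⟨v, hv, hvu⟩ := E.mark m a
  have hbase : ∀ᶠ x in 𝓝 p, x ∈ z.source ∧ S.q x ∈ Q.base a ∧ x ∈ D.truncated S.ε := by
    filter_upwards [z.open_source.mem_nhds hpe, S.isOpen_truncated.mem_nhds htr,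
      (S.continuousAt htr).eventually (Q.eventually_base ha)] with x h1 h2 h3
    exact ⟨h1, h3, h2⟩
  have hvs : ∀ᶠ x in 𝓝 p, SmoothCircleAt v x := by
    filter_upwards [hbase.eventually_nhds] with x h1
    refine hv.smoothCircleAt ?_
    filter_upwards [h1] with y h2
    exact ⟨h2.1, h2.2.1⟩
  have hvf : ∀ᶠ x in 𝓝 p, FormSmoothAt (dlog v) x :=
    hvs.eventually_nhds.mono fun x hx => formSmoothAt_dlog hx
  have hg : ∀ᶠ x in 𝓝[≠] p, FormSmoothAt (E.globalForm A s R) x := by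
    filter_upwards [R.eventually_pullDomain hp] with x h1
    exact (A.formIn_smoothAt (E.isTrivialisation_pullTriv hs) (isOpen_pullDomain S F) h1.2.1.2
      h1.2).congr (E.globalForm_eventually_outside A hs R h1.1 h1.2)
  have hvf' := eventually_nhdsWithin_of_eventually_nhds (s := {p}ᶜ) hvf
  -- The connection form in the given trivialisation is the global form plus `dlog v` minus `dlog`
  -- of the pulled back section. The function `v` is smooth through the marked point, because the
  -- trivialisation extends there, so its term has limit zero.
  have h := tendsto_circ_sub he hpe ((hg.and hvf').mono fun x hx => hx.1.add hx.2)
    (eventually_formSmoothAt_pullback hs htr ha)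
    (tendsto_circ_add he hpe hg hvf' hL (tendsto_circ_of_smooth he hpe hvf.self_of_nhds))
    (hlim z he hpe)
  rw [add_zero] at h
  have hres := Framing.residue_of_tendsto (T := T) A (t := Sum.inl m)
    (L := L - 2 * Real.pi * Complex.I * N) ?_
  · rw [hres]
    ring
  refine tendsto_circ_congr (D.mem_source _) ?_ h
  change ∀ᶠ x in 𝓝[≠] p, _
  filter_upwards [R.eventually_pullDomain hp, self_mem_nhdsWithin, hvf',
    eventually_nhdsWithin_of_eventually_nhds hvs,
    eventually_nhdsWithin_of_eventually_nhds hbase.eventually_nhds] with x h1 h2 h3 h4 h5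
  have hpd : x ∈ puncturedDisk D (Sum.inl m) := ⟨h5.self_of_nhds.1, h2⟩
  have hsx := smoothAt_section_comp hs h1.2.1.1 h5.self_of_nhds.2.1 h1.2.2
  have hcoord : E.coord s (Sum.inl m) =ᶠ[𝓝 x] fun x => (v x)⁻¹ * s a (S.q x) := by
    filter_upwards [(isOpen_pullDomain S F).mem_nhds h1.2,
      (isOpen_puncturedDisk (D := D) (Sum.inl m)).mem_nhds hpd, h5] with y h6 h7 h8
    obtain ⟨i, hi⟩ := P.exists_base h6.1.2
    rw [E.coord_eq hs h6 h7 hi h8.2.1, hvu i y h7.1 hi h8.2.1]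
  simp only [Pi.add_apply, Pi.sub_apply]
  rw [E.globalForm_outside A hs R h1.1 h1.2, E.formIn_pullTriv A hs h1.2 hpd, dlog_congr hcoord,
    dlog_mul h4.inv hsx, dlog_inv h4]
  abel

open Classical in
/-- The given coordinate at a marked point or a preimage of a node, and any chart elsewhere. -/
def CoordDisks.chart (D : CoordDisks C) (p : X) : OpenPartialHomeomorph X ℂ :=
  if h : ∃ t, C.point t = p then D.z (Classical.choose h) else chartAt ℂ p

theorem CoordDisks.chart_point (D : CoordDisks C) (t : Fin n ⊕ Fin k × Bool) :
    D.chart (C.point t) = D.z t := by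
  have h : ∃ t', C.point t' = C.point t := ⟨t, rfl⟩
  unfold CoordDisks.chart
  rw [dif_pos h, C.injective (Classical.choose_spec h)]

theorem CoordDisks.chart_mem (D : CoordDisks C) (p : X) :
    D.chart p ∈ holAtlas X ∧ p ∈ (D.chart p).source := by
  by_cases h : ∃ t, C.point t = p
  · obtain ⟨t, rfl⟩ := h
    rw [D.chart_point]
    exact ⟨D.holomorphic t, D.mem_source t⟩
  · unfold CoordDisks.chart
    rw [dif_neg h]
    exact ⟨chart_mem_holAtlas p, mem_chart_source ℂ p⟩

theorem Extension.degree_formula (E : Extension T S Q) (A : Connection P) (hA : T.IsMeromorphic A) {d : ℤ}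
    (hd : Q.HasDegree d) :
    (d : ℂ) = Complex.I / (2 * Real.pi) * surfaceIntegral (X := X) A.curvature +
      Complex.I * ∑ m : Fin n, T.residue A (Sum.inl m) := by
  classical
  -- The images of the marked points are put into the singular set, so that the only points off the
  -- singular set of the global form are points where `P` is defined.
  obtain ⟨F, s, N, hFm, hs, hN, rfl⟩ :=
    hd.exists_superset (Finset.univ.image fun m => S.q (C.mark m))
  have hF : ∀ m, S.q (C.mark m) ∈ F := fun m =>
    hFm (Finset.mem_image.2 ⟨m, Finset.mem_univ _, rfl⟩)
  obtain ⟨R⟩ := exists_neckRadii S F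
  obtain ⟨hInt, hval⟩ := E.integral_dForm_globalForm A hA.1 hs R hF
  obtain ⟨L, hL, hsum⟩ := residue_theorem R.singular (E.globalForm A s R)
    (fun p hp => E.formSmoothAt_globalForm A hs R hF hp) hInt D.chart
    (fun p _ => (D.chart_mem p).1) (fun p _ => (D.chart_mem p).2)
  rw [hval] at hsum
  have hinj : Function.Injective C.point := C.injective
  have hout : ∀ j, C.point (Sum.inr j) ∉ D.outside R.outer := by
    intro j h
    have h4 := h j (D.mem_source (Sum.inr j))
    rw [D.map_point, norm_zero] at h4
    exact absurd ((R.inner_pos j).trans (R.lt j)) h4.not_gt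
  have hsub : ∀ p ∈ R.finite_singularSet.toFinset, p ∈ R.singular := fun p hp =>
    Finset.mem_union_right _ hp
  have hbr : ∀ j, C.branch j ∈ R.singular := fun j =>
    Finset.mem_union_left _ (Finset.mem_image.2 ⟨j, Finset.mem_univ _, rfl⟩)
  have hLb : ∀ j, L (C.branch j) = 2 * Real.pi * T.residue A (Sum.inr j) := by
    intro j
    refine (E.branch_limit (s := s) A R ?_).symm
    have h1 := hL _ (hbr j)
    rwa [show C.branch j = C.point (Sum.inr j) from rfl, D.chart_point] at h1
  -- Marked and unmarked points are treated together: the marked points are distinct, so the sum has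
  -- at most one nonzero term.
  have hLs : ∀ p ∈ R.finite_singularSet.toFinset, L p = 2 * Real.pi * Complex.I * N (S.q p) +
      ∑ m, if C.mark m = p then 2 * Real.pi * T.residue A (Sum.inl m) else 0 := by
    intro p hp
    have h1 := hL p (hsub p hp)
    obtain ⟨h2, h3⟩ := R.finite_singularSet.mem_toFinset.1 hp
    by_cases hreg : p ∈ C.regular
    · rw [tendsto_nhds_unique h1 (E.regular_limit A hs R h2 hreg (hN _ h3) (D.chart_mem p).1
        (D.chart_mem p).2), Finset.sum_eq_zero, add_zero]
      intro m _
      rw [if_neg]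
      rintro rfl
      exact hreg ⟨Sum.inl m, rfl⟩
    · obtain ⟨t, rfl⟩ := not_not.1 hreg
      rw [D.chart_point] at h1
      rcases t with m | j
      · rw [E.mark_limit A hs R (hN _ (hF m)) h1, Finset.sum_eq_single m]
        · rw [if_pos (show C.mark m = C.point (Sum.inl m) from rfl)]
          rfl
        · intro m' _ hm'
          refine if_neg fun h => hm' ?_
          exact Sum.inl.inj (hinj (h : C.point (Sum.inl m') = C.point (Sum.inl m)))
        · intro h
          exact absurd (Finset.mem_univ m) h
      · exact absurd h2 (hout j)
  have hdisj : Disjoint (Finset.univ.image C.branch) R.finite_singularSet.toFinset := by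
    rw [Finset.disjoint_left]
    intro p hp hp'
    obtain ⟨j, -, rfl⟩ := Finset.mem_image.1 hp
    exact hout j (R.finite_singularSet.mem_toFinset.1 hp').1
  have hsb : ∑ p ∈ Finset.univ.image C.branch, L p = 0 := by
    have hbi : Function.Injective C.branch := fun j j' h =>
      Sum.inr.inj (hinj (h : C.point (Sum.inr j) = C.point (Sum.inr j')))
    rw [Finset.sum_image hbi.injOn]
    simp only [hLb]
    rw [← Finset.mul_sum, Fintype.sum_prod_type, Finset.sum_eq_zero, mul_zero]
    intro l _
    rw [Fintype.sum_bool, add_comm]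
    exact hA.2 l
  -- The map `q` is a bijection from the retained singular points onto `F`, so each index is counted
  -- once.
  have hsN : ∑ p ∈ R.finite_singularSet.toFinset, (N (S.q p) : ℂ) = ∑ y ∈ F, (N y : ℂ) := by
    refine Finset.sum_nbij S.q (fun p hp => (R.finite_singularSet.mem_toFinset.1 hp).2) ?_ ?_
      fun _ _ => rfl
    · simpa using R.injOn_singularSet
    · simpa using R.surjOn_singularSet
  have hsm : ∑ p ∈ R.finite_singularSet.toFinset, L p =
      2 * Real.pi * Complex.I * ∑ y ∈ F, (N y : ℂ) +
        2 * Real.pi * ∑ m : Fin n, T.residue A (Sum.inl m) := by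
    rw [Finset.sum_congr rfl hLs, Finset.sum_add_distrib, ← Finset.mul_sum, hsN, Finset.sum_comm]
    congr 1
    rw [Finset.mul_sum]
    refine Finset.sum_congr rfl fun m _ => ?_
    rw [Finset.sum_ite_eq, if_pos]
    exact R.finite_singularSet.mem_toFinset.2
      ⟨D.mark_mem_outside _ (D.mem_source (Sum.inl m)), hF m⟩
  unfold NeckRadii.singular at hsum
  rw [Finset.sum_union hdisj, hsb, hsm, zero_add] at hsum
  have hpi : (Real.pi : ℂ) ≠ 0 := by exact_mod_cast Real.pi_ne_zero
  push_cast
  field_simp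
  have hI := Complex.I_sq
  linear_combination (-Complex.I) * hsum + (2 * Real.pi * ∑ y ∈ F, (N y : ℂ)) * hI

end Limits

end

end ChernWeil

theorem mainTheorem9
    {X : Type*} [TopologicalSpace X] [T2Space X] [CompactSpace X] [ChartedSpace ℂ X]
    [IsManifold 𝓘(ℂ) ω X] {n k : ℕ} (C : ChernWeil.MarkedNodalCurve X n k)
    {ι : Type*} (P : ChernWeil.CircleBundle ι X C.regular)
    (D : ChernWeil.CoordDisks C) (T : ChernWeil.Framing D P)
    (A : ChernWeil.Connection P) (hA : T.IsMeromorphic A)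
    {Y : Type*} [TopologicalSpace Y] [T2Space Y] [CompactSpace Y] [ChartedSpace ℂ Y]
    [IsManifold 𝓘(ℂ) ω Y] (S : ChernWeil.Smoothing D Y)
    {κ : Type*} (Q : ChernWeil.CircleBundle κ Y univ) (E : ChernWeil.Extension T S Q) :
    (Q.degree : ℂ) =
      Complex.I / (2 * Real.pi) * ChernWeil.surfaceIntegral (X := X) A.curvature +
        Complex.I * ∑ m : Fin n, T.residue A (Sum.inl m) := by
  -- The formula holds for every integer satisfying `HasDegree`, so the choice made in `degree` does
  -- not matter; existence of such an integer excludes the default value `0`.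
  refine E.degree_formula A hA ?_
  have h := Q.exists_hasDegree
  unfold ChernWeil.CircleBundle.degree
  rw [dif_pos h]
  exact Classical.choose_spec h
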